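/- **Theorem (Reconstruction of the condensate).** Fix $d>0$ (pair extension), $\beta>0$ (inverse temperature), $\alpha\ge 0$ (surface tension), $\lambda>0$ (strength of the surface repulsion) and $\delta>0$. *Bulk.* For $L>0$ let $\Omega_L=\{(x,y)\in[0,L]^2 : |x-y|\le d\}$ and let $H_p^L$ be the self-adjoint operator on $L^2_a(\Omega_L)=\{\varphi\in L^2(\Omega_L):\varphi(x,y)=-\varphi(y,x)\}$ associated with the quadratic form $\varphi\mapsto\int_{\Omega_L}|\nabla\varphi|^2$ whose domain consists of the antisymmetric $\varphi\in H^1(\Omega_L)$ with zero trace on the part of $\partial\Omega_L$ inside the open quadrant $(0,\infty)^2$, i.e. on the segments $|x-y|=d$, $x=L$, $y=L$ (no condition is imposed on the axes $x=0$, $y=0$). Let $E_0(L)\le E_1(L)\le\cdots$ be its eigenvalues, counted with multiplicity. *Surface.* For a sequence $(e_i)_{i\ge 0}$ in $[0,\infty)$ and $N\in\mathbb N$ let $\mathcal L_N$ be the weighted graph Laplacian on $\mathbb C^N$ of the path with vertices $0,\dots,N-1$ and weight $\gamma_{i,i+1}=\gamma_{i+1,i}=e_i$ on the edge $\{i,i+1\}$,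 $(\mathcal L_Nf)(i)=\sum_j\gamma_{ij}(f(i)-f(j))$, with eigenvalues $\lambda_1,\dots,\lambda_N\ge0$ counted with multiplicity. Let $n(L)\in\mathbb N$ be the number of surface defects up to length $L$; for $N=n(L)$ write $\lambda_j=\lambda_j(L)$. There is $\rho_{crit}>0$, depending only on $\beta,\delta,\alpha,\lambda$ (and $d$), such that the following holds for every sequence $(e_i)$ in $[0,\infty)$, every $n(\cdot)$ with $\lim_{L\to\infty}L/n(L)=\delta$, and every pair density $\rho>\rho_{crit}$. Let $L_k>0$ with $L_k\to\infty$, and let $\mu_k\in\mathbb R$ (chemical potentials) and $s_k\ge0$ (surface pair densities) satisfy, for all $k$, $$\mu_k<\min\{\lambda s_k-\alpha,\;E_0(L_k)\},\qquad s_k=\frac1{n(L_k)}\sum_{j=1}^{n(L_k)}\frac1{e^{\beta[\lambda_j(L_k)-\alpha+\lambda s_k-\mu_k]}-1},$$ and $$\rho=\lim_{k\to\infty}\frac1{L_k}\left(\sum_{j=1}^{n(L_k)}\frac1{e^{\beta[\lambda_j(L_k)-\alpha+\lambda s_k-\mu_k]}-1}+\sum_{n=0}^\infty\frac1{e^{\beta(E_n(L_k)-\mu_k)}-1}\right).$$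 Then the bulk ground state is macroscopically occupied: with $$r_k:=\frac1{L_k}\,\frac1{e^{\beta(E_0(L_k)-\mu_k)}-1}$$ one has $\liminf_{k\to\infty}r_k>0$, and every subsequence of $(r_k)$ has a further subsequence that converges to a (finite) positive limit. In particular, $\lim_k r_k>0$ whenever this limit exists. -/

import Mathlib

open MeasureTheory Filter Topology
open scoped ContDiff

noncomputable section

namespace ElectronPairs

/-! ## The bulk: a bound pair of electrons on the wire of length `L` -/

/-- The open quadrant `(0,∞) × (0,∞)`, the configuration space of two particles on the half-line. -/
def quadrant : Set (ℝ × ℝ) := Set.Ioi 0 ×ˢ Set.Ioi 0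

/-- The complex Hilbert space `L²((0,∞)²)`. -/
abbrev L2Quadrant : Type := Lp ℂ 2 ((volume : Measure (ℝ × ℝ)).restrict quadrant)

/-- `Ω_L = {(x,y) : 0 ≤ x, y ≤ L, |x - y| ≤ d}`, the configuration space of a pair whose extension
is at most `d`, on the wire `[0,L]`. -/
def pairDomain (d L : ℝ) : Set (ℝ × ℝ) :=
  {p | 0 ≤ p.1 ∧ p.1 ≤ L ∧ 0 ≤ p.2 ∧ p.2 ≤ L ∧ |p.1 - p.2| ≤ d}

/-- `g = (g₁, g₂)` is the weak (distributional) gradient of `φ` on the open quadrant; so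
`∃ g, HasWeakGradient φ g` says that `φ ∈ H¹((0,∞)²)`. -/
def HasWeakGradient (φ : L2Quadrant) (g : L2Quadrant × L2Quadrant) : Prop :=
  ∀ η : ℝ × ℝ → ℝ, ContDiff ℝ ∞ η → HasCompactSupport η → tsupport η ⊆ quadrant →
    (∫ p in quadrant, (fderiv ℝ η p (1, 0) : ℂ) * φ p = - ∫ p in quadrant, (η p : ℂ) * g.1 p) ∧
    (∫ p in quadrant, (fderiv ℝ η p (0, 1) : ℂ) * φ p = - ∫ p in quadrant, (η p : ℂ) * g.2 p)

/-- `φ`, with weak gradient `g`, lies in the domain of the quadratic form `∫ |∇φ|²` of the pair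
Hamiltonian on `L²_a(Ω_L)`: it is an antisymmetric `H¹` function which vanishes where the binding
potential is infinite (`|x - y| > d`) and outside the wire (`x > L` or `y > L`). Equivalently,
`φ` is an antisymmetric element of `H¹(Ω_L)` with zero trace on the part of `∂Ω_L` in the open
quadrant; nothing is imposed on the axes `x = 0` and `y = 0` (natural boundary condition). -/
structure MemFormDomain (d L : ℝ) (φ : L2Quadrant) (g : L2Quadrant × L2Quadrant) : Prop where
  hasWeakGradient : HasWeakGradient φ g
  eq_zero_off : ∀ᵐ p ∂((volume : Measure (ℝ × ℝ)).restrict quadrant), p ∉ pairDomain d L → φ p = 0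
  antisymm : ∀ᵐ p ∂((volume : Measure (ℝ × ℝ)).restrict quadrant), φ p.swap = - φ p

/-- `φ` belongs to the eigenspace, for the value `E`, of the self-adjoint operator `H_p^L` on
`L²_a(Ω_L)` associated with the closed quadratic form `∫ |∇φ|²`: it lies in the form domain and
`⟨∇ψ, ∇φ⟩ = E ⟨ψ, φ⟩` for all `ψ` in the form domain. (The zero vector is included.) -/
def IsBulkEigenvector (d L E : ℝ) (φ : L2Quadrant) : Prop :=
  ∃ g : L2Quadrant × L2Quadrant, MemFormDomain d L φ g ∧
    ∀ (ψ : L2Quadrant) (h : L2Quadrant × L2Quadrant), MemFormDomain d L ψ h →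
      inner ℂ h.1 g.1 + inner ℂ h.2 g.2 = (E : ℂ) * inner ℂ ψ φ

/-- The eigenvalues `E_0(L) ≤ E_1(L) ≤ ⋯` of `H_p^L`, counted with multiplicity: `E_n(L)` is the
least `E` such that there are `n + 1` linearly independent eigenvectors whose eigenvalues are at
most `E`. -/
def bulkEigenvalue (d L : ℝ) (n : ℕ) : ℝ :=
  sInf {E : ℝ | ∃ (φ : Fin (n + 1) → L2Quadrant) (ε : Fin (n + 1) → ℝ),
    LinearIndependent ℂ φ ∧ ∀ i, IsBulkEigenvector d L (ε i) (φ i) ∧ ε i ≤ E}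

/-! ## The surface: a weighted path graph -/

/-- The edge weights `γ` of the path graph on `N` vertices; the edge joining the vertices `i` and
`i + 1` has weight `e i`. -/
def edgeWeight (e : ℕ → ℝ) {N : ℕ} (i j : Fin N) : ℝ :=
  if (i : ℕ) + 1 = j then e i else if (j : ℕ) + 1 = i then e j else 0

/-- The weighted graph Laplacian of the path graph on `N` vertices,
`(𝓛 f)(i) = ∑ j, γ i j * (f i - f j)`, as a matrix acting on `ℂ^N`. -/
def pathLaplacian (e : ℕ → ℝ) (N : ℕ) : Matrix (Fin N) (Fin N) ℂ :=
  Matrix.diagonal (fun i => ∑ j, (edgeWeight e i j : ℂ)) -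
    Matrix.of (fun i j => (edgeWeight e i j : ℂ))

theorem edgeWeight_comm (e : ℕ → ℝ) {N : ℕ} (i j : Fin N) :
    edgeWeight e i j = edgeWeight e j i := by
  unfold edgeWeight
  split_ifs <;> first | rfl | omega

theorem pathLaplacian_mulVec (e : ℕ → ℝ) (N : ℕ) (f : Fin N → ℂ) (i : Fin N) :
    (pathLaplacian e N).mulVec f i = ∑ j, (edgeWeight e i j : ℂ) * (f i - f j) := by
  rw [pathLaplacian, Matrix.sub_mulVec, Pi.sub_apply, Matrix.mulVec_diagonal]
  simp only [Matrix.mulVec, dotProduct, Matrix.of_apply, mul_sub, Finset.sum_sub_distrib,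
    Finset.sum_mul]

theorem pathLaplacian_isHermitian (e : ℕ → ℝ) (N : ℕ) : (pathLaplacian e N).IsHermitian := by
  refine Matrix.IsHermitian.sub ?_ ?_
  · refine Matrix.isHermitian_diagonal_of_self_adjoint _ ?_
    ext i
    simp
  · ext i j
    simp [Matrix.conjTranspose_apply, edgeWeight_comm e i j]

/-- The eigenvalues `λ_j` of the Laplacian of the path graph on `N` vertices, counted with
multiplicity. -/
def surfaceEigenvalue (e : ℕ → ℝ) (N : ℕ) (j : Fin N) : ℝ :=
  (pathLaplacian_isHermitian e N).eigenvalues j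

/-! ## Occupation numbers in the mean-field model -/

/-- The expected number of pairs in a one-pair state of energy `E` in the grand-canonical Gibbs
state at inverse temperature `β` and chemical potential `μ`. -/
def occupation (β μ E : ℝ) : ℝ := 1 / (Real.exp (β * (E - μ)) - 1)

/-- The total number of pairs on a surface of `N` sites, `∑ j, 1/(e^{β(λ_j - α + λ s - μ)} - 1)`,
when the mean-field repulsion is computed from the surface pair density `s`. -/
def surfaceNumber (β α lam : ℝ) (e : ℕ → ℝ) (N : ℕ) (μ s : ℝ) : ℝ :=
  ∑ j : Fin N, occupation β μ (surfaceEigenvalue e N j - α + lam * s)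

/-- The total number of pairs in the bulk, `∑ n, 1/(e^{β(E_n(L) - μ)} - 1)`. -/
def bulkNumber (β d L μ : ℝ) : ℝ := ∑' n : ℕ, occupation β μ (bulkEigenvalue d L n)

end ElectronPairs

end

noncomputable section

namespace ElectronPairs

/-! ## Closed quadratic forms as closed subspaces of a product of Hilbert spaces

A closed form `q` on `H` is described by a closed subspace `W` of `H × K`, the graph of a "gradient",
with `q (w.1) = ‖w.2‖ ^ 2` for `w ∈ W`. -/

section Forms

variable {H K : Type*} [NormedAddCommGroup H] [InnerProductSpace ℂ H]
  [NormedAddCommGroup K] [InnerProductSpace ℂ K]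

/-! The surface and the excited bulk states can hold only a bounded number of pairs per unit length,
uniformly in the length and in the chemical potential. If the total density exceeds these two
bounds, the excess must sit in the bulk ground state. Let `t = 2 (π / d) ^ 2`, the bottom of the
spectrum of the infinite strip `|x - y| < d` on antisymmetric functions.

Surface. For long wires the chemical potential is below `E_0(L) < t`. If `λ s` exceeded `t + α + 1`,
every surface level would lie at distance at least one above `μ` and hold at most `1 / (e ^ β - 1)`
pairs. Self-consistency therefore bounds `s` (`surfaceDensity_le`), and `L / n(L) → δ` turns this
into a bound per unit length.

Spectral gap. There is `γ > 0`, independent of `L`, with `E_0(L) ≤ t - γ`, while the higher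
eigenvalues are at least `t`. The upper bound comes from an explicit compactly supported trial
function that puts a little of the second transverse mode near the corner; its interference with the
first mode lowers the energy below the threshold (`exists_trial`). The lower bound
(`exists_functional_gap`) uses the even reflection across both axes, which respects the natural
boundary condition. In the coordinates `x - y`, `x + y` the extended function is odd in each
variable. On the corner square `|x - y|, |x + y| < d` the Neumann inequality then leaves one product
cosine mode below the threshold. On the remaining arm the function is odd in `x - y` and vanishes
beyond `|x - y| = d`, so there the form is already at least `t`. Thus the form is above `t` up to a
perturbation of rank one. This yields both the min-max bound for the higher eigenvalues and, with
the trial function, a minimizer (`exists_ground_state`).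

Counting. A Neumann inequality on the half strip, with cosine modes in `x - y` and `y`, shows that
`E_n(L)` grows at least linearly in `n / L` (`exists_le_bulkEigenvalue`). Since `μ ≤ t - γ`, the
occupation numbers of the excited states are dominated by a geometric series whose ratio differs
from one by order `1 / L`, so their sum is at most a constant times `L` (`exists_bulkNumber_le`).

Existence of a full sequence of eigenvalues is not needed. An empty index set in the definition of
`E_n` gives the default value zero. If the series of occupation numbers converges, such indices
contribute nothing. If it diverges, its sum is zero by convention, which the supercritical density
excludes. -/

theorem norm_sq_add_smul {V : Type*} [NormedAddCommGroup V] [InnerProductSpace ℂ V]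
    (x y : V) (s : ℝ) (B : ℂ) :
    ‖x + (-(s : ℂ) * B) • y‖ ^ 2
      = ‖x‖ ^ 2 - 2 * s * (starRingEnd ℂ B * inner ℂ y x).re + s ^ 2 * ‖B‖ ^ 2 * ‖y‖ ^ 2 := by
  rw [@norm_add_sq ℂ, norm_smul, inner_smul_right]
  have h1 : RCLike.re (-(s : ℂ) * B * inner ℂ x y) = - s * (starRingEnd ℂ B * inner ℂ y x).re := by
    rw [← inner_conj_symm x y]
    generalize (inner ℂ y x : ℂ) = z
    simp [Complex.mul_re, Complex.mul_im]
    ring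
  rw [h1, norm_mul, norm_neg, Complex.norm_real, Real.norm_eq_abs, mul_pow, mul_pow, sq_abs]
  ring

/-- A vector at which a form attains its lower bound is an eigenvector. -/
theorem inner_eq_of_isMinimizer (W : Submodule ℂ (H × K)) {E : ℝ}
    (hE : ∀ w ∈ W, E * ‖w.1‖ ^ 2 ≤ ‖w.2‖ ^ 2) {w : H × K} (hw : w ∈ W)
    (hwE : ‖w.2‖ ^ 2 = E * ‖w.1‖ ^ 2) {v : H × K} (hv : v ∈ W) :
    inner ℂ v.2 w.2 = (E : ℂ) * inner ℂ v.1 w.1 := by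
  set B : ℂ := inner ℂ v.2 w.2 - (E : ℂ) * inner ℂ v.1 w.1 with hB
  set M : ℝ := ‖v.2‖ ^ 2 - E * ‖v.1‖ ^ 2 with hM
  have hM0 : 0 ≤ M := sub_nonneg.2 (hE v hv)
  -- Moving from `w` by `-s B v` changes the excess of the form over `E` by `s ‖B‖ ^ 2 (s M - 2)`.
  -- Any positive `s` with `s M < 2` forces `B = 0`; the `+ 1` covers `M = 0`.
  set s : ℝ := 1 / (M + 1) with hs
  have hs0 : 0 < s := by positivity
  have key := hE _ (W.add_mem hw (W.smul_mem (-(s : ℂ) * B) hv))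
  simp only [Prod.fst_add, Prod.smul_fst, Prod.snd_add, Prod.smul_snd] at key
  rw [norm_sq_add_smul, norm_sq_add_smul] at key
  have hre : (starRingEnd ℂ B * inner ℂ v.2 w.2).re - E * (starRingEnd ℂ B * inner ℂ v.1 w.1).re
      = ‖B‖ ^ 2 := by
    have : starRingEnd ℂ B * B = ((‖B‖ ^ 2 : ℝ) : ℂ) := by
      rw [mul_comm, Complex.mul_conj, Complex.normSq_eq_norm_sq]
    have h2 := congrArg Complex.re this
    rw [Complex.ofReal_re] at h2
    rw [← h2]
    conv_rhs => rw [hB, mul_sub, Complex.sub_re]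
    congr 1
    rw [mul_left_comm, Complex.re_ofReal_mul]
  have h3 : 0 ≤ s * ‖B‖ ^ 2 * (s * M - 2) := by nlinarith
  have hsM : s * M - 2 ≤ -1 := by
    have : s * M ≤ 1 := by
      rw [hs, one_div, inv_mul_le_iff₀ (by positivity)]; linarith
    linarith
  have hB0 : ‖B‖ ^ 2 = 0 := by
    by_contra hne
    have : 0 < s * ‖B‖ ^ 2 := by positivity
    nlinarith
  exact sub_eq_zero.1 (norm_eq_zero.1 (pow_eq_zero_iff two_ne_zero |>.1 hB0))

theorem cauchySeq_of_norm_sub_sq {V : Type*} [NormedAddCommGroup V] {x : ℕ → V}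
    (hx : Tendsto (fun n : ℕ × ℕ => ‖x n.1 - x n.2‖ ^ 2) atTop (𝓝 0)) : CauchySeq x := by
  rw [cauchySeq_iff_tendsto_dist_atTop_0]
  simp only [dist_eq_norm]
  simpa [Real.sqrt_sq (norm_nonneg _)] using hx.sqrt

theorem norm_sq_sum_smul {V ι : Type*} [Fintype ι] [NormedAddCommGroup V] [InnerProductSpace ℂ V]
    (x : ι → V) (c : ι → ℂ) : ((‖∑ i, c i • x i‖ ^ 2 : ℝ) : ℂ)
      = ∑ i, ∑ j, starRingEnd ℂ (c i) * c j * inner ℂ (x i) (x j) := by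
  have := inner_self_eq_norm_sq_to_K (𝕜 := ℂ) (∑ i, c i • x i)
  push_cast
  rw [show ((‖∑ i, c i • x i‖ : ℝ) : ℂ) ^ 2 = _ from this.symm, sum_inner]
  refine Finset.sum_congr rfl fun i _ => ?_
  rw [inner_sum]
  refine Finset.sum_congr rfl fun j _ => ?_
  rw [inner_smul_left, inner_smul_right]
  ring

/-- A normalized minimizing sequence of a closed form which lies above `Λ > E` up to a perturbation
of rank one has a limit point. -/
theorem exists_minimizer_of_tendsto [CompleteSpace H] [CompleteSpace K] (W : Submodule ℂ (H × K))
    (hW : IsClosed (W : Set (H × K))) (ℓ : H →L[ℂ] ℂ) {C Λ E : ℝ} (hΛ : E < Λ)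
    (hgap : ∀ w ∈ W, Λ * ‖w.1‖ ^ 2 ≤ ‖w.2‖ ^ 2 + C * ‖ℓ w.1‖ ^ 2)
    (hE : ∀ w ∈ W, E * ‖w.1‖ ^ 2 ≤ ‖w.2‖ ^ 2)
    {u : ℕ → H × K} {r : ℕ → ℝ} (huW : ∀ n, u n ∈ W) (hu1 : ∀ n, ‖(u n).1‖ = 1)
    (hu2 : ∀ n, ‖(u n).2‖ ^ 2 = r n) (hr : Tendsto r atTop (𝓝 E)) :
    ∃ w ∈ W, ‖w.1‖ = 1 ∧ ‖w.2‖ ^ 2 = E := by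
  -- The scalars `ℓ (u n).1` are bounded, hence converge along a subsequence. As the perturbation
  -- has rank one, no other compactness is needed.
  obtain ⟨z, -, a, ha, hz⟩ := tendsto_subseq_of_bounded (s := Metric.closedBall (0 : ℂ) ‖ℓ‖)
    Metric.isBounded_closedBall (x := fun n => ℓ (u n).1) (fun n => by
      rw [mem_closedBall_zero_iff]
      simpa [hu1] using ℓ.le_opNorm (u n).1)
  have hra : Tendsto (fun n => r (a n)) atTop (𝓝 E) := hr.comp ha.tendsto_atTop
  -- the minimizing sequence is Cauchy
  have hdiff2 : ∀ k l, ‖(u k).2 - (u l).2‖ ^ 2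
      ≤ 2 * (r k - E) + 2 * (r l - E) + E * ‖(u k).1 - (u l).1‖ ^ 2 := by
    intro k l
    have h1 := parallelogram_law_with_norm ℂ (u k).1 (u l).1
    have h2 := parallelogram_law_with_norm ℂ (u k).2 (u l).2
    have h3 := hE _ (W.add_mem (huW k) (huW l))
    simp only [Prod.fst_add, Prod.snd_add] at h3
    rw [hu1, hu1] at h1
    have hk := hu2 k
    have hl := hu2 l
    have h4 : E * (‖(u k).1 + (u l).1‖ ^ 2 + ‖(u k).1 - (u l).1‖ ^ 2) = 4 * E := by
      rw [h1]; ring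
    linarith
  -- The gap inequality bounds the difference from below, the parallelogram bound from above;
  -- subtracting leaves the positive factor `Λ - E` on the left.
  have hdiff1 : ∀ k l, (Λ - E) * ‖(u k).1 - (u l).1‖ ^ 2
      ≤ 2 * (r k - E) + 2 * (r l - E) + C * ‖ℓ (u k).1 - ℓ (u l).1‖ ^ 2 := by
    intro k l
    have h1 := hgap _ (W.sub_mem (huW k) (huW l))
    simp only [Prod.fst_sub, Prod.snd_sub, map_sub] at h1
    have h2 := hdiff2 k l
    linarith
  have hfst : Tendsto (fun n : ℕ × ℕ => n.1) atTop atTop := by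
    rw [← prod_atTop_atTop_eq]; exact tendsto_fst
  have hsnd : Tendsto (fun n : ℕ × ℕ => n.2) atTop atTop := by
    rw [← prod_atTop_atTop_eq]; exact tendsto_snd
  have hb : Tendsto (fun n : ℕ × ℕ => 2 * (r (a n.1) - E) + 2 * (r (a n.2) - E)) atTop (𝓝 0) := by
    have h0 : Tendsto (fun n => 2 * (r (a n) - E)) atTop (𝓝 0) := by
      simpa using (hra.sub_const E).const_mul 2
    have h1 := (h0.comp hfst).add (h0.comp hsnd)
    rwa [add_zero] at h1
  have hc : Tendsto (fun n : ℕ × ℕ => C * ‖ℓ (u (a n.1)).1 - ℓ (u (a n.2)).1‖ ^ 2)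
      atTop (𝓝 0) := by
    have h1 := cauchySeq_iff_tendsto_dist_atTop_0.1 hz.cauchySeq
    simp only [Function.comp, dist_eq_norm] at h1
    simpa using (h1.pow 2).const_mul C
  have hd1 : Tendsto (fun n : ℕ × ℕ => ‖(u (a n.1)).1 - (u (a n.2)).1‖ ^ 2) atTop (𝓝 0) := by
    have hpos : 0 < Λ - E := by linarith
    have hlim := (hb.add hc).const_mul (Λ - E)⁻¹
    rw [add_zero, mul_zero] at hlim
    refine squeeze_zero (fun _ => by positivity) (fun n => ?_) hlim
    rw [← div_eq_inv_mul, le_div_iff₀ hpos, mul_comm]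
    exact hdiff1 _ _
  have hd2 : Tendsto (fun n : ℕ × ℕ => ‖(u (a n.1)).2 - (u (a n.2)).2‖ ^ 2) atTop (𝓝 0) := by
    have hlim := hb.add (hd1.const_mul E)
    rw [mul_zero, add_zero] at hlim
    exact squeeze_zero (fun _ => by positivity) (fun n => hdiff2 _ _) hlim
  obtain ⟨x, hx⟩ := cauchySeq_tendsto_of_complete
    (cauchySeq_of_norm_sub_sq (x := fun n => (u (a n)).1) hd1)
  obtain ⟨y, hy⟩ := cauchySeq_tendsto_of_complete
    (cauchySeq_of_norm_sub_sq (x := fun n => (u (a n)).2) hd2)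
  have hxy : (x, y) ∈ W :=
    hW.mem_of_tendsto (hx.prodMk_nhds hy) (Eventually.of_forall fun n => huW (a n))
  have hx1 : ‖x‖ = 1 := tendsto_nhds_unique hx.norm (by simp [hu1])
  have hy2 : ‖y‖ ^ 2 = E := tendsto_nhds_unique (hy.norm.pow 2) (by simpa [hu2] using hra)
  exact ⟨(x, y), hxy, hx1, hy2⟩

/-- If a closed form lies above `Λ` up to a perturbation of rank one, and takes a value at most
`Λ' < Λ`, then it has a minimizer, and this is an eigenvector. -/
theorem exists_ground_state [CompleteSpace H] [CompleteSpace K] (W : Submodule ℂ (H × K))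
    (hW : IsClosed (W : Set (H × K))) (ℓ : H →L[ℂ] ℂ) {C Λ Λ' : ℝ} (hΛ : Λ' < Λ)
    (hgap : ∀ w ∈ W, Λ * ‖w.1‖ ^ 2 ≤ ‖w.2‖ ^ 2 + C * ‖ℓ w.1‖ ^ 2)
    {ψ : H × K} (hψ : ψ ∈ W) (hψ1 : ψ.1 ≠ 0) (hψq : ‖ψ.2‖ ^ 2 ≤ Λ' * ‖ψ.1‖ ^ 2) :
    ∃ E ≤ Λ', ∃ w ∈ W, w.1 ≠ 0 ∧
      ∀ v ∈ W, inner ℂ v.2 w.2 = (E : ℂ) * inner ℂ v.1 w.1 := by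
  set S : Set ℝ := {r | ∃ w ∈ W, ‖w.1‖ = 1 ∧ ‖w.2‖ ^ 2 = r} with hS
  have hbdd : BddBelow S := ⟨0, by rintro r ⟨w, -, -, rfl⟩; positivity⟩
  have hnormalize : ∀ w ∈ W, w.1 ≠ 0 → ‖w.2‖ ^ 2 / ‖w.1‖ ^ 2 ∈ S := by
    intro w hw h0
    refine ⟨((‖w.1‖⁻¹ : ℝ) : ℂ) • w, W.smul_mem _ hw, ?_, ?_⟩
    · simp [norm_smul, h0]
    · simp only [Prod.smul_snd, norm_smul, Complex.norm_real, norm_inv, norm_norm]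
      field_simp
  have hne : S.Nonempty := ⟨_, hnormalize ψ hψ hψ1⟩
  set E := sInf S with hEdef
  have hE : ∀ w ∈ W, E * ‖w.1‖ ^ 2 ≤ ‖w.2‖ ^ 2 := by
    intro w hw
    by_cases h0 : w.1 = 0
    · simp [h0]
    · have := csInf_le hbdd (hnormalize w hw h0)
      rwa [le_div_iff₀ (by positivity)] at this
  have hEΛ' : E ≤ Λ' :=
    (csInf_le hbdd (hnormalize ψ hψ hψ1)).trans (by rwa [div_le_iff₀ (by positivity)])
  obtain ⟨r, -, hr, hrS⟩ := exists_seq_tendsto_sInf hne hbdd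
  choose u huW hu1 hu2 using hrS
  obtain ⟨w, hw, hw1, hw2⟩ := exists_minimizer_of_tendsto W hW ℓ (hEΛ'.trans_lt hΛ) hgap hE
    huW hu1 hu2 hr
  refine ⟨E, hEΛ', w, hw, ?_, fun v hv => ?_⟩
  · intro h0
    simp [h0] at hw1
  · exact inner_eq_of_isMinimizer W hE hw (by simp [hw1, hw2]) hv

/-- On the span of eigenvectors with eigenvalues at most `E`, the form is at most `E`. -/
theorem norm_sq_sum_le_of_eigenvectors {ι : Type*} [Fintype ι] (φ : ι → H) (g : ι → K)
    (ε : ι → ℝ) {E : ℝ} (hε : ∀ i, ε i ≤ E)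
    (h : ∀ i j, inner ℂ (g i) (g j) = (ε j : ℂ) * inner ℂ (φ i) (φ j)) (c : ι → ℂ) :
    ‖∑ i, c i • g i‖ ^ 2 ≤ E * ‖∑ i, c i • φ i‖ ^ 2 := by
  have horth : ∀ i j, ((ε i : ℂ) - ε j) * inner ℂ (φ i) (φ j) = 0 := by
    intro i j
    have h1 := h i j
    rw [← inner_conj_symm, h j i, map_mul, inner_conj_symm, Complex.conj_ofReal] at h1
    rw [sub_mul, h1, sub_self]
  -- Either the inner product vanishes or the two eigenvalues agree, so `E - ε j` splits
  -- symmetrically into two square roots.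
  have hsqrt : ∀ i j, ((√(E - ε i) : ℝ) : ℂ) * ((√(E - ε j) : ℝ) : ℂ) * inner ℂ (φ i) (φ j)
      = ((E : ℂ) - ε j) * inner ℂ (φ i) (φ j) := by
    intro i j
    rcases mul_eq_zero.1 (horth i j) with h0 | h0
    · have : ε i = ε j := by exact_mod_cast sub_eq_zero.1 h0
      rw [this, ← Complex.ofReal_mul, Real.mul_self_sqrt (by linarith [hε j])]
      push_cast
      ring
    · simp [h0]
  -- The defect is thereby a squared norm, even though the eigenvectors within one eigenspace need
  -- not be orthogonal.
  have key : ((E * ‖∑ i, c i • φ i‖ ^ 2 - ‖∑ i, c i • g i‖ ^ 2 : ℝ) : ℂ)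
      = ((‖∑ i, (c i * ((√(E - ε i) : ℝ) : ℂ)) • φ i‖ ^ 2 : ℝ) : ℂ) := by
    rw [norm_sq_sum_smul, Complex.ofReal_sub, Complex.ofReal_mul, norm_sq_sum_smul, norm_sq_sum_smul]
    rw [Finset.mul_sum, ← Finset.sum_sub_distrib]
    refine Finset.sum_congr rfl fun i _ => ?_
    rw [Finset.mul_sum, ← Finset.sum_sub_distrib]
    refine Finset.sum_congr rfl fun j _ => ?_
    rw [map_mul, Complex.conj_ofReal, h i j]
    linear_combination (-(starRingEnd ℂ (c i) * c j)) * hsqrt i j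
  have := Complex.ofReal_injective key
  nlinarith [sq_nonneg ‖∑ i, (c i * ((√(E - ε i) : ℝ) : ℂ)) • φ i‖]

/-- Min-max principle: if the form is at least `Λ` on the joint kernel of fewer functionals than
there are independent eigenvectors, then one of the eigenvalues is at least `Λ`. -/
theorem le_of_eigenvectors {ι κ : Type*} [Fintype ι] [Fintype κ] (W : Submodule ℂ (H × K))
    (ℓ : κ → H →ₗ[ℂ] ℂ) {Λ : ℝ} (hcard : Fintype.card κ < Fintype.card ι)
    (hΛ : ∀ w ∈ W, (∀ k, ℓ k w.1 = 0) → Λ * ‖w.1‖ ^ 2 ≤ ‖w.2‖ ^ 2)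
    (φ : ι → H) (g : ι → K) (ε : ι → ℝ) {E : ℝ} (hε : ∀ i, ε i ≤ E)
    (hind : LinearIndependent ℂ φ) (hmem : ∀ i, (φ i, g i) ∈ W)
    (h : ∀ i j, inner ℂ (g i) (g j) = (ε j : ℂ) * inner ℂ (φ i) (φ j)) : Λ ≤ E := by
  -- There are more coefficients than functionals, so some nontrivial combination of the
  -- eigenvectors is annihilated by all of them.
  let T : (ι → ℂ) →ₗ[ℂ] (κ → ℂ) := (LinearMap.pi ℓ).comp (Fintype.linearCombination ℂ φ)
  have hker : LinearMap.ker T ≠ ⊥ := by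
    refine LinearMap.ker_ne_bot_of_finrank_lt ?_
    simpa using hcard
  obtain ⟨c, hc, hc0⟩ := (Submodule.ne_bot_iff _).1 hker
  have hφ0 : (∑ i, c i • φ i) ≠ 0 := fun h0 =>
    hc0 (funext fun i => Fintype.linearIndependent_iff.1 hind c h0 i)
  have hw : ((∑ i, c i • φ i), (∑ i, c i • g i)) ∈ W := by
    have : ∑ i, c i • (φ i, g i) ∈ W := W.sum_mem fun i _ => W.smul_mem _ (hmem i)
    convert this using 1
    ext <;> simp [Prod.fst_sum, Prod.snd_sum]
  have hℓ : ∀ k, ℓ k (∑ i, c i • φ i) = 0 := fun k => by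
    have := congrFun (LinearMap.mem_ker.1 hc) k
    simpa [T, Fintype.linearCombination_apply] using this
  have h1 := hΛ _ hw hℓ
  have h2 := norm_sq_sum_le_of_eigenvectors φ g ε hε h c
  exact le_of_mul_le_mul_right (h1.trans h2) (by positivity)

end Forms

/-! ## Spectral inequalities in one dimension -/

open Set in
theorem fourierCoeffOn_symm_interval {h : ℝ} (hh : -h < h) (F : ℝ → ℂ) (n : ℤ) :
    fourierCoeffOn hh F n = (1 / (2 * h) : ℂ) *
      ∫ x in (-h)..h, (Real.cos (Real.pi * n * x / h) - Real.sin (Real.pi * n * x / h) * Complex.I)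
        * F x := by
  have h0 : h ≠ 0 := by linarith
  rw [fourierCoeffOn_eq_integral, show h - -h = 2 * h by ring, Complex.real_smul]
  congr 1
  · push_cast; rfl
  · refine intervalIntegral.integral_congr fun x _ => ?_
    simp only [smul_eq_mul]
    congr 1
    rw [fourier_coe_apply]
    have : (2 * Real.pi * Complex.I * ((-n : ℤ) : ℂ) * x / ((2 * h : ℝ) : ℂ))
        = ((-(Real.pi * n * x / h) : ℝ) : ℂ) * Complex.I := by
      have : (h : ℂ) ≠ 0 := by exact_mod_cast h0
      push_cast
      field_simp
    rw [this, Complex.exp_mul_I, ← Complex.ofReal_cos, ← Complex.ofReal_sin, Real.cos_neg,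
      Real.sin_neg]
    push_cast
    ring

/-- The inequality `‖F‖² ≤ (h / π m)² ‖F'‖² + ‖P_m F‖²` for periodic functions on `(-h, h)`, where
`P_m` projects to the Fourier modes below `m`; the derivative is expressed by its Fourier
coefficients. -/
theorem periodic_poincare {h : ℝ} (h0 : 0 < h) (hh : -h < h) {F G : ℝ → ℂ}
    (hF : MemLp F 2 (volume.restrict (Set.Ioc (-h) h)))
    (hG : MemLp G 2 (volume.restrict (Set.Ioc (-h) h)))
    (hrel : ∀ n : ℤ, fourierCoeffOn hh G n = ((Real.pi * n / h : ℝ) : ℂ) * Complex.I *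
      fourierCoeffOn hh F n) {m : ℕ} (hm : 0 < m) :
    ∫ x in (-h)..h, ‖F x‖ ^ 2 ≤ (h / (Real.pi * m)) ^ 2 * (∫ x in (-h)..h, ‖G x‖ ^ 2) +
      2 * h * ∑ n ∈ Finset.Ioo (-m : ℤ) m, ‖fourierCoeffOn hh F n‖ ^ 2 := by
  have hsF := hasSum_sq_fourierCoeffOn hh hF
  have hsG := hasSum_sq_fourierCoeffOn hh hG
  -- The finite projection is written as a series over all of `ℤ`, so that it can be compared term
  -- by term with the two Parseval series.
  have hsP : HasSum (fun n : ℤ => if n ∈ Finset.Ioo (-m : ℤ) m then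
      ‖fourierCoeffOn hh F n‖ ^ 2 else 0) _ :=
    hasSum_sum_of_ne_finset_zero (s := Finset.Ioo (-m : ℤ) m) (fun n hn => if_neg hn)
  rw [Finset.sum_congr rfl (fun n hn => if_pos hn)] at hsP
  have key := hasSum_le (fun n => ?_) hsF ((hsG.mul_left ((h / (Real.pi * m)) ^ 2)).add hsP)
  · rw [show h - -h = 2 * h by ring] at key
    simp only [smul_eq_mul] at key
    have := mul_le_mul_of_nonneg_left key (by positivity : 0 ≤ 2 * h)
    calc _ = 2 * h * ((2 * h)⁻¹ * ∫ x in (-h)..h, ‖F x‖ ^ 2) := by field_simp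
      _ ≤ _ := this
      _ = _ := by field_simp
  -- A low mode is dominated by the projection. A mode with `|n| ≥ m` is dominated by the
  -- derivative, whose weighted coefficient carries the factor `|n| / m ≥ 1`.
  · split_ifs with hn
    · have : 0 ≤ (h / (Real.pi * m)) ^ 2 * ‖fourierCoeffOn hh G n‖ ^ 2 := by positivity
      linarith
    · have hmn : (m : ℝ) ≤ |(n : ℝ)| := by
        have : (m : ℤ) ≤ |n| := by
          rw [Finset.mem_Ioo, ← abs_lt, not_lt] at hn
          exact hn
        exact_mod_cast this
      rw [hrel n, norm_mul, norm_mul, Complex.norm_I, Complex.norm_real, Real.norm_eq_abs, mul_one,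
        add_zero, mul_pow, ← mul_assoc, ← mul_pow]
      refine le_mul_of_one_le_left (by positivity) (one_le_pow₀ ?_)
      rw [abs_div, abs_mul, abs_of_pos Real.pi_pos, abs_of_pos h0]
      have hm' : (0 : ℝ) < m := by exact_mod_cast hm
      have : h / (Real.pi * m) * (Real.pi * |(n : ℝ)| / h) = |(n : ℝ)| / m := by
        have := Real.pi_pos
        field_simp
      rw [this, one_le_div hm']
      exact hmn

/-! ### Even and odd extensions and their Fourier coefficients -/

theorem intervalIntegral_symm {E : Type*} [NormedAddCommGroup E] [NormedSpace ℝ E] {K : ℝ → E}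
    {h : ℝ} (h1 : IntervalIntegrable K volume 0 h)
    (h2 : IntervalIntegrable (fun x => K (-x)) volume 0 h) :
    ∫ x in (-h)..h, K x = ∫ x in (0)..h, (K x + K (-x)) := by
  have h3 : IntervalIntegrable K volume (-h) 0 := by
    have := (IntervalIntegrable.iff_comp_neg (f := fun x => K (-x)) (a := 0) (b := h)).1 h2
    simpa using this.symm
  rw [← intervalIntegral.integral_add_adjacent_intervals h3 h1, intervalIntegral.integral_add h1 h2,
    intervalIntegral.integral_comp_neg (fun x => K x)]
  simp [add_comm]

theorem memLp_two_restrict_Ioc_iff {h a : ℝ} (h0 : a ≤ h) {F : ℝ → ℂ}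
    (hFm : StronglyMeasurable F) :
    MemLp F 2 (volume.restrict (Set.Ioc a h)) ↔
      IntervalIntegrable (fun x => ‖F x‖ ^ 2) volume a h := by
  rw [memLp_two_iff_integrable_sq_norm hFm.aestronglyMeasurable,
    intervalIntegrable_iff_integrableOn_Ioc_of_le h0, IntegrableOn]

/-- The even extension from `(0, ∞)`. -/
def evenExt (F : ℝ → ℂ) (x : ℝ) : ℂ := F |x|

/-- The odd extension from `(0, ∞)`. -/
def oddExt (F : ℝ → ℂ) (x : ℝ) : ℂ := (SignType.sign x : ℂ) * F |x|

theorem stronglyMeasurable_evenExt {F : ℝ → ℂ} (hF : StronglyMeasurable F) :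
    StronglyMeasurable (evenExt F) :=
  hF.comp_measurable (by fun_prop)

theorem measurable_sign : Measurable (fun x : ℝ => (SignType.sign x : ℂ)) := by
  have : (fun x : ℝ => (SignType.sign x : ℂ)) = fun x : ℝ => if 0 < x then 1 else
      if x < 0 then -1 else 0 := by
    ext x
    rcases lt_trichotomy x 0 with h | h | h
    · simp [h, h.not_gt]
    · simp [h]
    · simp [h]
  rw [this]
  exact Measurable.ite measurableSet_Ioi measurable_const
    (Measurable.ite measurableSet_Iio measurable_const measurable_const)

theorem stronglyMeasurable_oddExt {F : ℝ → ℂ} (hF : StronglyMeasurable F) :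
    StronglyMeasurable (oddExt F) :=
  measurable_sign.stronglyMeasurable.mul (hF.comp_measurable (by fun_prop))

theorem norm_oddExt_ae (F : ℝ → ℂ) : ∀ᵐ x : ℝ, ‖oddExt F x‖ = ‖F |x|‖ := by
  have : ∀ᵐ x : ℝ, x ≠ 0 := by simp [ae_iff]
  filter_upwards [this] with x hx
  rcases lt_or_gt_of_ne hx with h | h <;> simp [oddExt, h]

theorem intervalIntegrable_mul_of_memLp {F : ℝ → ℂ} {h : ℝ} (h0 : 0 ≤ h)
    (hF : MemLp F 2 (volume.restrict (Set.Ioc 0 h))) {c : ℝ → ℂ} (hc : Continuous c) :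
    IntervalIntegrable (fun x => c x * F x) volume 0 h := by
  rw [intervalIntegrable_iff_integrableOn_Ioc_of_le h0]
  have hF1 : IntegrableOn F (Set.Ioc 0 h) := hF.integrable (by norm_num)
  exact (IntegrableOn.continuousOn_mul hc.continuousOn
    ((integrableOn_Icc_iff_integrableOn_Ioc (by simp)).2 hF1) isCompact_Icc).mono_set Set.Ioc_subset_Icc_self

section EvenOdd

variable {h : ℝ} {F : ℝ → ℂ}

theorem memLp_evenExt (h0 : 0 < h) (hFm : StronglyMeasurable F)
    (hF : MemLp F 2 (volume.restrict (Set.Ioc 0 h))) :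
    MemLp (evenExt F) 2 (volume.restrict (Set.Ioc (-h) h)) := by
  rw [memLp_two_restrict_Ioc_iff (by linarith) (stronglyMeasurable_evenExt hFm)]
  rw [memLp_two_restrict_Ioc_iff h0.le hFm] at hF
  have h1 : IntervalIntegrable (fun x => ‖evenExt F x‖ ^ 2) volume 0 h := by
    refine hF.congr fun x hx => ?_
    rw [Set.uIoc_of_le h0.le] at hx
    simp [evenExt, abs_of_pos hx.1]
  refine IntervalIntegrable.trans (b := 0) ?_ h1
  have h2 := (IntervalIntegrable.iff_comp_neg (by simp)).1 h1
  simpa [evenExt] using h2.symm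

theorem memLp_oddExt (h0 : 0 < h) (hFm : StronglyMeasurable F)
    (hF : MemLp F 2 (volume.restrict (Set.Ioc 0 h))) :
    MemLp (oddExt F) 2 (volume.restrict (Set.Ioc (-h) h)) :=
  (memLp_evenExt h0 hFm hF).congr_norm (stronglyMeasurable_oddExt hFm).aestronglyMeasurable
    (ae_restrict_of_ae (by
      filter_upwards [norm_oddExt_ae F] with x hx
      rw [hx]; rfl))

theorem integral_evenExt_mul (h0 : 0 < h)
    (hF : MemLp F 2 (volume.restrict (Set.Ioc 0 h))) {c : ℝ → ℂ} (hc : Continuous c) :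
    ∫ x in (-h)..h, c x * evenExt F x = ∫ x in (0)..h, (c x + c (-x)) * F x := by
  have e1 : Set.EqOn (fun x => c x * evenExt F x) (fun x => c x * F x) (Set.uIoc 0 h) := by
    intro x hx
    rw [Set.uIoc_of_le h0.le] at hx
    simp [evenExt, abs_of_pos hx.1]
  have e2 : Set.EqOn (fun x => c (-x) * evenExt F (-x)) (fun x => c (-x) * F x)
      (Set.uIoc 0 h) := by
    intro x hx
    rw [Set.uIoc_of_le h0.le] at hx
    simp [evenExt, abs_of_pos hx.1]
  rw [intervalIntegral_symm]
  · refine intervalIntegral.integral_congr_ae (Eventually.of_forall fun x hx => ?_)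
    rw [show c x * evenExt F x = _ from e1 hx, show c (-x) * evenExt F (-x) = _ from e2 hx, add_mul]
  · exact (intervalIntegrable_mul_of_memLp h0.le hF hc).congr e1.symm
  · exact (intervalIntegrable_mul_of_memLp h0.le hF (hc.comp continuous_neg)).congr e2.symm

theorem integral_oddExt_mul (h0 : 0 < h)
    (hF : MemLp F 2 (volume.restrict (Set.Ioc 0 h))) {c : ℝ → ℂ} (hc : Continuous c) :
    ∫ x in (-h)..h, c x * oddExt F x = ∫ x in (0)..h, (c x - c (-x)) * F x := by
  have e1 : Set.EqOn (fun x => c x * oddExt F x) (fun x => c x * F x) (Set.uIoc 0 h) := by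
    intro x hx
    rw [Set.uIoc_of_le h0.le] at hx
    simp [oddExt, abs_of_pos hx.1, hx.1]
  have e2 : Set.EqOn (fun x => c (-x) * oddExt F (-x)) (fun x => -(c (-x) * F x))
      (Set.uIoc 0 h) := by
    intro x hx
    rw [Set.uIoc_of_le h0.le] at hx
    simp [oddExt, abs_of_pos hx.1, hx.1]
  rw [intervalIntegral_symm]
  · refine intervalIntegral.integral_congr_ae (Eventually.of_forall fun x hx => ?_)
    rw [show c x * oddExt F x = _ from e1 hx, show c (-x) * oddExt F (-x) = _ from e2 hx]
    ring
  · exact (intervalIntegrable_mul_of_memLp h0.le hF hc).congr e1.symm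
  · exact (intervalIntegrable_mul_of_memLp h0.le hF (hc.comp continuous_neg)).neg.congr e2.symm

theorem integral_norm_sq_evenExt (h0 : 0 < h) (hFm : StronglyMeasurable F)
    (hF : MemLp F 2 (volume.restrict (Set.Ioc 0 h))) :
    ∫ x in (-h)..h, ‖evenExt F x‖ ^ 2 = 2 * ∫ x in (0)..h, ‖F x‖ ^ 2 := by
  have e1 : Set.EqOn (fun x => ‖evenExt F x‖ ^ 2) (fun x => ‖F x‖ ^ 2) (Set.uIoc 0 h) := by
    intro x hx
    rw [Set.uIoc_of_le h0.le] at hx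
    simp [evenExt, abs_of_pos hx.1]
  have e2 : Set.EqOn (fun x => ‖evenExt F (-x)‖ ^ 2) (fun x => ‖F x‖ ^ 2) (Set.uIoc 0 h) := by
    intro x hx
    rw [Set.uIoc_of_le h0.le] at hx
    simp [evenExt, abs_of_pos hx.1]
  rw [memLp_two_restrict_Ioc_iff h0.le hFm] at hF
  rw [intervalIntegral_symm (hF.congr e1.symm) (hF.congr e2.symm),
    ← intervalIntegral.integral_const_mul]
  refine intervalIntegral.integral_congr_ae (Eventually.of_forall fun x hx => ?_)
  rw [show ‖evenExt F x‖ ^ 2 = _ from e1 hx, show ‖evenExt F (-x)‖ ^ 2 = _ from e2 hx]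
  ring

theorem integral_norm_sq_oddExt (h0 : 0 < h) (hFm : StronglyMeasurable F)
    (hF : MemLp F 2 (volume.restrict (Set.Ioc 0 h))) :
    ∫ x in (-h)..h, ‖oddExt F x‖ ^ 2 = 2 * ∫ x in (0)..h, ‖F x‖ ^ 2 := by
  rw [← integral_norm_sq_evenExt h0 hFm hF]
  refine intervalIntegral.integral_congr_ae ?_
  filter_upwards [norm_oddExt_ae F] with x hx _
  rw [hx]; rfl

/-- Reflection cancels the sine part; for the odd extension, `fourierCoeffOn_oddExt`, it cancels the
cosine part. Integration by parts against sines on `(0, h)` thus becomes the Fourier relation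
between a periodic function and its derivative, with no boundary condition on the function itself.
-/
theorem fourierCoeffOn_evenExt (h0 : 0 < h) (hh : -h < h)
    (hF : MemLp F 2 (volume.restrict (Set.Ioc 0 h))) (n : ℤ) :
    fourierCoeffOn hh (evenExt F) n
      = (1 / h : ℂ) * ∫ x in (0)..h, (Real.cos (Real.pi * n * x / h) : ℂ) * F x := by
  have hc : (h : ℂ) ≠ 0 := by exact_mod_cast h0.ne'
  rw [fourierCoeffOn_symm_interval, integral_evenExt_mul h0 hF (by fun_prop)]
  have : ∀ x : ℝ, ((Real.cos (Real.pi * n * x / h) - Real.sin (Real.pi * n * x / h) * Complex.I) +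
      (Real.cos (Real.pi * n * -x / h) - Real.sin (Real.pi * n * -x / h) * Complex.I)) * F x
      = 2 * ((Real.cos (Real.pi * n * x / h) : ℂ) * F x) := by
    intro x
    rw [show Real.pi * n * -x / h = -(Real.pi * n * x / h) by ring, Real.cos_neg, Real.sin_neg]
    push_cast
    ring
  simp_rw [this, intervalIntegral.integral_const_mul]
  field_simp

theorem fourierCoeffOn_oddExt (h0 : 0 < h) (hh : -h < h)
    (hF : MemLp F 2 (volume.restrict (Set.Ioc 0 h))) (n : ℤ) :
    fourierCoeffOn hh (oddExt F) n
      = -(Complex.I / h) * ∫ x in (0)..h, (Real.sin (Real.pi * n * x / h) : ℂ) * F x := by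
  have hc : (h : ℂ) ≠ 0 := by exact_mod_cast h0.ne'
  rw [fourierCoeffOn_symm_interval, integral_oddExt_mul h0 hF (by fun_prop)]
  have : ∀ x : ℝ, ((Real.cos (Real.pi * n * x / h) - Real.sin (Real.pi * n * x / h) * Complex.I) -
      (Real.cos (Real.pi * n * -x / h) - Real.sin (Real.pi * n * -x / h) * Complex.I)) * F x
      = (-2 * Complex.I) * ((Real.sin (Real.pi * n * x / h) : ℂ) * F x) := by
    intro x
    rw [show Real.pi * n * -x / h = -(Real.pi * n * x / h) by ring, Real.cos_neg, Real.sin_neg]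
    push_cast
    ring
  simp_rw [this, intervalIntegral.integral_const_mul]
  field_simp

theorem norm_sq_fourierCoeffOn_evenExt (h0 : 0 < h) (hh : -h < h)
    (hF : MemLp F 2 (volume.restrict (Set.Ioc 0 h))) (n : ℤ) :
    ‖fourierCoeffOn hh (evenExt F) n‖ ^ 2
      = (1 / h) ^ 2 * ‖∫ x in (0)..h, (Real.cos (Real.pi * n * x / h) : ℂ) * F x‖ ^ 2 := by
  rw [fourierCoeffOn_evenExt h0 hh hF, norm_mul, mul_pow]
  simp

end EvenOdd

/-! ### Neumann and Bessel inequalities on an interval -/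

theorem intervalIntegral_translate {E : Type*} [NormedAddCommGroup E] [NormedSpace ℝ E]
    (a : ℝ) {h : ℝ} (h0 : 0 < h) (f : ℝ → E) :
    ∫ x in (0)..h, f (a + x) = ∫ x in Set.Ioo a (a + h), f x := by
  rw [intervalIntegral.integral_comp_add_left, add_zero,
    intervalIntegral.integral_of_le (by linarith), integral_Ioc_eq_integral_Ioo]

theorem memLp_translate (a h : ℝ) {F : ℝ → ℂ}
    (hF : MemLp F 2 (volume.restrict (Set.Ioo a (a + h)))) :
    MemLp (fun x => F (a + x)) 2 (volume.restrict (Set.Ioc 0 h)) := by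
  have h1 : MeasurePreserving (fun x : ℝ => a + x) (volume.restrict (Set.Ioc 0 h))
      (volume.restrict (Set.Ioc a (a + h))) := by
    have := (measurePreserving_add_left volume a).restrict_preimage
      (measurableSet_Ioc (a := a) (b := a + h))
    simpa using this
  rw [← restrict_Ioo_eq_restrict_Ioc (a := a)] at h1
  exact hF.comp_measurePreserving h1

/-- Neumann inequality `‖F‖² ≤ (h / π m)² ‖F'‖² + ‖P_m F‖²` on an interval of length `h`, where
`P_m` projects to the cosine modes below `m`. The derivative `G` of `F` is only
assumed to satisfy the integration by parts formula with sines. -/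
theorem neumann_poincare (a : ℝ) {h : ℝ} (h0 : 0 < h) {F G : ℝ → ℂ}
    (hFm : StronglyMeasurable F) (hGm : StronglyMeasurable G)
    (hF : MemLp F 2 (volume.restrict (Set.Ioo a (a + h))))
    (hG : MemLp G 2 (volume.restrict (Set.Ioo a (a + h))))
    (hrel : ∀ n : ℤ,
      ∫ x in Set.Ioo a (a + h), (Real.sin (Real.pi * n * (x - a) / h) : ℂ) * G x
        = -((Real.pi * n / h : ℝ) : ℂ) *
      ∫ x in Set.Ioo a (a + h), (Real.cos (Real.pi * n * (x - a) / h) : ℂ) * F x)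
    {m : ℕ} (hm : 0 < m) :
    ∫ x in Set.Ioo a (a + h), ‖F x‖ ^ 2
      ≤ (h / (Real.pi * m)) ^ 2 * (∫ x in Set.Ioo a (a + h), ‖G x‖ ^ 2) +
      1 / h * ∑ n ∈ Finset.Ioo (-m : ℤ) m,
        ‖∫ x in Set.Ioo a (a + h), (Real.cos (Real.pi * n * (x - a) / h) : ℂ) * F x‖ ^ 2 := by
  have hh : -h < h := by linarith
  have hFm' : StronglyMeasurable fun x => F (a + x) := hFm.comp_measurable (by fun_prop)
  have hGm' : StronglyMeasurable fun x => G (a + x) := hGm.comp_measurable (by fun_prop)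
  have hF' := memLp_translate a h hF
  have hG' := memLp_translate a h hG
  simp only [← intervalIntegral_translate a h0, add_sub_cancel_left] at hrel ⊢
  -- The even extension of `F` has the odd extension of `G` as its periodic derivative: even
  -- reflection creates no jump at either end.
  have key := periodic_poincare h0 hh (memLp_evenExt h0 hFm' hF') (memLp_oddExt h0 hGm' hG')
    (fun n => by
      rw [fourierCoeffOn_evenExt h0 hh hF', fourierCoeffOn_oddExt h0 hh hG', hrel n]
      push_cast
      ring) hm
  rw [integral_norm_sq_evenExt h0 hFm' hF', integral_norm_sq_oddExt h0 hGm' hG'] at key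
  simp_rw [norm_sq_fourierCoeffOn_evenExt h0 hh hF', ← Finset.mul_sum] at key
  have e : ∀ z : ℝ, 2 * h * ((1 / h) ^ 2 * z) = 2 * (1 / h * z) := fun z => by field_simp
  rw [e] at key
  linarith

/-- Bessel's inequality for the cosine modes. -/
theorem cosine_bessel (a : ℝ) {h : ℝ} (h0 : 0 < h) {F : ℝ → ℂ}
    (hFm : StronglyMeasurable F) (hF : MemLp F 2 (volume.restrict (Set.Ioo a (a + h)))) (m : ℕ) :
    1 / h * ∑ n ∈ Finset.Ioo (-m : ℤ) m,
        ‖∫ x in Set.Ioo a (a + h), (Real.cos (Real.pi * n * (x - a) / h) : ℂ) * F x‖ ^ 2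
      ≤ ∫ x in Set.Ioo a (a + h), ‖F x‖ ^ 2 := by
  have hh : -h < h := by linarith
  have hFm' : StronglyMeasurable fun x => F (a + x) := hFm.comp_measurable (by fun_prop)
  have hF' := memLp_translate a h hF
  simp only [← intervalIntegral_translate a h0, add_sub_cancel_left]
  have key := sum_le_hasSum (Finset.Ioo (-m : ℤ) m) (fun n _ => by positivity)
    (hasSum_sq_fourierCoeffOn hh (memLp_evenExt h0 hFm' hF'))
  rw [integral_norm_sq_evenExt h0 hFm' hF', smul_eq_mul] at key
  simp_rw [norm_sq_fourierCoeffOn_evenExt h0 hh hF', ← Finset.mul_sum] at key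
  have := mul_le_mul_of_nonneg_left key h0.le
  calc _ = h * ((1 / h) ^ 2 * ∑ n ∈ Finset.Ioo (-m : ℤ) m,
        ‖∫ x in (0)..h, (Real.cos (Real.pi * n * x / h) : ℂ) * F (a + x)‖ ^ 2) := by field_simp
    _ ≤ _ := this
    _ = _ := by field_simp; ring

/-! ## Cutoff functions -/

/-- Rescaling one smooth step makes the derivative of order `n`, but only where `x` is of order `1 /
n`, so `θ' x * x` is bounded uniformly in `n`. Such cutoffs can be removed by dominated convergence
from test functions that vanish at the end point. -/
theorem exists_cutoff_Ioi : ∃ θ : ℕ → ℝ → ℝ, (∀ n, ContDiff ℝ ∞ (θ n)) ∧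
    (∀ n x, 0 ≤ θ n x) ∧ (∀ n x, θ n x ≤ 1) ∧
    (∀ (n : ℕ) x, x ≤ 1 / ((n : ℝ) + 1) → θ n x = 0) ∧
    (∀ x, 0 < x → ∀ᶠ n in atTop, θ n =ᶠ[𝓝 x] 1) ∧
    ∃ T, ∀ n x, |deriv (θ n) x * x| ≤ T := by
  have hst : ContDiff ℝ ∞ Real.smoothTransition := Real.smoothTransition.contDiff
  have hd : ∀ (n : ℕ) (x : ℝ), HasDerivAt (fun x : ℝ => Real.smoothTransition ((n + 1) * x - 1))
      (deriv Real.smoothTransition ((n + 1) * x - 1) * (n + 1)) x := fun n x => by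
    have h1 : HasDerivAt (fun x : ℝ => ((n : ℝ) + 1) * x - 1) ((n : ℝ) + 1) x := by
      simpa using ((hasDerivAt_id x).const_mul ((n : ℝ) + 1)).sub_const 1
    exact ((hst.differentiable (by simp)).differentiableAt.hasDerivAt).comp x h1
  refine ⟨fun n x => Real.smoothTransition ((n + 1) * x - 1), fun n => ?_, fun n x => ?_,
    fun n x => ?_, fun n x hx => ?_, fun x hx => ?_, ?_⟩
  · exact hst.comp (by fun_prop)
  · exact Real.smoothTransition.nonneg _
  · exact Real.smoothTransition.le_one _
  · refine Real.smoothTransition.zero_of_nonpos ?_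
    have hn : (0 : ℝ) < n + 1 := by positivity
    rw [le_div_iff₀ hn] at hx
    linarith
  · obtain ⟨k, hk⟩ := exists_nat_gt (2 / x)
    filter_upwards [eventually_ge_atTop k] with n hn
    have hk2 : 2 < ((n : ℝ) + 1) * x := by
      rw [div_lt_iff₀ hx] at hk
      have : (k : ℝ) ≤ n := by exact_mod_cast hn
      nlinarith
    have : ∀ᶠ y in 𝓝 x, 2 < ((n : ℝ) + 1) * y :=
      (continuous_const.mul continuous_id).continuousAt.eventually (lt_mem_nhds hk2)
    filter_upwards [this] with y hy
    exact Real.smoothTransition.one_of_one_le (by linarith)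
  · have hcont : Continuous fun w : ℝ => deriv Real.smoothTransition w * (w + 1) :=
      (hst.continuous_deriv (by simp)).mul (by fun_prop)
    obtain ⟨T, hT⟩ := (isCompact_Icc (a := (0 : ℝ)) (b := 1)).exists_bound_of_continuousOn
      hcont.continuousOn
    have hT0 : 0 ≤ T := (norm_nonneg _).trans (hT 0 (by simp))
    refine ⟨T, fun n x => ?_⟩
    rw [(hd n x).deriv]
    -- In the rescaled variable the quantity is a fixed function of `w`, and it vanishes off `[0,
    -- 1]`.
    set w : ℝ := (n + 1) * x - 1 with hw
    rw [mul_assoc, show ((n : ℝ) + 1) * x = w + 1 by rw [hw]; ring]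
    by_cases hmem : w ∈ Set.Icc (0 : ℝ) 1
    · exact hT w hmem
    · have : deriv Real.smoothTransition w = 0 := by
        rcases not_and_or.1 hmem with h | h
        · have h1 : Real.smoothTransition =ᶠ[𝓝 w] fun _ => 0 := by
            filter_upwards [gt_mem_nhds (not_le.1 h)] with y hy
            exact Real.smoothTransition.zero_of_nonpos hy.le
          rw [h1.deriv_eq, deriv_const]
        · have h1 : Real.smoothTransition =ᶠ[𝓝 w] fun _ => 1 := by
            filter_upwards [lt_mem_nhds (not_le.1 h)] with y hy
            exact Real.smoothTransition.one_of_one_le hy.le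
          rw [h1.deriv_eq, deriv_const]
      simp [this, hT0]

/-- Cutoffs of an interval, whose derivatives are controlled by the distance to the boundary. -/
theorem exists_cutoff_Ioo (a c : ℝ) : ∃ χ : ℕ → ℝ → ℝ, (∀ n, ContDiff ℝ ∞ (χ n)) ∧
    (∀ n, HasCompactSupport (χ n)) ∧ (∀ n, tsupport (χ n) ⊆ Set.Ioo a c) ∧
    (∀ n x, |χ n x| ≤ 1) ∧ (∀ x ∈ Set.Ioo a c, ∀ᶠ n in atTop, χ n =ᶠ[𝓝 x] 1) ∧
    ∀ u : ℝ → ℝ, ContDiff ℝ ∞ u → u a = 0 → u c = 0 →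
      ∃ T, ∀ n, ∀ x ∈ Set.Ioo a c, |deriv (χ n) x * u x| ≤ T := by
  obtain ⟨θ, hθ, hθ0, hθ1, hθz, hθe, T, hT⟩ := exists_cutoff_Ioi
  have hsupp : ∀ n, tsupport (fun x => θ n (x - a) * θ n (c - x))
      ⊆ Set.Icc (a + 1 / ((n : ℝ) + 1)) (c - 1 / ((n : ℝ) + 1)) := by
    intro n
    refine closure_minimal (fun x hx => ?_) isClosed_Icc
    rw [Function.mem_support] at hx
    constructor
    · by_contra hlt
      exact hx (by rw [hθz n (x - a) (by linarith), zero_mul])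
    · by_contra hlt
      exact hx (by rw [hθz n (c - x) (by linarith), mul_zero])
  have hdl : ∀ n x, HasDerivAt (fun x => θ n (x - a)) (deriv (θ n) (x - a)) x := fun n x => by
    have h1 : HasDerivAt (fun x : ℝ => x - a) 1 x := (hasDerivAt_id x).sub_const a
    have h2 : HasDerivAt (θ n) (deriv (θ n) (x - a)) (x - a) :=
      ((hθ n).differentiable (by simp)).differentiableAt.hasDerivAt
    have h3 := HasDerivAt.comp x h2 h1
    rw [mul_one] at h3
    exact h3
  have hdr : ∀ n x, HasDerivAt (fun x => θ n (c - x)) (-deriv (θ n) (c - x)) x := fun n x => by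
    have h1 : HasDerivAt (fun x : ℝ => c - x) (-1) x := by
      simpa using (hasDerivAt_id x).const_sub c
    have h2 : HasDerivAt (θ n) (deriv (θ n) (c - x)) (c - x) :=
      ((hθ n).differentiable (by simp)).differentiableAt.hasDerivAt
    have h3 := HasDerivAt.comp x h2 h1
    rw [mul_neg_one] at h3
    exact h3
  refine ⟨fun n x => θ n (x - a) * θ n (c - x), fun n => ?_, fun n => ?_, fun n => ?_,
    fun n x => ?_, fun x hx => ?_, fun u hu hua huc => ?_⟩
  · exact ((hθ n).comp (by fun_prop)).mul ((hθ n).comp (by fun_prop))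
  · exact isCompact_Icc.of_isClosed_subset (isClosed_tsupport _) (hsupp n)
  · have : (0 : ℝ) < 1 / ((n : ℝ) + 1) := by positivity
    exact (hsupp n).trans (Set.Icc_subset_Ioo (by linarith) (by linarith))
  · rw [abs_mul, abs_of_nonneg (hθ0 _ _), abs_of_nonneg (hθ0 _ _)]
    exact mul_le_one₀ (hθ1 _ _) (hθ0 _ _) (hθ1 _ _)
  · filter_upwards [hθe (x - a) (by linarith [hx.1]), hθe (c - x) (by linarith [hx.2])] with n h1 h2
    have c1 : Tendsto (fun y : ℝ => y - a) (𝓝 x) (𝓝 (x - a)) := by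
      exact (continuous_id.sub continuous_const).continuousAt
    have c2 : Tendsto (fun y : ℝ => c - y) (𝓝 x) (𝓝 (c - x)) := by
      exact (continuous_const.sub continuous_id).continuousAt
    filter_upwards [c1.eventually h1, c2.eventually h2] with y h3 h4
    simp [h3, h4]
  · have hcd : ContinuousOn (deriv u) (Set.Icc a c) :=
      (hu.continuous_deriv (by simp)).continuousOn
    obtain ⟨K, hK⟩ := isCompact_Icc.exists_bound_of_continuousOn hcd
    -- As `u` vanishes at both ends, this bounds `|u|` by the distance to either end, which
    -- compensates the growth of the derivatives of the cutoffs there.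
    have hlip : ∀ x ∈ Set.Icc a c, ∀ y ∈ Set.Icc a c, |u y - u x| ≤ K * |y - x| := by
      intro x hx y hy
      exact (convex_Icc a c).norm_image_sub_le_of_norm_deriv_le
        (fun z _ => (hu.differentiable (by simp)).differentiableAt) hK hx hy
    refine ⟨T * K + T * K, fun n x hx => ?_⟩
    have hx' := Set.Ioo_subset_Icc_self hx
    have hac : a ≤ c := (hx.1.trans hx.2).le
    have hK0 : 0 ≤ K := (norm_nonneg _).trans (hK x hx')
    have hT0 : 0 ≤ T := (abs_nonneg _).trans (hT n 0)
    have ua := hlip a ⟨le_rfl, hac⟩ x hx'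
    have uc := hlip c ⟨hac, le_rfl⟩ x hx'
    rw [hua, sub_zero] at ua
    rw [huc, sub_zero] at uc
    rw [((hdl n x).fun_mul (hdr n x)).deriv, add_mul]
    refine (abs_add_le _ _).trans (add_le_add ?_ ?_)
    · rw [abs_mul, abs_mul, abs_of_nonneg (hθ0 n (c - x))]
      calc _ ≤ |deriv (θ n) (x - a)| * 1 * (K * |x - a|) := by
            gcongr
            exact hθ1 _ _
        _ = |deriv (θ n) (x - a) * (x - a)| * K := by rw [abs_mul]; ring
        _ ≤ _ := by gcongr; exact hT _ _
    · rw [abs_mul, abs_mul, abs_of_nonneg (hθ0 n (x - a)), abs_neg]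
      calc _ ≤ 1 * |deriv (θ n) (c - x)| * (K * |x - c|) := by
            gcongr
            exact hθ1 _ _
        _ = |deriv (θ n) (c - x) * (c - x)| * K := by rw [abs_mul, abs_sub_comm x c]; ring
        _ ≤ _ := by gcongr; exact hT _ _

/-! ## Weak derivatives tested with products -/

/-- `G` is the weak derivative of `F` in the first coordinate on `I × J`, tested only with products
of smooth functions. -/
def ProdWeakDeriv (I J : Set ℝ) (F G : ℝ × ℝ → ℂ) : Prop :=
  ∀ u v : ℝ → ℝ, ContDiff ℝ ∞ u → HasCompactSupport u → tsupport u ⊆ I →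
    ContDiff ℝ ∞ v → HasCompactSupport v → tsupport v ⊆ J →
    ∫ z : ℝ × ℝ, ((deriv u z.1 * v z.2 : ℝ) : ℂ) * F z
      = -∫ z : ℝ × ℝ, ((u z.1 * v z.2 : ℝ) : ℂ) * G z

theorem integral_mul_eq_setIntegral_prod {I J : Set ℝ} {u v : ℝ → ℝ}
    (hu : Function.support u ⊆ I) (hv : Function.support v ⊆ J) (F : ℝ × ℝ → ℂ) :
    ∫ z : ℝ × ℝ, ((u z.1 * v z.2 : ℝ) : ℂ) * F z
      = ∫ z in I ×ˢ J, ((u z.1 * v z.2 : ℝ) : ℂ) * F z := by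
  refine (setIntegral_eq_integral_of_forall_compl_eq_zero fun z hz => ?_).symm
  rw [Set.mem_prod, not_and_or] at hz
  rcases hz with h | h
  · have : u z.1 = 0 := by
      by_contra h0
      exact h (hu h0)
    simp [this]
  · have : v z.2 = 0 := by
      by_contra h0
      exact h (hv h0)
    simp [this]

/-- In bounded rectangles, the test functions need not have compact support: it suffices that the
differentiated factor vanishes at the end points. -/
theorem ProdWeakDeriv.setIntegral_eq {a c b e : ℝ} {F G : ℝ × ℝ → ℂ}
    (h : ProdWeakDeriv (Set.Ioo a c) (Set.Ioo b e) F G)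
    (hF : IntegrableOn F (Set.Ioo a c ×ˢ Set.Ioo b e))
    (hG : IntegrableOn G (Set.Ioo a c ×ˢ Set.Ioo b e))
    {u v : ℝ → ℝ} (hu : ContDiff ℝ ∞ u) (hua : u a = 0) (huc : u c = 0) (hv : ContDiff ℝ ∞ v) :
    ∫ z in Set.Ioo a c ×ˢ Set.Ioo b e, ((deriv u z.1 * v z.2 : ℝ) : ℂ) * F z
      = -∫ z in Set.Ioo a c ×ˢ Set.Ioo b e, ((u z.1 * v z.2 : ℝ) : ℂ) * G z := by
  obtain ⟨χ, hχ, hχc, hχs, hχ1, hχe, hχu⟩ := exists_cutoff_Ioo a c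
  obtain ⟨ξ, hξ, hξc, hξs, hξ1, hξe, -⟩ := exists_cutoff_Ioo b e
  obtain ⟨T, hT⟩ := hχu u hu hua huc
  obtain ⟨A, hA⟩ := isCompact_Icc.exists_bound_of_continuousOn (s := Set.Icc a c)
    hu.continuous.continuousOn
  obtain ⟨A', hA'⟩ := isCompact_Icc.exists_bound_of_continuousOn (s := Set.Icc a c)
    (hu.continuous_deriv (by simp)).continuousOn
  obtain ⟨B, hB⟩ := isCompact_Icc.exists_bound_of_continuousOn (s := Set.Icc b e)
    hv.continuous.continuousOn
  have hmeas : MeasurableSet (Set.Ioo a c ×ˢ Set.Ioo b e) := measurableSet_Ioo.prod measurableSet_Ioo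
  have hder : ∀ n x, deriv (fun x => χ n x * u x) x = deriv (χ n) x * u x + χ n x * deriv u x :=
    fun n x => by
      rw [deriv_fun_mul]
      · exact ((hχ n).differentiable (by simp)).differentiableAt
      · exact (hu.differentiable (by simp)).differentiableAt
  have hw : ∀ n, ContDiff ℝ ∞ fun x => χ n x * u x := fun n => (hχ n).mul hu
  have hv' : ∀ n, ContDiff ℝ ∞ fun x => ξ n x * v x := fun n => (hξ n).mul hv
  have heq : ∀ n, ∫ z in Set.Ioo a c ×ˢ Set.Ioo b e,
      ((deriv (fun x => χ n x * u x) z.1 * (ξ n z.2 * v z.2) : ℝ) : ℂ) * F z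
      = -∫ z in Set.Ioo a c ×ˢ Set.Ioo b e,
        ((χ n z.1 * u z.1 * (ξ n z.2 * v z.2) : ℝ) : ℂ) * G z := by
    intro n
    have hs1 : tsupport (fun x => χ n x * u x) ⊆ Set.Ioo a c :=
      (tsupport_mul_subset_left).trans (hχs n)
    have hs2 : tsupport (fun x => ξ n x * v x) ⊆ Set.Ioo b e :=
      (tsupport_mul_subset_left).trans (hξs n)
    have h1 := h _ _ (hw n) ((hχc n).mul_right) hs1 (hv' n) ((hξc n).mul_right) hs2
    rw [integral_mul_eq_setIntegral_prod (u := deriv fun x => χ n x * u x)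
        (v := fun x => ξ n x * v x) ((support_deriv_subset).trans hs1)
        ((subset_tsupport _).trans hs2),
      integral_mul_eq_setIntegral_prod (u := fun x => χ n x * u x)
        (v := fun x => ξ n x * v x) ((subset_tsupport _).trans hs1)
        ((subset_tsupport _).trans hs2)] at h1
    exact h1
  -- The derivative of the cut-off factor has two terms: `χ' u`, bounded by `T`, and `χ u'`, bounded
  -- by `A'`. Near each interior point the cutoffs are eventually one.
  have lim1 : Tendsto (fun n => ∫ z in Set.Ioo a c ×ˢ Set.Ioo b e,
      ((deriv (fun x => χ n x * u x) z.1 * (ξ n z.2 * v z.2) : ℝ) : ℂ) * F z) atTop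
      (𝓝 (∫ z in Set.Ioo a c ×ˢ Set.Ioo b e, ((deriv u z.1 * v z.2 : ℝ) : ℂ) * F z)) := by
    refine tendsto_integral_of_dominated_convergence (fun z => (T + A') * B * ‖F z‖) (fun n => ?_)
      (hF.norm.const_mul _) (fun n => ?_) ?_
    · refine AEStronglyMeasurable.mul (Continuous.aestronglyMeasurable ?_) hF.1
      have h1 := (hw n).continuous_deriv (by simp)
      have h2 := (hv' n).continuous
      exact Complex.continuous_ofReal.comp ((h1.comp continuous_fst).mul (h2.comp continuous_snd))
    · filter_upwards [ae_restrict_mem hmeas] with z hz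
      have hz1 := Set.Ioo_subset_Icc_self hz.1
      have hz2 := Set.Ioo_subset_Icc_self hz.2
      have hA0 := (norm_nonneg _).trans (hA' _ hz1)
      have hT0 := (abs_nonneg _).trans (hT 0 z.1 hz.1)
      rw [norm_mul, Complex.norm_real, norm_mul, hder]
      gcongr
      · refine (norm_add_le _ _).trans (add_le_add (hT n _ hz.1) ?_)
        rw [norm_mul]
        exact (mul_le_mul (hχ1 _ _) (hA' _ hz1) (norm_nonneg _) zero_le_one).trans (one_mul _).le
      · rw [norm_mul]
        exact (mul_le_mul (hξ1 _ _) (hB _ hz2) (norm_nonneg _) zero_le_one).trans (one_mul _).le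
    · filter_upwards [ae_restrict_mem hmeas] with z hz
      refine tendsto_const_nhds.congr' ?_
      filter_upwards [hχe _ hz.1, hξe _ hz.2] with n h1 h2
      rw [hder, h1.deriv_eq, h1.self_of_nhds, h2.self_of_nhds]
      simp
  have lim2 : Tendsto (fun n => ∫ z in Set.Ioo a c ×ˢ Set.Ioo b e,
      ((χ n z.1 * u z.1 * (ξ n z.2 * v z.2) : ℝ) : ℂ) * G z) atTop
      (𝓝 (∫ z in Set.Ioo a c ×ˢ Set.Ioo b e, ((u z.1 * v z.2 : ℝ) : ℂ) * G z)) := by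
    refine tendsto_integral_of_dominated_convergence (fun z => A * B * ‖G z‖) (fun n => ?_)
      (hG.norm.const_mul _) (fun n => ?_) ?_
    · refine AEStronglyMeasurable.mul (Continuous.aestronglyMeasurable ?_) hG.1
      have h1 := (hw n).continuous
      have h2 := (hv' n).continuous
      exact Complex.continuous_ofReal.comp ((h1.comp continuous_fst).mul (h2.comp continuous_snd))
    · filter_upwards [ae_restrict_mem hmeas] with z hz
      have hz1 := Set.Ioo_subset_Icc_self hz.1
      have hz2 := Set.Ioo_subset_Icc_self hz.2
      have hA0 := (norm_nonneg _).trans (hA _ hz1)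
      rw [norm_mul, Complex.norm_real, norm_mul]
      gcongr
      · rw [norm_mul]
        exact (mul_le_mul (hχ1 _ _) (hA _ hz1) (norm_nonneg _) zero_le_one).trans (one_mul _).le
      · rw [norm_mul]
        exact (mul_le_mul (hξ1 _ _) (hB _ hz2) (norm_nonneg _) zero_le_one).trans (one_mul _).le
    · filter_upwards [ae_restrict_mem hmeas] with z hz
      refine tendsto_const_nhds.congr' ?_
      filter_upwards [hχe _ hz.1, hξe _ hz.2] with n h1 h2
      rw [h1.self_of_nhds, h2.self_of_nhds]
      simp
  refine tendsto_nhds_unique lim1 ?_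
  simp_rw [heq]
  exact lim2.neg

/-! ## The Neumann inequality on a rectangle -/

section Rectangle

variable {I J : Set ℝ} {F : ℝ × ℝ → ℂ}

theorem memLp_slice_ae (hFm : StronglyMeasurable F)
    (hF : MemLp F 2 (volume.restrict (I ×ˢ J))) :
    ∀ᵐ y ∂(volume.restrict J), MemLp (fun x => F (x, y)) 2 (volume.restrict I) := by
  rw [Measure.volume_eq_prod, ← Measure.prod_restrict] at hF
  have h1 := (memLp_two_iff_integrable_sq_norm hF.1).1 hF
  filter_upwards [h1.prod_left_ae] with y hy
  have hm : StronglyMeasurable fun x => F (x, y) := hFm.comp_measurable measurable_prodMk_right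
  exact (memLp_two_iff_integrable_sq_norm hm.aestronglyMeasurable).2 hy

theorem integrable_integral_norm_sq (hF : MemLp F 2 (volume.restrict (I ×ˢ J))) :
    Integrable (fun y => ∫ x in I, ‖F (x, y)‖ ^ 2) (volume.restrict J) := by
  rw [Measure.volume_eq_prod, ← Measure.prod_restrict] at hF
  exact ((memLp_two_iff_integrable_sq_norm hF.1).1 hF).integral_prod_right

theorem integral_integral_norm_sq (hF : MemLp F 2 (volume.restrict (I ×ˢ J))) :
    ∫ y in J, ∫ x in I, ‖F (x, y)‖ ^ 2 = ∫ z in I ×ˢ J, ‖F z‖ ^ 2 := by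
  rw [Measure.volume_eq_prod, ← Measure.prod_restrict] at hF ⊢
  exact (integral_prod_symm _ ((memLp_two_iff_integrable_sq_norm hF.1).1 hF)).symm

theorem stronglyMeasurable_integral_slice (hFm : StronglyMeasurable F) {c : ℝ → ℂ}
    (hc : Continuous c) : StronglyMeasurable fun y => ∫ x in I, c x * F (x, y) :=
  StronglyMeasurable.integral_prod_left' (μ := volume.restrict I)
    (f := fun z : ℝ × ℝ => c z.1 * F z)
    ((hc.comp continuous_fst).stronglyMeasurable.mul hFm)

theorem integrableOn_mul_of_bounded (hF : IntegrableOn F (I ×ˢ J)) {c e : ℝ → ℂ}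
    (hc : Continuous c) (he : Continuous e) {B B' : ℝ} (hB : ∀ x, ‖c x‖ ≤ B) (hB' : ∀ x, ‖e x‖ ≤ B') :
    IntegrableOn (fun z => c z.1 * e z.2 * F z) (I ×ˢ J) := by
  refine Integrable.bdd_mul (c := B * B') hF
    (((hc.comp continuous_fst).mul (he.comp continuous_snd)).aestronglyMeasurable)
    (Eventually.of_forall fun z => ?_)
  rw [norm_mul]
  exact mul_le_mul (hB _) (hB' _) (norm_nonneg _) ((norm_nonneg _).trans (hB z.1))

theorem integral_mul_integral_slice (hF : IntegrableOn F (I ×ˢ J)) {c e : ℝ → ℂ}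
    (hc : Continuous c) (he : Continuous e) {B B' : ℝ} (hB : ∀ x, ‖c x‖ ≤ B)
    (hB' : ∀ x, ‖e x‖ ≤ B') :
    ∫ y in J, e y * ∫ x in I, c x * F (x, y) = ∫ z in I ×ˢ J, c z.1 * e z.2 * F z := by
  have h := integrableOn_mul_of_bounded hF hc he hB hB'
  rw [IntegrableOn, Measure.volume_eq_prod, ← Measure.prod_restrict] at h
  rw [Measure.volume_eq_prod, ← Measure.prod_restrict, integral_prod_symm _ h]
  refine integral_congr_ae (Eventually.of_forall fun y => ?_)
  simp only
  rw [← integral_const_mul]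
  congr 1
  ext x
  ring

end Rectangle

theorem setIntegral_swap {E : Type*} [NormedAddCommGroup E] [NormedSpace ℝ E] (s t : Set ℝ)
    (g : ℝ × ℝ → E) : ∫ z in t ×ˢ s, g z = ∫ z in s ×ˢ t, g z.swap := by
  rw [Measure.volume_eq_prod, ← setIntegral_prod_swap]

theorem norm_ofReal_cos_le (x : ℝ) : ‖(Real.cos x : ℂ)‖ ≤ 1 := by
  rw [Complex.norm_real]; exact Real.abs_cos_le_one x

theorem norm_ofReal_sin_le (x : ℝ) : ‖(Real.sin x : ℂ)‖ ≤ 1 := by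
  rw [Complex.norm_real]; exact Real.abs_sin_le_one x

theorem contDiff_sin_scaled (n : ℤ) (a h : ℝ) :
    ContDiff ℝ ∞ fun x => Real.sin (Real.pi * n * (x - a) / h) := by fun_prop

theorem contDiff_cos_scaled (n : ℤ) (a h : ℝ) :
    ContDiff ℝ ∞ fun x => Real.cos (Real.pi * n * (x - a) / h) := by fun_prop

theorem deriv_sin_scaled (n : ℤ) (a h x : ℝ) :
    deriv (fun x => Real.sin (Real.pi * n * (x - a) / h)) x
      = Real.pi * n / h * Real.cos (Real.pi * n * (x - a) / h) := by
  have h1 : HasDerivAt (fun x : ℝ => Real.pi * n * (x - a) / h) (Real.pi * n / h) x := by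
    simpa using (((hasDerivAt_id x).sub_const a).const_mul (Real.pi * n)).div_const h
  rw [h1.sin.deriv, mul_comm]

theorem sin_scaled_right (n : ℤ) (a : ℝ) {h : ℝ} (h0 : 0 < h) :
    Real.sin (Real.pi * n * (a + h - a) / h) = 0 := by
  rw [add_sub_cancel_left, mul_div_assoc, div_self h0.ne', mul_one, mul_comm]
  exact Real.sin_int_mul_pi n

/-- One term of Bessel's inequality; it makes the cosine coefficients of the slices square
integrable in the other variable. -/
theorem norm_sq_cosine_coeff_le (a : ℝ) {h : ℝ} (h0 : 0 < h) {F : ℝ → ℂ}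
    (hFm : StronglyMeasurable F) (hF : MemLp F 2 (volume.restrict (Set.Ioo a (a + h)))) (n : ℤ) :
    ‖∫ x in Set.Ioo a (a + h), (Real.cos (Real.pi * n * (x - a) / h) : ℂ) * F x‖ ^ 2
      ≤ h * ∫ x in Set.Ioo a (a + h), ‖F x‖ ^ 2 := by
  have h1 := cosine_bessel a h0 hFm hF (n.natAbs + 1)
  have h2 := Finset.single_le_sum (f := fun n : ℤ =>
    ‖∫ x in Set.Ioo a (a + h), (Real.cos (Real.pi * n * (x - a) / h) : ℂ) * F x‖ ^ 2)
    (s := Finset.Ioo (-((n.natAbs + 1 : ℕ) : ℤ)) ((n.natAbs + 1 : ℕ) : ℤ)) (fun _ _ => by positivity)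
    (a := n) (by rw [Finset.mem_Ioo]; omega)
  rw [one_div, inv_mul_le_iff₀ h0] at h1
  exact h2.trans h1

variable {a b h h' : ℝ} {F Ga Gb : ℝ × ℝ → ℂ}

theorem memLp_cosine_coeff (h0 : 0 < h) (hFm : StronglyMeasurable F) {J : Set ℝ}
    (hF : MemLp F 2 (volume.restrict (Set.Ioo a (a + h) ×ˢ J))) (n : ℤ) :
    MemLp (fun y => ∫ x in Set.Ioo a (a + h),
      (Real.cos (Real.pi * n * (x - a) / h) : ℂ) * F (x, y)) 2 (volume.restrict J) := by
  have hm : StronglyMeasurable fun y => ∫ x in Set.Ioo a (a + h),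
      (Real.cos (Real.pi * n * (x - a) / h) : ℂ) * F (x, y) :=
    stronglyMeasurable_integral_slice hFm (by fun_prop)
  rw [memLp_two_iff_integrable_sq_norm hm.aestronglyMeasurable]
  refine ((integrable_integral_norm_sq hF).const_mul h).mono'
    (hm.norm.pow 2).aestronglyMeasurable ?_
  filter_upwards [memLp_slice_ae hFm hF] with y hy
  rw [Real.norm_of_nonneg (by positivity)]
  exact norm_sq_cosine_coeff_le a h0 (hFm.comp_measurable measurable_prodMk_right) hy n

/-- An integration by parts formula tested with functions of the second variable holds on almost
every slice. -/
theorem slice_of_prod {I J : Set ℝ} (hJ : IsOpen J) {G : ℝ × ℝ → ℂ} (hF : IntegrableOn F (I ×ˢ J))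
    (hG : IntegrableOn G (I ×ˢ J)) {w w' : ℝ → ℝ} (hw : Continuous w) (hw' : Continuous w')
    {B B' : ℝ} (hB : ∀ x, |w x| ≤ B) (hB' : ∀ x, |w' x| ≤ B')
    (h : ∀ v : ℝ → ℝ, ContDiff ℝ ∞ v → HasCompactSupport v → tsupport v ⊆ J →
      ∫ z in I ×ˢ J, ((w' z.1 * v z.2 : ℝ) : ℂ) * F z
        = -∫ z in I ×ˢ J, ((w z.1 * v z.2 : ℝ) : ℂ) * G z) :
    ∀ᵐ y ∂(volume.restrict J),
      ∫ x in I, (w x : ℂ) * G (x, y) = -∫ x in I, (w' x : ℂ) * F (x, y) := by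
  have cw : Continuous fun x => (w x : ℂ) := Complex.continuous_ofReal.comp hw
  have cw' : Continuous fun x => (w' x : ℂ) := Complex.continuous_ofReal.comp hw'
  have bw : ∀ x, ‖(w x : ℂ)‖ ≤ B := fun x => by rw [Complex.norm_real]; exact hB x
  have bw' : ∀ x, ‖(w' x : ℂ)‖ ≤ B' := fun x => by rw [Complex.norm_real]; exact hB' x
  have jG : IntegrableOn (fun y => ∫ x in I, (w x : ℂ) * G (x, y)) J := by
    have iG := integrableOn_mul_of_bounded hG cw (continuous_const (y := (1 : ℂ))) bw
      (B' := 1) (by simp)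
    simp only [mul_one] at iG
    rw [IntegrableOn, Measure.volume_eq_prod, ← Measure.prod_restrict] at iG
    exact iG.integral_prod_right
  have jF : IntegrableOn (fun y => ∫ x in I, (w' x : ℂ) * F (x, y)) J := by
    have iF := integrableOn_mul_of_bounded hF cw' (continuous_const (y := (1 : ℂ))) bw'
      (B' := 1) (by simp)
    simp only [mul_one] at iF
    rw [IntegrableOn, Measure.volume_eq_prod, ← Measure.prod_restrict] at iF
    exact iF.integral_prod_right
  -- The fundamental lemma of the calculus of variations in `y`, applied to the sum of the two slice
  -- integrals.
  have key := hJ.ae_eq_zero_of_integral_contDiff_smul_eq_zero (μ := volume)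
    (jG.add jF).locallyIntegrableOn ?_
  · rw [ae_restrict_iff' hJ.measurableSet]
    filter_upwards [key] with y hy hyJ
    exact eq_neg_of_add_eq_zero_left (hy hyJ)
  · intro v hv hvc hvs
    obtain ⟨M, hM⟩ := hvc.exists_bound_of_continuous hv.continuous
    have bv : ∀ x, ‖(v x : ℂ)‖ ≤ M := fun x => by rw [Complex.norm_real]; exact hM x
    have cv : Continuous fun x => (v x : ℂ) := Complex.continuous_ofReal.comp hv.continuous
    have i1 : IntegrableOn (fun y => (v y : ℂ) * ∫ x in I, (w x : ℂ) * G (x, y)) J :=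
      Integrable.bdd_mul (c := M) jG cv.aestronglyMeasurable (Eventually.of_forall bv)
    have i2 : IntegrableOn (fun y => (v y : ℂ) * ∫ x in I, (w' x : ℂ) * F (x, y)) J :=
      Integrable.bdd_mul (c := M) jF cv.aestronglyMeasurable (Eventually.of_forall bv)
    rw [← setIntegral_eq_integral_of_forall_compl_eq_zero (s := J)]
    · calc _ = ∫ y in J, ((v y : ℂ) * (∫ x in I, (w x : ℂ) * G (x, y)) +
            (v y : ℂ) * ∫ x in I, (w' x : ℂ) * F (x, y)) := by
            congr 1
            ext y
            simp only [Pi.add_apply, Complex.real_smul]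
            ring
        _ = 0 := by
            rw [integral_add i1 i2, integral_mul_integral_slice hG cw cv bw bv,
              integral_mul_integral_slice hF cw' cv bw' bv]
            have := h v hv hvc hvs
            push_cast at this
            rw [this, add_neg_cancel]
    · intro y hy
      have : v y = 0 := by
        by_contra h1
        exact hy (hvs (subset_tsupport _ h1))
      simp [this]

/-- The integration by parts formula holds on almost every slice. -/
theorem slice_relation (h0 : 0 < h)
    (hF : IntegrableOn F (Set.Ioo a (a + h) ×ˢ Set.Ioo b (b + h')))
    (hGa : IntegrableOn Ga (Set.Ioo a (a + h) ×ˢ Set.Ioo b (b + h')))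
    (hA : ProdWeakDeriv (Set.Ioo a (a + h)) (Set.Ioo b (b + h')) F Ga) (n : ℤ) :
    ∀ᵐ y ∂(volume.restrict (Set.Ioo b (b + h'))),
      ∫ x in Set.Ioo a (a + h), (Real.sin (Real.pi * n * (x - a) / h) : ℂ) * Ga (x, y)
        = -((Real.pi * n / h : ℝ) : ℂ) *
      ∫ x in Set.Ioo a (a + h), (Real.cos (Real.pi * n * (x - a) / h) : ℂ) * F (x, y) := by
  have key := slice_of_prod isOpen_Ioo hF hGa (w := fun x => Real.sin (Real.pi * n * (x - a) / h))
    (w' := fun x => Real.pi * n / h * Real.cos (Real.pi * n * (x - a) / h)) (by fun_prop)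
    (by fun_prop) (fun x => Real.abs_sin_le_one _) (B' := |Real.pi * n / h|) (fun x => by
      rw [abs_mul]
      exact mul_le_of_le_one_right (abs_nonneg _) (Real.abs_cos_le_one _))
    (fun v hv _ _ => by
      have := hA.setIntegral_eq hF hGa (contDiff_sin_scaled n a h) (by simp)
        (sin_scaled_right n a h0) hv
      simpa only [deriv_sin_scaled] using this)
  filter_upwards [key] with y hy
  rw [hy, neg_mul, ← integral_const_mul]
  congr 2
  ext x
  push_cast
  ring

/-- The integration by parts formula for the cosine coefficients in the other variable. -/
theorem coeff_relation (h0' : 0 < h')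
    (hF : IntegrableOn F (Set.Ioo a (a + h) ×ˢ Set.Ioo b (b + h')))
    (hGb : IntegrableOn Gb (Set.Ioo a (a + h) ×ˢ Set.Ioo b (b + h')))
    (hB : ProdWeakDeriv (Set.Ioo b (b + h')) (Set.Ioo a (a + h)) (fun z => F z.swap)
      (fun z => Gb z.swap)) (n l : ℤ) :
    ∫ y in Set.Ioo b (b + h'), (Real.sin (Real.pi * l * (y - b) / h') : ℂ) *
        ∫ x in Set.Ioo a (a + h), (Real.cos (Real.pi * n * (x - a) / h) : ℂ) * Gb (x, y)
      = -((Real.pi * l / h' : ℝ) : ℂ) *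
    ∫ y in Set.Ioo b (b + h'), (Real.cos (Real.pi * l * (y - b) / h') : ℂ) *
        ∫ x in Set.Ioo a (a + h), (Real.cos (Real.pi * n * (x - a) / h) : ℂ) * F (x, y) := by
  rw [integral_mul_integral_slice hGb (c := fun x => (Real.cos (Real.pi * n * (x - a) / h) : ℂ))
      (e := fun y => (Real.sin (Real.pi * l * (y - b) / h') : ℂ)) (by fun_prop) (by fun_prop)
      (fun x => norm_ofReal_cos_le _) (fun x => norm_ofReal_sin_le _),
    integral_mul_integral_slice hF (c := fun x => (Real.cos (Real.pi * n * (x - a) / h) : ℂ))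
      (e := fun y => (Real.cos (Real.pi * l * (y - b) / h') : ℂ)) (by fun_prop) (by fun_prop)
      (fun x => norm_ofReal_cos_le _) (fun x => norm_ofReal_cos_le _)]
  have e3 := hB.setIntegral_eq hF.swap hGb.swap (contDiff_sin_scaled l b h') (by simp)
      (sin_scaled_right l b h0') (contDiff_cos_scaled n a h)
  rw [setIntegral_swap (Set.Ioo a (a + h)) (Set.Ioo b (b + h')),
    setIntegral_swap (Set.Ioo a (a + h)) (Set.Ioo b (b + h'))] at e3
  simp only [Prod.fst_swap, Prod.snd_swap, Prod.swap_swap] at e3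
  simp_rw [deriv_sin_scaled] at e3
  have e4 : ∀ z : ℝ × ℝ, ((Real.pi * l / h' * Real.cos (Real.pi * l * (z.2 - b) / h') *
      Real.cos (Real.pi * n * (z.1 - a) / h) : ℝ) : ℂ) * F z = ((Real.pi * l / h' : ℝ) : ℂ) *
      ((Real.cos (Real.pi * n * (z.1 - a) / h) : ℂ) * (Real.cos (Real.pi * l * (z.2 - b) / h') : ℂ)
        * F z) := by
    intro z
    push_cast
    ring
  have e5 : ∀ z : ℝ × ℝ, ((Real.sin (Real.pi * l * (z.2 - b) / h') *
      Real.cos (Real.pi * n * (z.1 - a) / h) : ℝ) : ℂ) * Gb z =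
      (Real.cos (Real.pi * n * (z.1 - a) / h) : ℂ) * (Real.sin (Real.pi * l * (z.2 - b) / h') : ℂ)
        * Gb z := by
    intro z
    push_cast
    ring
  simp_rw [e4, e5] at e3
  rw [integral_const_mul] at e3
  rw [neg_mul, e3, neg_neg]

/-- Neumann inequality on a rectangle, up to the product cosine modes `(n, l)` with
`|n| < m`, `|l| < M`. -/
theorem rectangle_poincare (h0 : 0 < h) (h0' : 0 < h')
    (hFm : StronglyMeasurable F) (hGam : StronglyMeasurable Ga) (hGbm : StronglyMeasurable Gb)
    (hF : MemLp F 2 (volume.restrict (Set.Ioo a (a + h) ×ˢ Set.Ioo b (b + h'))))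
    (hGa : MemLp Ga 2 (volume.restrict (Set.Ioo a (a + h) ×ˢ Set.Ioo b (b + h'))))
    (hGb : MemLp Gb 2 (volume.restrict (Set.Ioo a (a + h) ×ˢ Set.Ioo b (b + h'))))
    (hA : ProdWeakDeriv (Set.Ioo a (a + h)) (Set.Ioo b (b + h')) F Ga)
    (hB : ProdWeakDeriv (Set.Ioo b (b + h')) (Set.Ioo a (a + h)) (fun z => F z.swap)
      (fun z => Gb z.swap)) {m M : ℕ} (hm : 0 < m) (hM : 0 < M) :
    ∫ z in Set.Ioo a (a + h) ×ˢ Set.Ioo b (b + h'), ‖F z‖ ^ 2 ≤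
      (h / (Real.pi * m)) ^ 2 * (∫ z in Set.Ioo a (a + h) ×ˢ Set.Ioo b (b + h'), ‖Ga z‖ ^ 2) +
      (h' / (Real.pi * M)) ^ 2 * (∫ z in Set.Ioo a (a + h) ×ˢ Set.Ioo b (b + h'), ‖Gb z‖ ^ 2) +
      1 / h * (1 / h' * ∑ n ∈ Finset.Ioo (-m : ℤ) m, ∑ l ∈ Finset.Ioo (-M : ℤ) M,
        ‖∫ z in Set.Ioo a (a + h) ×ˢ Set.Ioo b (b + h'),
          (Real.cos (Real.pi * n * (z.1 - a) / h) : ℂ) *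
            (Real.cos (Real.pi * l * (z.2 - b) / h') : ℂ) * F z‖ ^ 2) := by
  have hfin : IsFiniteMeasure (volume.restrict (Set.Ioo a (a + h) ×ˢ Set.Ioo b (b + h'))) :=
    ⟨by
      rw [Measure.restrict_apply_univ, Measure.volume_eq_prod, Measure.prod_prod, Real.volume_Ioo,
        Real.volume_Ioo]
      exact ENNReal.mul_lt_top ENNReal.ofReal_lt_top ENNReal.ofReal_lt_top⟩
  have iF : IntegrableOn F (Set.Ioo a (a + h) ×ˢ Set.Ioo b (b + h')) :=
    hF.integrable (by norm_num)
  have iGa : IntegrableOn Ga (Set.Ioo a (a + h) ×ˢ Set.Ioo b (b + h')) :=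
    hGa.integrable (by norm_num)
  have iGb : IntegrableOn Gb (Set.Ioo a (a + h) ×ˢ Set.Ioo b (b + h')) :=
    hGb.integrable (by norm_num)
  set C : ℤ → ℝ → ℂ := fun n y => ∫ x in Set.Ioo a (a + h),
    (Real.cos (Real.pi * n * (x - a) / h) : ℂ) * F (x, y) with hC
  set D : ℤ → ℝ → ℂ := fun n y => ∫ x in Set.Ioo a (a + h),
    (Real.cos (Real.pi * n * (x - a) / h) : ℂ) * Gb (x, y) with hD
  have mC : ∀ n, MemLp (C n) 2 (volume.restrict (Set.Ioo b (b + h'))) :=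
    fun n => memLp_cosine_coeff h0 hFm hF n
  have mD : ∀ n, MemLp (D n) 2 (volume.restrict (Set.Ioo b (b + h'))) :=
    fun n => memLp_cosine_coeff h0 hGbm hGb n
  have iC : ∀ n, Integrable (fun y => ‖C n y‖ ^ 2) (volume.restrict (Set.Ioo b (b + h'))) :=
    fun n => (memLp_two_iff_integrable_sq_norm (mC n).1).1 (mC n)
  have iD : ∀ n, Integrable (fun y => ‖D n y‖ ^ 2) (volume.restrict (Set.Ioo b (b + h'))) :=
    fun n => (memLp_two_iff_integrable_sq_norm (mD n).1).1 (mD n)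
  -- slices in the first variable
  have hfst : ∫ z in Set.Ioo a (a + h) ×ˢ Set.Ioo b (b + h'), ‖F z‖ ^ 2 ≤
      (h / (Real.pi * m)) ^ 2 * (∫ z in Set.Ioo a (a + h) ×ˢ Set.Ioo b (b + h'), ‖Ga z‖ ^ 2) +
      1 / h * ∑ n ∈ Finset.Ioo (-m : ℤ) m, ∫ y in Set.Ioo b (b + h'), ‖C n y‖ ^ 2 := by
    rw [← integral_integral_norm_sq hF, ← integral_integral_norm_sq hGa,
      ← integral_finsetSum _ (fun n _ => iC n), ← integral_const_mul, ← integral_const_mul,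
      ← integral_add ((integrable_integral_norm_sq hGa).const_mul _)
        ((integrable_finsetSum _ (fun n _ => iC n)).const_mul _)]
    refine integral_mono_ae (integrable_integral_norm_sq hF)
      (((integrable_integral_norm_sq hGa).const_mul _).add
        ((integrable_finsetSum _ (fun n _ => iC n)).const_mul _)) ?_
    filter_upwards [memLp_slice_ae hFm hF, memLp_slice_ae hGam hGa,
      ae_all_iff.2 (slice_relation h0 iF iGa hA)] with y h1 h2 h3
    exact neumann_poincare a h0 (hFm.comp_measurable measurable_prodMk_right)
      (hGam.comp_measurable measurable_prodMk_right) h1 h2 h3 hm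
  -- the coefficients are functions of the second variable
  have hsnd : ∀ n, ∫ y in Set.Ioo b (b + h'), ‖C n y‖ ^ 2 ≤
      (h' / (Real.pi * M)) ^ 2 * (∫ y in Set.Ioo b (b + h'), ‖D n y‖ ^ 2) +
      1 / h' * ∑ l ∈ Finset.Ioo (-M : ℤ) M, ‖∫ z in Set.Ioo a (a + h) ×ˢ Set.Ioo b (b + h'),
          (Real.cos (Real.pi * n * (z.1 - a) / h) : ℂ) *
            (Real.cos (Real.pi * l * (z.2 - b) / h') : ℂ) * F z‖ ^ 2 := by
    intro n
    have := neumann_poincare b h0' (stronglyMeasurable_integral_slice hFm (by fun_prop))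
      (stronglyMeasurable_integral_slice hGbm (by fun_prop)) (mC n) (mD n)
      (fun l => coeff_relation h0' iF iGb hB n l) hM
    refine this.trans_eq ?_
    congr 2
    refine Finset.sum_congr rfl fun l _ => ?_
    rw [← integral_mul_integral_slice iF
      (c := fun x => (Real.cos (Real.pi * n * (x - a) / h) : ℂ))
      (e := fun y => (Real.cos (Real.pi * l * (y - b) / h') : ℂ)) (by fun_prop) (by fun_prop)
      (fun x => norm_ofReal_cos_le _) (fun x => norm_ofReal_cos_le _)]
  -- By Bessel in the first variable, the derivatives of all the coefficients together cost no more
  -- than the full derivative, so the bound does not deteriorate with the number `m` of modes.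
  have hderiv : 1 / h * ∑ n ∈ Finset.Ioo (-m : ℤ) m, ∫ y in Set.Ioo b (b + h'), ‖D n y‖ ^ 2
      ≤ ∫ z in Set.Ioo a (a + h) ×ˢ Set.Ioo b (b + h'), ‖Gb z‖ ^ 2 := by
    rw [← integral_integral_norm_sq hGb, ← integral_finsetSum _ (fun n _ => iD n),
      ← integral_const_mul]
    refine integral_mono_ae ((integrable_finsetSum _ (fun n _ => iD n)).const_mul _)
      (integrable_integral_norm_sq hGb) ?_
    filter_upwards [memLp_slice_ae hGbm hGb] with y h1
    exact cosine_bessel a h0 (hGbm.comp_measurable measurable_prodMk_right) h1 m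
  have hsum := Finset.sum_le_sum fun n (_ : n ∈ Finset.Ioo (-m : ℤ) m) => hsnd n
  rw [Finset.sum_add_distrib, ← Finset.mul_sum, ← Finset.mul_sum] at hsum
  have hscaled := mul_le_mul_of_nonneg_left hsum (by positivity : 0 ≤ 1 / h)
  have hbound := mul_le_mul_of_nonneg_left hderiv (by positivity : 0 ≤ (h' / (Real.pi * M)) ^ 2)
  linarith

/-! ## Reflection across the axes -/

theorem measurableSet_quadrant : MeasurableSet quadrant := measurableSet_Ioi.prod measurableSet_Ioi

theorem isOpen_quadrant : IsOpen quadrant := isOpen_Ioi.prod isOpen_Ioi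

/-- Folding an integral along a measure preserving involution. -/
theorem setIntegral_fold {X E : Type*} [MeasurableSpace X] [NormedAddCommGroup E] [NormedSpace ℝ E]
    {μ : Measure X} {σ : X → X} (hσ : MeasurePreserving σ μ μ) (hinv : Function.Involutive σ)
    {A B : Set X} (hA : MeasurableSet A) (hB : MeasurableSet B) (hBσ : σ ⁻¹' B = B)
    (hdisj : Disjoint A (σ ⁻¹' A)) (hcover : ∀ᵐ x ∂μ, x ∈ A ∪ σ ⁻¹' A) {K : X → E}
    (hK : IntegrableOn K B μ) :
    ∫ x in B, K x ∂μ = ∫ x in B ∩ A, (K x + K (σ x)) ∂μ := by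
  have hemb : MeasurableEmbedding σ :=
    (MeasurableEquiv.ofInvolutive σ hinv hσ.measurable).measurableEmbedding
  have h1 : ∫ x in B, K x ∂μ = ∫ x in (B ∩ A) ∪ (B ∩ σ ⁻¹' A), K x ∂μ := by
    refine setIntegral_congr_set ?_
    filter_upwards [hcover] with x hx
    rw [← Set.inter_union_distrib_left]
    exact propext ⟨fun h => ⟨h, hx⟩, fun h => h.1⟩
  have hset : B ∩ σ ⁻¹' A = σ ⁻¹' (B ∩ A) := by rw [Set.preimage_inter, hBσ]
  have i2 : IntegrableOn (fun x => K (σ x)) (B ∩ A) μ := by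
    have : IntegrableOn (K ∘ σ) (σ ⁻¹' (σ ⁻¹' (B ∩ A))) μ := by
      rw [hσ.integrableOn_comp_preimage hemb, ← hset]
      exact hK.mono_set Set.inter_subset_left
    rwa [← Set.preimage_comp, hinv.comp_self, Set.preimage_id] at this
  rw [h1, setIntegral_union (hdisj.mono Set.inter_subset_right Set.inter_subset_right)
      (hB.inter (hσ.measurable hA)) (hK.mono_set Set.inter_subset_left)
      (hK.mono_set Set.inter_subset_left),
    integral_add (hK.mono_set Set.inter_subset_left) i2, hset]
  congr 1
  rw [← hσ.setIntegral_preimage_emb hemb (fun x => K (σ x)) (B ∩ A)]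
  simp [hinv _]

theorem ae_fst_ne_zero : ∀ᵐ z : ℝ × ℝ, z.1 ≠ 0 := by
  rw [Measure.volume_eq_prod]
  exact Measure.quasiMeasurePreserving_fst.ae (by simp [ae_iff] : ∀ᵐ x : ℝ, x ≠ 0)

theorem ae_snd_ne_zero : ∀ᵐ z : ℝ × ℝ, z.2 ≠ 0 := by
  rw [Measure.volume_eq_prod]
  exact Measure.quasiMeasurePreserving_snd.ae (by simp [ae_iff] : ∀ᵐ x : ℝ, x ≠ 0)

theorem measurePreserving_neg_fst :
    MeasurePreserving (fun z : ℝ × ℝ => (-z.1, z.2)) volume volume :=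
  (Measure.measurePreserving_neg (volume : Measure ℝ)).prod (MeasurePreserving.id volume)

theorem measurePreserving_neg_snd :
    MeasurePreserving (fun z : ℝ × ℝ => (z.1, -z.2)) volume volume :=
  (MeasurePreserving.id volume).prod (Measure.measurePreserving_neg (volume : Measure ℝ))

/-- Two successive folds, across `x = 0` and across `y = 0`; the axes are null sets. -/
theorem setIntegral_fold_quadrant {E : Type*} [NormedAddCommGroup E] [NormedSpace ℝ E]
    {B : Set (ℝ × ℝ)} (hB : MeasurableSet B) (hB1 : ∀ z, (-z.1, z.2) ∈ B ↔ z ∈ B)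
    (hB2 : ∀ z, (z.1, -z.2) ∈ B ↔ z ∈ B) {K : ℝ × ℝ → E}
    (hK : IntegrableOn K B) :
    ∫ z in B, K z = ∫ z in B ∩ quadrant,
      (K z + K (-z.1, z.2) + (K (z.1, -z.2) + K (-z.1, -z.2))) := by
  have i2 : IntegrableOn (fun z : ℝ × ℝ => K (-z.1, z.2)) B := by
    have hemb : MeasurableEmbedding (fun z : ℝ × ℝ => (-z.1, z.2)) :=
      (MeasurableEquiv.ofInvolutive _ (fun z => by simp)
        measurePreserving_neg_fst.measurable).measurableEmbedding
    have h1 := (measurePreserving_neg_fst.integrableOn_comp_preimage hemb (f := K) (s := B)).2 hK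
    have h2 : (fun z : ℝ × ℝ => (-z.1, z.2)) ⁻¹' B = B := Set.ext hB1
    rwa [h2] at h1
  rw [setIntegral_fold measurePreserving_neg_fst (fun z => by simp)
      (A := {z | 0 < z.1}) (measurableSet_lt measurable_const measurable_fst) hB (Set.ext hB1) ?_ ?_
      hK,
    setIntegral_fold (K := fun z => K z + K (-z.1, z.2)) measurePreserving_neg_snd
      (fun z => by simp)
      (A := {z | 0 < z.2}) (measurableSet_lt measurable_const measurable_snd)
      (hB.inter (measurableSet_lt measurable_const measurable_fst)) ?_ ?_ ?_
      ((hK.add i2).mono_set Set.inter_subset_left)]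
  · rw [Set.inter_assoc]
    rfl
  · ext z
    simp [hB2]
  · rw [Set.disjoint_left]
    intro z h1 h2
    simp only [Set.mem_ofPred_eq, Set.preimage_ofPred_eq] at h1 h2
    linarith
  · filter_upwards [ae_snd_ne_zero] with z hz
    rcases lt_or_gt_of_ne hz with h | h
    · exact Or.inr (by simpa using h)
    · exact Or.inl h
  · rw [Set.disjoint_left]
    intro z h1 h2
    simp only [Set.mem_ofPred_eq, Set.preimage_ofPred_eq] at h1 h2
    linarith
  · filter_upwards [ae_fst_ne_zero] with z hz
    rcases lt_or_gt_of_ne hz with h | h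
    · exact Or.inr (by simpa using h)
    · exact Or.inl h

/-- `g` is the weak derivative of `φ` in the first coordinate on the quadrant. -/
def WeakDerivQuadrant (φ g : ℝ × ℝ → ℂ) : Prop :=
  ∀ η : ℝ × ℝ → ℝ, ContDiff ℝ ∞ η → HasCompactSupport η → tsupport η ⊆ quadrant →
    ∫ p in quadrant, (fderiv ℝ η p (1, 0) : ℂ) * φ p = - ∫ p in quadrant, (η p : ℂ) * g p

theorem integrableOn_of_memLp_two {X : Type*} [MeasurableSpace X] {μ : Measure X} {f : X → ℂ}
    (hf : MemLp f 2 μ) {S : Set X} (hS : μ S ≠ ⊤) : IntegrableOn f S μ := by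
  have : IsFiniteMeasure (μ.restrict S) := ⟨by simpa using hS.lt_top⟩
  exact (hf.restrict S).integrable (by norm_num)

theorem hasDerivAt_fst {ζ : ℝ × ℝ → ℝ} (hζ : ContDiff ℝ ∞ ζ) (x y : ℝ) :
    HasDerivAt (fun t => ζ (t, y)) (fderiv ℝ ζ (x, y) (1, 0)) x := by
  have h1 : HasDerivAt (fun t : ℝ => (t, y)) ((1 : ℝ), (0 : ℝ)) x :=
    (hasDerivAt_id x).prodMk (hasDerivAt_const x y)
  exact ((hζ.differentiable (by simp)).differentiableAt.hasFDerivAt).comp_hasDerivAt x h1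

/-- The test functions need to vanish only on the axis which is orthogonal to the direction of
differentiation. -/
theorem WeakDerivQuadrant.integral_eq {φ g : ℝ × ℝ → ℂ} (h : WeakDerivQuadrant φ g)
    (hφ : MemLp φ 2 (volume.restrict quadrant)) (hg : MemLp g 2 (volume.restrict quadrant))
    {ζ : ℝ × ℝ → ℝ} (hζ : ContDiff ℝ ∞ ζ) (hζc : HasCompactSupport ζ) (hζ0 : ∀ y, ζ (0, y) = 0) :
    ∫ p in quadrant, (fderiv ℝ ζ p (1, 0) : ℂ) * φ p = - ∫ p in quadrant, (ζ p : ℂ) * g p := by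
  obtain ⟨θ, hθ, hθ0, hθ1, hθz, hθe, T, hT⟩ := exists_cutoff_Ioi
  have hT0 : 0 ≤ T := (abs_nonneg _).trans (hT 0 0)
  have hcd : Continuous fun p => fderiv ℝ ζ p := hζ.continuous_fderiv (by simp)
  obtain ⟨K, hK⟩ := (hζc.fderiv (𝕜 := ℝ)).exists_bound_of_continuous hcd
  have hK0 : 0 ≤ K := (norm_nonneg _).trans (hK 0)
  obtain ⟨M, hM⟩ := hζc.exists_bound_of_continuous hζ.continuous
  -- Vanishing on `x = 0` makes `ζ` of order `|x|`, which absorbs the `x`-derivative of the cutoff.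
  -- The cutoff in `y` is not differentiated in the direction `(1, 0)`, so nothing is needed on `y =
  -- 0`.
  have hlin : ∀ p : ℝ × ℝ, |ζ p| ≤ K * |p.1| := by
    intro p
    have := (convex_univ (𝕜 := ℝ) (E := ℝ × ℝ)).norm_image_sub_le_of_norm_fderiv_le (𝕜 := ℝ)
      (fun x _ => (hζ.differentiable (by simp)).differentiableAt) (fun x _ => hK x)
      (Set.mem_univ ((0 : ℝ), p.2)) (Set.mem_univ p)
    rw [hζ0, sub_zero] at this
    refine this.trans_eq ?_
    congr 1
    rw [Prod.norm_def]
    simp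
  set w : ℕ → ℝ × ℝ → ℝ := fun n p => θ n p.1 * θ n p.2 * ζ p with hw
  have hwd : ∀ n, ContDiff ℝ ∞ (w n) := fun n =>
    (((hθ n).comp contDiff_fst).mul ((hθ n).comp contDiff_snd)).mul hζ
  have hwc : ∀ n, HasCompactSupport (w n) := fun n => hζc.mul_left
  have hwder : ∀ n p, fderiv ℝ (w n) p (1, 0)
      = deriv (θ n) p.1 * θ n p.2 * ζ p + θ n p.1 * θ n p.2 * fderiv ℝ ζ p (1, 0) := by
    intro n p
    have h1 := hasDerivAt_fst (hwd n) p.1 p.2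
    have h2 : HasDerivAt (θ n) (deriv (θ n) p.1) p.1 :=
      ((hθ n).differentiable (by simp)).differentiableAt.hasDerivAt
    have h3 := (h2.mul_const (θ n p.2)).mul (hasDerivAt_fst hζ p.1 p.2)
    exact h1.unique h3
  have hws : ∀ n, tsupport (w n) ⊆ quadrant := by
    intro n
    have hpos : (0 : ℝ) < 1 / ((n : ℝ) + 1) := by positivity
    have : tsupport (w n) ⊆ Set.Ici (1 / ((n : ℝ) + 1)) ×ˢ Set.Ici (1 / ((n : ℝ) + 1)) := by
      refine closure_minimal (fun p hp => ?_) (isClosed_Ici.prod isClosed_Ici)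
      rw [Function.mem_support] at hp
      constructor
      · by_contra hlt
        rw [Set.mem_Ici, not_le] at hlt
        exact hp (by simp [hw, hθz n p.1 hlt.le])
      · by_contra hlt
        rw [Set.mem_Ici, not_le] at hlt
        exact hp (by simp [hw, hθz n p.2 hlt.le])
    exact this.trans (Set.prod_mono (fun x hx => hpos.trans_le hx) (fun x hx => hpos.trans_le hx))
  have hfin : (volume.restrict quadrant) (tsupport ζ) ≠ ⊤ :=
    ((Measure.restrict_apply_le _ _).trans_lt hζc.isCompact.measure_lt_top).ne
  have iφ : Integrable ((tsupport ζ).indicator fun p => φ p) (volume.restrict quadrant) :=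
    (integrableOn_of_memLp_two hφ hfin).integrable_indicator (isClosed_tsupport _).measurableSet
  have ig : Integrable ((tsupport ζ).indicator fun p => g p) (volume.restrict quadrant) :=
    (integrableOn_of_memLp_two hg hfin).integrable_indicator (isClosed_tsupport _).measurableSet
  have lim1 : Tendsto (fun n => ∫ p in quadrant, (fderiv ℝ (w n) p (1, 0) : ℂ) * φ p) atTop
      (𝓝 (∫ p in quadrant, (fderiv ℝ ζ p (1, 0) : ℂ) * φ p)) := by
    refine tendsto_integral_of_dominated_convergence
      (fun p => (T * K + K) * ‖(tsupport ζ).indicator (fun p => φ p) p‖) (fun n => ?_)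
      (iφ.norm.const_mul _) (fun n => ?_) ?_
    · refine AEStronglyMeasurable.mul (Continuous.aestronglyMeasurable ?_) hφ.1
      exact Complex.continuous_ofReal.comp
        (((hwd n).continuous_fderiv (by simp)).clm_apply continuous_const)
    · refine Eventually.of_forall fun p => ?_
      by_cases hp : p ∈ tsupport ζ
      · rw [norm_mul, Set.indicator_of_mem hp, Complex.norm_real, hwder]
        gcongr
        refine (norm_add_le _ _).trans (add_le_add ?_ ?_)
        · rw [norm_mul, norm_mul, Real.norm_eq_abs, Real.norm_eq_abs, Real.norm_eq_abs,
            abs_of_nonneg (hθ0 n p.2)]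
          calc _ ≤ |deriv (θ n) p.1| * 1 * (K * |p.1|) := by
                gcongr
                · exact hθ1 _ _
                · exact hlin p
            _ = |deriv (θ n) p.1 * p.1| * K := by rw [abs_mul]; ring
            _ ≤ _ := by gcongr; exact hT _ _
        · rw [norm_mul, norm_mul, Real.norm_eq_abs, Real.norm_eq_abs, abs_of_nonneg (hθ0 n p.2),
            abs_of_nonneg (hθ0 n p.1)]
          have h3 : ‖fderiv ℝ ζ p (1, 0)‖ ≤ K := by
            refine ((fderiv ℝ ζ p).le_opNorm _).trans ?_
            have : ‖((1 : ℝ), (0 : ℝ))‖ = 1 := by simp [Prod.norm_def]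
            rw [this, mul_one]
            exact hK p
          calc _ ≤ 1 * 1 * K := by
                gcongr
                · exact hθ0 _ _
                · exact hθ1 _ _
                · exact hθ1 _ _
            _ = K := by ring
      · have h0 : ζ p = 0 := image_eq_zero_of_notMem_tsupport hp
        have h1 : fderiv ℝ ζ p = 0 :=
          image_eq_zero_of_notMem_tsupport (fun h => hp (tsupport_fderiv_subset ℝ h))
        rw [hwder, h0, h1]
        simp only [mul_zero, zero_mul, add_zero, zero_apply, Complex.ofReal_zero,
          norm_zero]
        positivity
    · filter_upwards [ae_restrict_mem measurableSet_quadrant] with p hp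
      refine tendsto_const_nhds.congr' ?_
      filter_upwards [hθe _ hp.1, hθe _ hp.2] with n h1 h2
      rw [hwder, h1.deriv_eq, h1.self_of_nhds, h2.self_of_nhds]
      simp
  have lim2 : Tendsto (fun n => ∫ p in quadrant, (w n p : ℂ) * g p) atTop
      (𝓝 (∫ p in quadrant, (ζ p : ℂ) * g p)) := by
    refine tendsto_integral_of_dominated_convergence
      (fun p => M * ‖(tsupport ζ).indicator (fun p => g p) p‖) (fun n => ?_)
      (ig.norm.const_mul _) (fun n => ?_) ?_
    · refine AEStronglyMeasurable.mul (Continuous.aestronglyMeasurable ?_) hg.1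
      exact Complex.continuous_ofReal.comp (hwd n).continuous
    · refine Eventually.of_forall fun p => ?_
      by_cases hp : p ∈ tsupport ζ
      · rw [norm_mul, Set.indicator_of_mem hp, Complex.norm_real]
        gcongr
        simp only [hw]
        rw [norm_mul, norm_mul, Real.norm_eq_abs, Real.norm_eq_abs, abs_of_nonneg (hθ0 n p.2),
            abs_of_nonneg (hθ0 n p.1)]
        calc _ ≤ 1 * 1 * M := by
              gcongr
              · exact hθ0 _ _
              · exact hθ1 _ _
              · exact hθ1 _ _
              · exact hM p
          _ = M := by ring
      · have h0 : ζ p = 0 := image_eq_zero_of_notMem_tsupport hp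
        simp [hw, h0, hp]
    · filter_upwards [ae_restrict_mem measurableSet_quadrant] with p hp
      refine tendsto_const_nhds.congr' ?_
      filter_upwards [hθe _ hp.1, hθe _ hp.2] with n h1 h2
      simp only [hw]
      rw [h1.self_of_nhds, h2.self_of_nhds]
      simp
  refine tendsto_nhds_unique lim1 ?_
  have heq : ∀ n, _ := fun n => h (w n) (hwd n) (hwc n) (hws n)
  simp_rw [heq]
  exact lim2.neg

theorem integrableOn_of_fold {X E : Type*} [MeasurableSpace X] [NormedAddCommGroup E]
    {μ : Measure X} {σ : X → X} (hσ : MeasurePreserving σ μ μ) (hinv : Function.Involutive σ)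
    {A B : Set X} (hBσ : σ ⁻¹' B = B) (hcover : ∀ᵐ x ∂μ, x ∈ A ∪ σ ⁻¹' A) {K : X → E}
    (hKσ : ∀ x, K (σ x) = K x) (hK : IntegrableOn K (B ∩ A) μ) : IntegrableOn K B μ := by
  have hemb : MeasurableEmbedding σ :=
    (MeasurableEquiv.ofInvolutive σ hinv hσ.measurable).measurableEmbedding
  have h1 : IntegrableOn (K ∘ σ) (σ ⁻¹' (B ∩ A)) μ :=
    (hσ.integrableOn_comp_preimage hemb).2 hK
  rw [show K ∘ σ = K from funext hKσ, Set.preimage_inter, hBσ] at h1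
  refine (hK.union h1).mono_set_ae ?_
  filter_upwards [hcover] with x hx hxB
  rw [← Set.inter_union_distrib_left]
  exact ⟨hxB, hx⟩

theorem ae_mem_pos_fst : ∀ᵐ z : ℝ × ℝ,
    z ∈ {z : ℝ × ℝ | 0 < z.1} ∪ (fun z : ℝ × ℝ => (-z.1, z.2)) ⁻¹' {z : ℝ × ℝ | 0 < z.1} := by
  filter_upwards [ae_fst_ne_zero] with z hz
  rcases lt_or_gt_of_ne hz with h | h
  · exact Or.inr (by simpa using h)
  · exact Or.inl h

theorem ae_mem_pos_snd : ∀ᵐ z : ℝ × ℝ,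
    z ∈ {z : ℝ × ℝ | 0 < z.2} ∪ (fun z : ℝ × ℝ => (z.1, -z.2)) ⁻¹' {z : ℝ × ℝ | 0 < z.2} := by
  filter_upwards [ae_snd_ne_zero] with z hz
  rcases lt_or_gt_of_ne hz with h | h
  · exact Or.inr (by simpa using h)
  · exact Or.inl h

theorem integrable_of_fold_quadrant {E : Type*} [NormedAddCommGroup E] {K : ℝ × ℝ → E}
    (hK1 : ∀ z : ℝ × ℝ, K (-z.1, z.2) = K z) (hK2 : ∀ z : ℝ × ℝ, K (z.1, -z.2) = K z)
    (hK : IntegrableOn K quadrant) : Integrable K := by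
  rw [← integrableOn_univ]
  refine integrableOn_of_fold measurePreserving_neg_fst (fun z => by simp) rfl ae_mem_pos_fst hK1 ?_
  refine integrableOn_of_fold measurePreserving_neg_snd (fun z => by simp) ?_ ae_mem_pos_snd hK2 ?_
  · ext z
    simp
  · rw [Set.univ_inter]
    exact hK

/-- The extension of a function on the quadrant which is even in both coordinates. -/
def reflect (φ : ℝ × ℝ → ℂ) (z : ℝ × ℝ) : ℂ := φ (|z.1|, |z.2|)

/-- The extension of a function on the quadrant which is odd in the first coordinate and even in the
second one. -/
def reflectOdd (φ : ℝ × ℝ → ℂ) (z : ℝ × ℝ) : ℂ := (SignType.sign z.1 : ℂ) * φ (|z.1|, |z.2|)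


section Reflect

variable {φ g : ℝ × ℝ → ℂ}

theorem reflect_of_mem {z : ℝ × ℝ} (hz : z ∈ quadrant) : reflect φ z = φ z := by
  rw [reflect, abs_of_pos hz.1, abs_of_pos hz.2]

theorem reflectOdd_of_mem {z : ℝ × ℝ} (hz : z ∈ quadrant) : reflectOdd φ z = φ z := by
  have : (0 : ℝ) < z.1 := hz.1
  rw [reflectOdd, abs_of_pos hz.1, abs_of_pos hz.2, sign_pos this]
  simp

theorem reflect_neg_fst (z : ℝ × ℝ) : reflect φ (-z.1, z.2) = reflect φ z := by simp [reflect]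

theorem reflect_neg_snd (z : ℝ × ℝ) : reflect φ (z.1, -z.2) = reflect φ z := by simp [reflect]

theorem reflectOdd_neg_fst (z : ℝ × ℝ) : reflectOdd φ (-z.1, z.2) = -reflectOdd φ z := by
  simp [reflectOdd, Left.sign_neg]

theorem reflectOdd_neg_snd (z : ℝ × ℝ) : reflectOdd φ (z.1, -z.2) = reflectOdd φ z := by
  simp [reflectOdd]

theorem stronglyMeasurable_reflect (hφ : StronglyMeasurable φ) : StronglyMeasurable (reflect φ) :=
  hφ.comp_measurable (by fun_prop)

theorem stronglyMeasurable_reflectOdd (hφ : StronglyMeasurable φ) :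
    StronglyMeasurable (reflectOdd φ) :=
  (measurable_sign.comp measurable_fst).stronglyMeasurable.mul (hφ.comp_measurable (by fun_prop))

theorem norm_reflectOdd_ae : ∀ᵐ z, ‖reflectOdd φ z‖ = ‖reflect φ z‖ := by
  filter_upwards [ae_fst_ne_zero] with z hz
  rcases lt_or_gt_of_ne hz with h | h <;> simp [reflectOdd, reflect, h]

theorem memLp_reflect (hφm : StronglyMeasurable φ)
    (hφ : MemLp φ 2 (volume.restrict quadrant)) : MemLp (reflect φ) 2 volume := by
  rw [memLp_two_iff_integrable_sq_norm hφ.1] at hφ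
  rw [memLp_two_iff_integrable_sq_norm (stronglyMeasurable_reflect hφm).aestronglyMeasurable]
  refine integrable_of_fold_quadrant (fun z => by rw [reflect_neg_fst])
    (fun z => by rw [reflect_neg_snd]) (hφ.congr ?_)
  filter_upwards [ae_restrict_mem measurableSet_quadrant] with z hz
  rw [reflect_of_mem hz]

theorem memLp_reflectOdd (hφm : StronglyMeasurable φ)
    (hφ : MemLp φ 2 (volume.restrict quadrant)) : MemLp (reflectOdd φ) 2 volume :=
  (memLp_reflect hφm hφ).congr_norm (stronglyMeasurable_reflectOdd hφm).aestronglyMeasurable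
    (by filter_upwards [norm_reflectOdd_ae] with z hz using hz.symm)

theorem integrable_bounded_mul_of_memLp {f : ℝ × ℝ → ℂ} (hf : MemLp f 2 volume)
    {c : ℝ × ℝ → ℝ} (hc : Continuous c) (hcs : HasCompactSupport c) :
    Integrable (fun z => (c z : ℂ) * f z) := by
  obtain ⟨M, hM⟩ := hcs.exists_bound_of_continuous hc
  have h1 : Integrable ((tsupport c).indicator f) volume :=
    (integrableOn_of_memLp_two hf hcs.isCompact.measure_lt_top.ne).integrable_indicator
      (isClosed_tsupport _).measurableSet
  have h2 : (fun z => (c z : ℂ) * f z) = fun z => (c z : ℂ) * (tsupport c).indicator f z := by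
    ext z
    by_cases hz : z ∈ tsupport c
    · rw [Set.indicator_of_mem hz]
    · rw [image_eq_zero_of_notMem_tsupport hz]
      simp
  rw [h2]
  exact h1.bdd_mul (c := M) (Complex.continuous_ofReal.comp hc).aestronglyMeasurable
    (Eventually.of_forall fun z => by rw [Complex.norm_real]; exact hM z)

/-- The even reflection of an `H¹` function is `H¹`. -/
theorem WeakDerivQuadrant.reflect (h : WeakDerivQuadrant φ g) (hφm : StronglyMeasurable φ)
    (hgm : StronglyMeasurable g) (hφ : MemLp φ 2 (volume.restrict quadrant))
    (hg : MemLp g 2 (volume.restrict quadrant))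
    {η : ℝ × ℝ → ℝ} (hη : ContDiff ℝ ∞ η) (hηc : HasCompactSupport η) :
    ∫ p, (fderiv ℝ η p (1, 0) : ℂ) * ElectronPairs.reflect φ p
      = -∫ p, (η p : ℂ) * reflectOdd g p := by
  set r1 : ℝ × ℝ ≃ₜ ℝ × ℝ := (Homeomorph.neg ℝ).prodCongr (Homeomorph.refl ℝ) with hr1
  set r2 : ℝ × ℝ ≃ₜ ℝ × ℝ := (Homeomorph.refl ℝ).prodCongr (Homeomorph.neg ℝ) with hr2
  set r3 : ℝ × ℝ ≃ₜ ℝ × ℝ := (Homeomorph.neg ℝ).prodCongr (Homeomorph.neg ℝ) with hr3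
  have s1 : ContDiff ℝ ∞ fun p : ℝ × ℝ => η (-p.1, p.2) := hη.comp (by fun_prop)
  have s2 : ContDiff ℝ ∞ fun p : ℝ × ℝ => η (p.1, -p.2) := hη.comp (by fun_prop)
  have s3 : ContDiff ℝ ∞ fun p : ℝ × ℝ => η (-p.1, -p.2) := hη.comp (by fun_prop)
  have c1 : HasCompactSupport fun p : ℝ × ℝ => η (-p.1, p.2) := hηc.comp_homeomorph r1
  have c2 : HasCompactSupport fun p : ℝ × ℝ => η (p.1, -p.2) := hηc.comp_homeomorph r2
  have c3 : HasCompactSupport fun p : ℝ × ℝ => η (-p.1, -p.2) := hηc.comp_homeomorph r3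
  -- Folding onto the quadrant replaces `η` by its part odd in `x` and even in `y`, up to a factor.
  -- Oddness makes `ζ` vanish on the one axis where `WeakDerivQuadrant.integral_eq` demands it.
  set ζ : ℝ × ℝ → ℝ := fun p =>
    η p - η (-p.1, p.2) + (η (p.1, -p.2) - η (-p.1, -p.2)) with hζ
  have hζd : ContDiff ℝ ∞ ζ := (hη.sub s1).add (s2.sub s3)
  have hζc : HasCompactSupport ζ := (hηc.sub c1).add (c2.sub c3)
  have hζ0 : ∀ y, ζ (0, y) = 0 := by simp [hζ]
  have hder : ∀ p : ℝ × ℝ, fderiv ℝ ζ p (1, 0) = fderiv ℝ η p (1, 0) +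
      fderiv ℝ η (-p.1, p.2) (1, 0) +
      (fderiv ℝ η (p.1, -p.2) (1, 0) + fderiv ℝ η (-p.1, -p.2) (1, 0)) := by
    intro p
    have d0 := hasDerivAt_fst hη p.1 p.2
    have d2 := hasDerivAt_fst hη p.1 (-p.2)
    have d1 := HasDerivAt.comp p.1 (hasDerivAt_fst hη (-p.1) p.2) (hasDerivAt_neg p.1)
    have d3 := HasDerivAt.comp p.1 (hasDerivAt_fst hη (-p.1) (-p.2)) (hasDerivAt_neg p.1)
    have := (hasDerivAt_fst hζd p.1 p.2).unique ((d0.sub d1).add (d2.sub d3))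
    rw [this]
    ring
  have key := h.integral_eq hφ hg hζd hζc hζ0
  have i1 := integrable_bounded_mul_of_memLp (memLp_reflect hφm hφ)
    (c := fun p => fderiv ℝ η p (1, 0))
    ((hη.continuous_fderiv (by simp)).clm_apply continuous_const)
    (hηc.fderiv_apply (𝕜 := ℝ) _)
  have i2 := integrable_bounded_mul_of_memLp (memLp_reflectOdd hgm hg) hη.continuous hηc
  have f1 := setIntegral_fold_quadrant MeasurableSet.univ (by simp) (by simp) i1.integrableOn
  have f2 := setIntegral_fold_quadrant MeasurableSet.univ (by simp) (by simp) i2.integrableOn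
  rw [setIntegral_univ, Set.univ_inter] at f1 f2
  rw [f1, f2]
  have n1 : ∀ z : ℝ × ℝ, ElectronPairs.reflect φ (-z.1, -z.2) = ElectronPairs.reflect φ z :=
    fun z => by simp [ElectronPairs.reflect]
  have n2 : ∀ z : ℝ × ℝ, reflectOdd g (-z.1, -z.2) = -reflectOdd g z :=
    fun z => by simp [reflectOdd, Left.sign_neg]
  have e1 : Set.EqOn (fun z : ℝ × ℝ => (fderiv ℝ η z (1, 0) : ℂ) * ElectronPairs.reflect φ z +
      (fderiv ℝ η (-z.1, z.2) (1, 0) : ℂ) * ElectronPairs.reflect φ (-z.1, z.2) +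
      ((fderiv ℝ η (z.1, -z.2) (1, 0) : ℂ) * ElectronPairs.reflect φ (z.1, -z.2) +
        (fderiv ℝ η (-z.1, -z.2) (1, 0) : ℂ) * ElectronPairs.reflect φ (-z.1, -z.2)))
      (fun z => (fderiv ℝ ζ z (1, 0) : ℂ) * φ z) quadrant := by
    intro z hz
    simp only [reflect_neg_fst, reflect_neg_snd, n1, reflect_of_mem hz, hder]
    push_cast
    ring
  have e2 : Set.EqOn (fun z : ℝ × ℝ => (η z : ℂ) * reflectOdd g z +
      (η (-z.1, z.2) : ℂ) * reflectOdd g (-z.1, z.2) +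
      ((η (z.1, -z.2) : ℂ) * reflectOdd g (z.1, -z.2) +
        (η (-z.1, -z.2) : ℂ) * reflectOdd g (-z.1, -z.2)))
      (fun z => (ζ z : ℂ) * g z) quadrant := by
    intro z hz
    simp only [reflectOdd_neg_fst, reflectOdd_neg_snd, n2, reflectOdd_of_mem hz, hζ]
    push_cast
    ring
  rw [setIntegral_congr_fun measurableSet_quadrant e1,
    setIntegral_congr_fun measurableSet_quadrant e2]
  exact key

end Reflect

/-! ## Linear changes of coordinates -/

section Linear

variable (T : (ℝ × ℝ) ≃L[ℝ] (ℝ × ℝ))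

theorem setIntegral_comp_symm {E : Type*} [NormedAddCommGroup E] [NormedSpace ℝ E]
    {A : Set (ℝ × ℝ)} (hA : MeasurableSet A) (K : ℝ × ℝ → E) :
    ∫ z in A, K (T.symm z) = |(T : ℝ × ℝ →L[ℝ] ℝ × ℝ).det| • ∫ p in T ⁻¹' A, K p := by
  have h := integral_image_eq_integral_abs_det_fderiv_smul volume
    (f := T) (f' := fun _ => (T : ℝ × ℝ →L[ℝ] ℝ × ℝ)) (s := T ⁻¹' A)
    (T.continuous.measurable hA) (fun x _ => (T.hasFDerivAt).hasFDerivWithinAt)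
    T.injective.injOn (fun z => K (T.symm z))
  rw [Set.image_preimage_eq _ T.surjective, integral_smul] at h
  simpa using h

theorem integrable_comp_symm {E : Type*} [NormedAddCommGroup E] [NormedSpace ℝ E]
    {K : ℝ × ℝ → E} (hK : Integrable K) : Integrable fun z => K (T.symm z) := by
  have h := integrableOn_image_iff_integrableOn_abs_det_fderiv_smul volume
    (f := T) (f' := fun _ => (T : ℝ × ℝ →L[ℝ] ℝ × ℝ)) (s := Set.univ)
    MeasurableSet.univ (fun x _ => (T.hasFDerivAt).hasFDerivWithinAt)
    T.injective.injOn (fun z => K (T.symm z))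
  rw [Set.image_univ, T.surjective.range_eq, integrableOn_univ, integrableOn_univ] at h
  rw [h]
  simp only [ContinuousLinearEquiv.symm_apply_apply]
  exact hK.smul |(T : ℝ × ℝ →L[ℝ] ℝ × ℝ).det|

theorem memLp_comp_symm {f : ℝ × ℝ → ℂ} (hfm : StronglyMeasurable f) (hf : MemLp f 2 volume) :
    MemLp (fun z => f (T.symm z)) 2 volume := by
  have hm : StronglyMeasurable fun z => f (T.symm z) :=
    hfm.comp_measurable T.symm.continuous.measurable
  rw [memLp_two_iff_integrable_sq_norm hm.aestronglyMeasurable]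
  exact integrable_comp_symm T ((memLp_two_iff_integrable_sq_norm hf.1).1 hf)

theorem ae_comp_symm {P : ℝ × ℝ → Prop} (hP : ∀ᵐ p, P p) : ∀ᵐ z, P (T.symm z) := by
  have : Measure.QuasiMeasurePreserving (fun z => T.symm z) volume volume := by
    refine ⟨T.symm.continuous.measurable, ?_⟩
    have hd : LinearMap.det ((T.symm : ℝ × ℝ →L[ℝ] ℝ × ℝ) : ℝ × ℝ →ₗ[ℝ] ℝ × ℝ) ≠ 0 :=
      (LinearEquiv.isUnit_det' T.symm.toLinearEquiv).ne_zero
    have := Measure.map_linearMap_addHaar_eq_smul_addHaar (volume : Measure (ℝ × ℝ)) hd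
    refine (Measure.absolutelyContinuous_of_eq this).trans ?_
    exact Measure.smul_absolutelyContinuous
  exact this.ae hP

/-- `G` is the weak gradient of `Φ` on the whole plane. -/
def WeakGradientPlane (Φ G₁ G₂ : ℝ × ℝ → ℂ) : Prop :=
  ∀ η : ℝ × ℝ → ℝ, ContDiff ℝ ∞ η → HasCompactSupport η →
    (∫ p, (fderiv ℝ η p (1, 0) : ℂ) * Φ p = -∫ p, (η p : ℂ) * G₁ p) ∧
    (∫ p, (fderiv ℝ η p (0, 1) : ℂ) * Φ p = -∫ p, (η p : ℂ) * G₂ p)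

/-- The vector `(c₁, c₂)` is the direction in the old coordinates along which only the first new
coordinate varies. The formula is the chain rule for the test function `u ⊗ v` pulled back by `T`;
the Jacobian occurs on both sides and cancels. -/
theorem WeakGradientPlane.prodWeakDeriv {Φ G₁ G₂ : ℝ × ℝ → ℂ} (h : WeakGradientPlane Φ G₁ G₂)
    (hΦ : MemLp Φ 2 volume) (hG₁ : MemLp G₁ 2 volume) (hG₂ : MemLp G₂ 2 volume)
    {c₁ c₂ : ℝ} (hc : T.symm (1, 0) = (c₁, c₂)) (I J : Set ℝ) :
    ProdWeakDeriv I J (fun z => Φ (T.symm z))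
      (fun z => (c₁ : ℂ) * G₁ (T.symm z) + (c₂ : ℂ) * G₂ (T.symm z)) := by
  intro u v hu huc _ hv hvc _
  set η : ℝ × ℝ → ℝ := fun p => u (T p).1 * v (T p).2 with hη
  have hηd : ContDiff ℝ ∞ η := (hu.comp (contDiff_fst.comp T.contDiff)).mul
    (hv.comp (contDiff_snd.comp T.contDiff))
  have hηc : HasCompactSupport η := by
    have h1 : IsCompact (T.toHomeomorph ⁻¹' (tsupport u ×ˢ tsupport v)) :=
      T.toHomeomorph.isCompact_preimage.2 (huc.isCompact.prod hvc.isCompact)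
    refine HasCompactSupport.intro h1 fun p hp => ?_
    rw [Set.mem_preimage, Set.mem_prod, not_and_or] at hp
    rcases hp with h2 | h2
    · have : u (T p).1 = 0 := image_eq_zero_of_notMem_tsupport h2
      simp [hη, this]
    · have : v (T p).2 = 0 := image_eq_zero_of_notMem_tsupport h2
      simp [hη, this]
  have hder : ∀ p, c₁ * fderiv ℝ η p (1, 0) + c₂ * fderiv ℝ η p (0, 1)
      = deriv u (T p).1 * v (T p).2 := by
    intro p
    have e1 : c₁ * fderiv ℝ η p (1, 0) + c₂ * fderiv ℝ η p (0, 1) = fderiv ℝ η p (c₁, c₂) := by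
      have : ((c₁, c₂) : ℝ × ℝ) = c₁ • (1, 0) + c₂ • (0, 1) := by simp
      rw [this, map_add, map_smul, map_smul, smul_eq_mul, smul_eq_mul]
    have d1 : HasDerivAt (fun t : ℝ => p + t • (c₁, c₂)) (c₁, c₂) 0 := by
      simpa using ((hasDerivAt_id (0 : ℝ)).smul_const (c₁, c₂)).const_add p
    have d2 : HasDerivAt (fun t : ℝ => η (p + t • (c₁, c₂))) (fderiv ℝ η p (c₁, c₂)) 0 := by
      have := (hηd.differentiable (by simp)).differentiableAt (x := p) |>.hasFDerivAt
      have e0 : p = p + (0 : ℝ) • (c₁, c₂) := by simp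
      exact HasFDerivAt.comp_hasDerivAt (0 : ℝ) (by rwa [← e0]) d1
    have e2 : (fun t : ℝ => η (p + t • (c₁, c₂))) = fun t => u ((T p).1 + t) * v (T p).2 := by
      ext t
      have : T (c₁, c₂) = (1, 0) := by rw [← hc, T.apply_symm_apply]
      simp only [hη, map_add, map_smul, this]
      simp
    have d3 : HasDerivAt (fun t : ℝ => u ((T p).1 + t) * v (T p).2)
        (deriv u (T p).1 * v (T p).2) 0 := by
      have h1 : HasDerivAt u (deriv u (T p).1) ((T p).1 + 0) := by
        rw [add_zero]
        exact (hu.differentiable (by simp)).differentiableAt.hasDerivAt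
      exact (h1.comp_const_add (T p).1 0).mul_const _
    rw [e1]
    rw [e2] at d2
    exact d2.unique d3
  have i0 : ∀ e : ℝ × ℝ, Integrable fun p => (fderiv ℝ η p e : ℂ) * Φ p := fun e =>
    integrable_bounded_mul_of_memLp hΦ (c := fun p => fderiv ℝ η p e)
      ((hηd.continuous_fderiv (by simp)).clm_apply continuous_const)
      (hηc.fderiv_apply (𝕜 := ℝ) _)
  have i1 := integrable_bounded_mul_of_memLp hG₁ hηd.continuous hηc
  have i2 := integrable_bounded_mul_of_memLp hG₂ hηd.continuous hηc
  have s1 := setIntegral_comp_symm T MeasurableSet.univ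
    (fun p => ((deriv u (T p).1 * v (T p).2 : ℝ) : ℂ) * Φ p)
  have s2 := setIntegral_comp_symm T MeasurableSet.univ
    (fun p => ((u (T p).1 * v (T p).2 : ℝ) : ℂ) * ((c₁ : ℂ) * G₁ p + (c₂ : ℂ) * G₂ p))
  simp only [ContinuousLinearEquiv.apply_symm_apply, Set.preimage_univ, setIntegral_univ] at s1 s2
  rw [s1, s2, ← smul_neg]
  congr 1
  obtain ⟨k1, k2⟩ := h η hηd hηc
  calc ∫ p, ((deriv u (T p).1 * v (T p).2 : ℝ) : ℂ) * Φ p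
      = ∫ p, ((c₁ : ℂ) * ((fderiv ℝ η p (1, 0) : ℂ) * Φ p) +
          (c₂ : ℂ) * ((fderiv ℝ η p (0, 1) : ℂ) * Φ p)) := by
        congr 1
        ext p
        rw [← hder]
        push_cast
        ring
    _ = -((c₁ : ℂ) * (∫ p, (η p : ℂ) * G₁ p) + (c₂ : ℂ) * ∫ p, (η p : ℂ) * G₂ p) := by
        rw [integral_add ((i0 _).const_mul _) ((i0 _).const_mul _), integral_const_mul,
          integral_const_mul, k1, k2]
        ring
    _ = _ := by
        rw [← integral_const_mul, ← integral_const_mul,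
          ← integral_add (i1.const_mul _) (i2.const_mul _)]
        congr 2
        ext p
        simp only [hη]
        ring

theorem WeakGradientPlane.prodWeakDeriv_swap {Φ G₁ G₂ : ℝ × ℝ → ℂ} (h : WeakGradientPlane Φ G₁ G₂)
    (hΦ : MemLp Φ 2 volume) (hG₁ : MemLp G₁ 2 volume) (hG₂ : MemLp G₂ 2 volume)
    {c₁ c₂ : ℝ} (hc : T.symm (0, 1) = (c₁, c₂)) (I J : Set ℝ) :
    ProdWeakDeriv I J (fun z => Φ (T.symm z.swap))
      (fun z => (c₁ : ℂ) * G₁ (T.symm z.swap) + (c₂ : ℂ) * G₂ (T.symm z.swap)) :=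
  h.prodWeakDeriv (T.trans (ContinuousLinearEquiv.prodComm ℝ ℝ ℝ)) hΦ hG₁ hG₂
    (by simpa using hc) I J

end Linear

theorem det_eq_of_matrix (T : ℝ × ℝ →L[ℝ] ℝ × ℝ) {a b c d : ℝ}
    (h : ∀ z : ℝ × ℝ, T z = (a * z.1 + b * z.2, c * z.1 + d * z.2)) : T.det = a * d - b * c := by
  have : (T : ℝ × ℝ →ₗ[ℝ] ℝ × ℝ) = Matrix.toLin (Module.Basis.finTwoProd ℝ)
      (Module.Basis.finTwoProd ℝ) !![a, b; c, d] := by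
    refine LinearMap.ext fun z => ?_
    rw [Matrix.toLin_finTwoProd_apply]
    exact h z
  rw [ContinuousLinearMap.det, this, LinearMap.det_toLin, Matrix.det_fin_two_of]

/-- The coordinates `(x - y, x + y)`. -/
def diagCoord : (ℝ × ℝ) ≃L[ℝ] (ℝ × ℝ) :=
  LinearEquiv.toContinuousLinearEquiv
    { toFun := fun z => (z.1 - z.2, z.1 + z.2)
      invFun := fun z => ((z.1 + z.2) / 2, (z.2 - z.1) / 2)
      map_add' := fun z w => by ext <;> simp <;> ring
      map_smul' := fun c z => by ext <;> simp <;> ring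
      left_inv := fun z => by ext <;> simp
      right_inv := fun z => by ext <;> simp <;> ring }

theorem diagCoord_apply (z : ℝ × ℝ) : diagCoord z = (z.1 - z.2, z.1 + z.2) := rfl

theorem diagCoord_symm_apply (z : ℝ × ℝ) :
    diagCoord.symm z = ((z.1 + z.2) / 2, (z.2 - z.1) / 2) := rfl

theorem diagCoord_det : (diagCoord : ℝ × ℝ →L[ℝ] ℝ × ℝ).det = 2 := by
  rw [det_eq_of_matrix (a := 1) (b := -1) (c := 1) (d := 1)]
  · norm_num
  · intro z
    ext <;> simp [diagCoord_apply]; ring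

/-- The coordinates `(x - y, y)`. -/
def shearCoord : (ℝ × ℝ) ≃L[ℝ] (ℝ × ℝ) :=
  LinearEquiv.toContinuousLinearEquiv
    { toFun := fun z => (z.1 - z.2, z.2)
      invFun := fun z => (z.1 + z.2, z.2)
      map_add' := fun z w => by ext <;> simp; ring
      map_smul' := fun c z => by ext <;> simp; ring
      left_inv := fun z => by ext <;> simp
      right_inv := fun z => by ext <;> simp }

theorem shearCoord_apply (z : ℝ × ℝ) : shearCoord z = (z.1 - z.2, z.2) := rfl

theorem shearCoord_symm_apply (z : ℝ × ℝ) : shearCoord.symm z = (z.1 + z.2, z.2) := rfl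

theorem shearCoord_det : (shearCoord : ℝ × ℝ →L[ℝ] ℝ × ℝ).det = 1 := by
  rw [det_eq_of_matrix (a := 1) (b := -1) (c := 0) (d := 1)]
  · norm_num
  · intro z
    ext <;> simp [shearCoord_apply]; ring

/-! ## The arms: a Dirichlet inequality on slices -/

theorem integral_Ioo_eq_interval {E : Type*} [NormedAddCommGroup E] [NormedSpace ℝ E] {a b : ℝ}
    (h : a ≤ b) (f : ℝ → E) : ∫ x in Set.Ioo a b, f x = ∫ x in a..b, f x := by
  rw [intervalIntegral.integral_of_le h, integral_Ioc_eq_integral_Ioo]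

/-- Dirichlet inequality in the first variable, for functions which are odd in this variable and
vanish for `|x| > d`. -/
theorem dirichlet_slices {d b e : ℝ} (hd : 0 < d) {F G : ℝ × ℝ → ℂ}
    (hFm : StronglyMeasurable F) (hGm : StronglyMeasurable G)
    (hF : MemLp F 2 volume) (hG : MemLp G 2 volume)
    (hw : ProdWeakDeriv Set.univ (Set.Ioo b e) F G)
    (hF0 : ∀ᵐ z : ℝ × ℝ, z.2 ∈ Set.Ioo b e → d < |z.1| → F z = 0)
    (hG0 : ∀ᵐ z : ℝ × ℝ, z.2 ∈ Set.Ioo b e → d < |z.1| → G z = 0)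
    (hodd : ∀ᵐ z : ℝ × ℝ, F (-z.1, z.2) = -F z) :
    ∫ z in Set.Ioo (-d) d ×ˢ Set.Ioo b e, ‖F z‖ ^ 2
      ≤ (d / Real.pi) ^ 2 * ∫ z in Set.Ioo (-d) d ×ˢ Set.Ioo b e, ‖G z‖ ^ 2 := by
  have hdd : -d < d := by linarith
  have hfin : volume (Set.Ioo (-d) d ×ˢ Set.Ioo b e) ≠ ⊤ := by
    rw [Measure.volume_eq_prod, Measure.prod_prod, Real.volume_Ioo, Real.volume_Ioo]
    exact (ENNReal.mul_lt_top ENNReal.ofReal_lt_top ENNReal.ofReal_lt_top).ne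
  have iF := integrableOn_of_memLp_two hF hfin
  have iG := integrableOn_of_memLp_two hG hfin
  -- The bump only supplies compact support: it equals one near `(-d, d)`, beyond which `F` and `G`
  -- vanish. Hence arbitrary `w` may be tested, with no condition at `± d`; this encodes the
  -- Dirichlet condition.
  let ρ : ContDiffBump (0 : ℝ) := ⟨d + 1, d + 2, by linarith, by linarith⟩
  have hρ1 : ∀ x ∈ Set.Ioo (-d) d, ρ =ᶠ[𝓝 x] 1 := fun x hx =>
    ρ.eventuallyEq_one_of_mem_ball (by
      rw [Metric.mem_ball, Real.dist_0_eq_abs]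
      exact (abs_lt.2 hx).trans (by show d < d + 1; linarith))
  have hne : ∀ᵐ z : ℝ × ℝ, |z.1| ≠ d := by
    rw [Measure.volume_eq_prod]
    refine Measure.quasiMeasurePreserving_fst.ae (p := fun x : ℝ => |x| ≠ d) ?_
    have h1 : ∀ᵐ x : ℝ, x ≠ d := by simp [ae_iff]
    have h2 : ∀ᵐ x : ℝ, x ≠ -d := by simp [ae_iff]
    filter_upwards [h1, h2] with x h3 h4 h5
    rcases (abs_eq hd.le).1 h5 with h | h
    · exact h3 h
    · exact h4 h
  have loc : ∀ (c v : ℝ → ℝ) (K : ℝ × ℝ → ℂ), Function.support v ⊆ Set.Ioo b e →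
      (∀ᵐ z : ℝ × ℝ, z.2 ∈ Set.Ioo b e → d < |z.1| → K z = 0) →
      ∫ z : ℝ × ℝ, ((c z.1 * v z.2 : ℝ) : ℂ) * K z
        = ∫ z in Set.Ioo (-d) d ×ˢ Set.Ioo b e, ((c z.1 * v z.2 : ℝ) : ℂ) * K z := by
    intro c v K hv hK
    refine (setIntegral_eq_integral_of_ae_compl_eq_zero ?_).symm
    filter_upwards [hK, hne] with z hz hzd hzm
    by_cases h2 : z.2 ∈ Set.Ioo b e
    · rw [Set.mem_prod, not_and_or] at hzm
      rcases hzm with h1 | h1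
      · have : d < |z.1| := by
          refine lt_of_le_of_ne (not_lt.1 fun h => h1 (abs_lt.1 h)) (Ne.symm hzd)
        rw [hz h2 this, mul_zero]
      · exact absurd h2 h1
    · have : v z.2 = 0 := by
        by_contra h0
        exact h2 (hv h0)
      simp [this]
  have slice : ∀ w : ℝ → ℝ, ContDiff ℝ ∞ w → (∃ B, ∀ x, |w x| ≤ B) → (∃ B, ∀ x, |deriv w x| ≤ B) →
      ∀ᵐ y ∂(volume.restrict (Set.Ioo b e)),
        ∫ x in Set.Ioo (-d) d, (w x : ℂ) * G (x, y)
          = -∫ x in Set.Ioo (-d) d, ((deriv w x : ℝ) : ℂ) * F (x, y) := by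
    rintro w hwd ⟨B, hB⟩ ⟨B', hB'⟩
    refine slice_of_prod isOpen_Ioo iF iG hwd.continuous (hwd.continuous_deriv (by simp)) hB hB'
      fun v hv hvc hvs => ?_
    have h1 := hw (fun x => ρ x * w x) v (ρ.contDiff.mul hwd) (ρ.hasCompactSupport.mul_right)
      (Set.subset_univ _) hv hvc hvs
    have hvs' := (subset_tsupport v).trans hvs
    rw [loc (deriv fun x => ρ x * w x) v F hvs' hF0, loc (fun x => ρ x * w x) v G hvs' hG0] at h1
    have hm : MeasurableSet (Set.Ioo (-d) d ×ˢ Set.Ioo b e) :=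
      measurableSet_Ioo.prod measurableSet_Ioo
    have ev : ∀ x ∈ Set.Ioo (-d) d, (fun x => ρ x * w x) =ᶠ[𝓝 x] w := fun x hx => by
      filter_upwards [hρ1 x hx] with y hy
      simp [hy]
    have e1 : Set.EqOn
        (fun z : ℝ × ℝ => ((deriv (fun x => ρ x * w x) z.1 * v z.2 : ℝ) : ℂ) * F z)
        (fun z => ((deriv w z.1 * v z.2 : ℝ) : ℂ) * F z) (Set.Ioo (-d) d ×ˢ Set.Ioo b e) := by
      intro z hz
      simp only [(ev z.1 hz.1).deriv_eq]
    have e2 : Set.EqOn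
        (fun z : ℝ × ℝ => ((ρ z.1 * w z.1 * v z.2 : ℝ) : ℂ) * G z)
        (fun z => ((w z.1 * v z.2 : ℝ) : ℂ) * G z) (Set.Ioo (-d) d ×ˢ Set.Ioo b e) := by
      intro z hz
      have := (ev z.1 hz.1).self_of_nhds
      simp only at this
      simp only [this]
    rw [setIntegral_congr_fun hm e1, setIntegral_congr_fun hm e2] at h1
    exact h1
  have rF : MemLp F 2 (volume.restrict (Set.Ioo (-d) d ×ˢ Set.Ioo b e)) := hF.restrict _
  have rG : MemLp G 2 (volume.restrict (Set.Ioo (-d) d ×ˢ Set.Ioo b e)) := hG.restrict _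
  have dcos : ∀ (n : ℤ) x, deriv (fun x => Real.cos (Real.pi * n * x / d)) x
      = -(Real.pi * n / d * Real.sin (Real.pi * n * x / d)) := fun n x => by
    have h1 : HasDerivAt (fun x : ℝ => Real.pi * n * x / d) (Real.pi * n / d) x := by
      simpa using ((hasDerivAt_id x).const_mul (Real.pi * n)).div_const d
    rw [h1.cos.deriv]
    ring
  have dsin : ∀ (n : ℤ) x, deriv (fun x => Real.sin (Real.pi * n * x / d)) x
      = Real.pi * n / d * Real.cos (Real.pi * n * x / d) := fun n x => by
    have := deriv_sin_scaled n 0 d x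
    simpa using this
  have scos : ∀ n : ℤ, _ := fun n : ℤ => slice (fun x => Real.cos (Real.pi * n * x / d))
    (by fun_prop) ⟨1, fun x => Real.abs_cos_le_one _⟩ ⟨|Real.pi * n / d|, fun x => by
      rw [dcos, abs_neg, abs_mul]
      exact mul_le_of_le_one_right (abs_nonneg _) (Real.abs_sin_le_one _)⟩
  have ssin : ∀ n : ℤ, _ := fun n : ℤ => slice (fun x => Real.sin (Real.pi * n * x / d))
    (by fun_prop) ⟨1, fun x => Real.abs_sin_le_one _⟩ ⟨|Real.pi * n / d|, fun x => by
      rw [dsin, abs_mul]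
      exact mul_le_of_le_one_right (abs_nonneg _) (Real.abs_cos_le_one _)⟩
  have sodd : ∀ᵐ y ∂(volume.restrict (Set.Ioo b e)), ∀ᵐ x : ℝ, F (-x, y) = -F (x, y) := by
    refine ae_restrict_of_ae ?_
    have : ∀ᵐ z : ℝ × ℝ, F (-z.2, z.1) = -F (z.2, z.1) :=
      (Measure.measurePreserving_swap (μ := (volume : Measure ℝ))
        (ν := (volume : Measure ℝ))).quasiMeasurePreserving.ae hodd
    exact Measure.ae_ae_of_ae_prod this
  rw [← integral_integral_norm_sq rF, ← integral_integral_norm_sq rG, ← integral_const_mul]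
  refine integral_mono_ae (integrable_integral_norm_sq rF)
    ((integrable_integral_norm_sq rG).const_mul _) ?_
  filter_upwards [memLp_slice_ae hFm rF, memLp_slice_ae hGm rG, ae_all_iff.2 scos, ae_all_iff.2 ssin,
    sodd] with y hFy hGy hcos hsin hoddy
  rw [restrict_Ioo_eq_restrict_Ioc] at hFy hGy
  have ic : ∀ (K : ℝ → ℂ) (c : ℝ → ℂ), MemLp K 2 (volume.restrict (Set.Ioc (-d) d)) → Continuous c →
      IntervalIntegrable (fun x => c x * K x) volume (-d) d := by
    intro K c hK hc
    rw [intervalIntegrable_iff_integrableOn_Ioc_of_le hdd.le]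
    have hK1 : IntegrableOn K (Set.Ioc (-d) d) := hK.integrable (by norm_num)
    exact (IntegrableOn.continuousOn_mul hc.continuousOn
      ((integrableOn_Icc_iff_integrableOn_Ioc (by simp)).2 hK1) isCompact_Icc).mono_set
      Set.Ioc_subset_Icc_self
  have split : ∀ (n : ℤ) (K : ℝ → ℂ), MemLp K 2 (volume.restrict (Set.Ioc (-d) d)) →
      fourierCoeffOn hdd K n = (1 / (2 * d) : ℂ) *
        ((∫ x in Set.Ioo (-d) d, (Real.cos (Real.pi * n * x / d) : ℂ) * K x) -
        Complex.I * ∫ x in Set.Ioo (-d) d, (Real.sin (Real.pi * n * x / d) : ℂ) * K x) := by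
    intro n K hK
    rw [fourierCoeffOn_symm_interval, integral_Ioo_eq_interval hdd.le,
      integral_Ioo_eq_interval hdd.le, ← intervalIntegral.integral_const_mul Complex.I,
      ← intervalIntegral.integral_sub
        (ic K (fun x => (Real.cos (Real.pi * n * x / d) : ℂ)) hK (by fun_prop))
        ((ic K (fun x => (Real.sin (Real.pi * n * x / d) : ℂ)) hK (by fun_prop)).const_mul _)]
    congr 2
    ext x
    ring
  -- Oddness removes the mean, the only mode that the periodic inequality with `m = 1` does not
  -- control.
  have hcF : fourierCoeffOn hdd (fun x => F (x, y)) 0 = 0 := by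
    have : ∫ x in (-d)..d, F (x, y) = 0 := by
      have h1 := intervalIntegral.integral_comp_neg (a := -d) (b := d) (fun x => F (x, y))
      have h2 : ∫ x in (-d)..d, F (-x, y) = ∫ x in (-d)..d, -F (x, y) :=
        intervalIntegral.integral_congr_ae (by filter_upwards [hoddy] with x hx _ using hx)
      rw [h2, intervalIntegral.integral_neg, neg_neg] at h1
      exact CharZero.neg_eq_self_iff.1 h1
    rw [fourierCoeffOn_symm_interval]
    simp [this]
  have key := periodic_poincare hd hdd hFy hGy (fun n => ?_) one_pos
  · have hs : Finset.Ioo (-((1 : ℕ) : ℤ)) ((1 : ℕ) : ℤ) = {0} := by decide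
    rw [hs, Finset.sum_singleton, hcF] at key
    simp only [integral_Ioo_eq_interval hdd.le]
    simpa using key
  · rw [split n _ hGy, split n _ hFy, hcos n, hsin n]
    have c1 : ∫ x in Set.Ioo (-d) d,
        ((deriv (fun x => Real.cos (Real.pi * n * x / d)) x : ℝ) : ℂ) * F (x, y)
        = -((Real.pi * n / d : ℝ) : ℂ) *
          ∫ x in Set.Ioo (-d) d, (Real.sin (Real.pi * n * x / d) : ℂ) * F (x, y) := by
      rw [← integral_const_mul]
      congr 1
      ext x
      rw [dcos]
      push_cast
      ring
    have c2 : ∫ x in Set.Ioo (-d) d,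
        ((deriv (fun x => Real.sin (Real.pi * n * x / d)) x : ℝ) : ℂ) * F (x, y)
        = ((Real.pi * n / d : ℝ) : ℂ) *
          ∫ x in Set.Ioo (-d) d, (Real.cos (Real.pi * n * x / d) : ℂ) * F (x, y) := by
      rw [← integral_const_mul]
      congr 1
      ext x
      rw [dsin]
      push_cast
      ring
    rw [c1, c2]
    generalize (∫ x in Set.Ioo (-d) d, (Real.sin (Real.pi * n * x / d) : ℂ) * F (x, y)) = s
    generalize (∫ x in Set.Ioo (-d) d, (Real.cos (Real.pi * n * x / d) : ℂ) * F (x, y)) = c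
    linear_combination (((Real.pi * n / d : ℝ) : ℂ) * (1 / (2 * d)) * s) * Complex.I_mul_I

/-! ## The form domain, extended to the plane -/

theorem norm_sq_eq_integral (f : L2Quadrant) : ‖f‖ ^ 2 = ∫ z in quadrant, ‖f z‖ ^ 2 := by
  have h2 : ∀ z, inner ℂ (f z) (f z) = ((‖f z‖ ^ 2 : ℝ) : ℂ) := fun z => by
    rw [inner_self_eq_norm_sq_to_K]
    push_cast
    rfl
  rw [← inner_self_eq_norm_sq (𝕜 := ℂ), L2.inner_def]
  simp_rw [h2]
  rw [integral_complex_ofReal]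
  exact Complex.ofReal_re _

theorem memLp_coe (f : L2Quadrant) : MemLp f 2 (volume.restrict quadrant) := Lp.memLp f

theorem integrable_norm_sq (f : L2Quadrant) :
    IntegrableOn (fun z => ‖f z‖ ^ 2) quadrant :=
  (memLp_two_iff_integrable_sq_norm (memLp_coe f).1).1 (memLp_coe f)

theorem measurePreserving_swap_quadrant :
    MeasurePreserving Prod.swap ((volume : Measure (ℝ × ℝ)).restrict quadrant)
      ((volume : Measure (ℝ × ℝ)).restrict quadrant) := by
  have h := (Measure.measurePreserving_swap (μ := (volume : Measure ℝ))
    (ν := (volume : Measure ℝ))).restrict_preimage measurableSet_quadrant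
  have : Prod.swap ⁻¹' quadrant = quadrant := by
    ext z
    exact and_comm
  rwa [this] at h

theorem setIntegral_quadrant_swap {E : Type*} [NormedAddCommGroup E] [NormedSpace ℝ E]
    (K : ℝ × ℝ → E) : ∫ z in quadrant, K z = ∫ z in quadrant, K z.swap :=
  setIntegral_swap _ _ K

theorem stronglyMeasurable_swap {f : ℝ × ℝ → ℂ} (hf : StronglyMeasurable f) :
    StronglyMeasurable fun p : ℝ × ℝ => f p.swap := hf.comp_measurable measurable_swap

theorem memLp_swap {f : ℝ × ℝ → ℂ} (hf : MemLp f 2 (volume.restrict quadrant)) :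
    MemLp (fun p : ℝ × ℝ => f p.swap) 2 (volume.restrict quadrant) :=
  hf.comp_measurePreserving measurePreserving_swap_quadrant

theorem fderiv_comp_swap {η : ℝ × ℝ → ℝ} (hη : ContDiff ℝ ∞ η) (p e : ℝ × ℝ) :
    fderiv ℝ (fun p : ℝ × ℝ => η p.swap) p e = fderiv ℝ η p.swap e.swap := by
  have h1 : HasFDerivAt (fun p : ℝ × ℝ => p.swap)
      ((ContinuousLinearEquiv.prodComm ℝ ℝ ℝ : ℝ × ℝ →L[ℝ] ℝ × ℝ)) p :=
    (ContinuousLinearEquiv.prodComm ℝ ℝ ℝ).hasFDerivAt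
  have h2 := ((hη.differentiable (by simp)).differentiableAt (x := p.swap)).hasFDerivAt.comp p h1
  rw [show (fun p : ℝ × ℝ => η p.swap) = η ∘ fun p : ℝ × ℝ => p.swap from rfl, h2.fderiv]
  rfl

theorem contDiff_swap {η : ℝ × ℝ → ℝ} (hη : ContDiff ℝ ∞ η) :
    ContDiff ℝ ∞ fun p : ℝ × ℝ => η p.swap :=
  hη.comp (ContinuousLinearEquiv.prodComm ℝ ℝ ℝ).contDiff

theorem hasCompactSupport_swap {η : ℝ × ℝ → ℝ} (hη : HasCompactSupport η) :
    HasCompactSupport fun p : ℝ × ℝ => η p.swap :=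
  hη.comp_homeomorph (Homeomorph.prodComm ℝ ℝ)

theorem HasWeakGradient.fst {φ : L2Quadrant} {g : L2Quadrant × L2Quadrant}
    (h : HasWeakGradient φ g) : WeakDerivQuadrant φ g.1 :=
  fun η h1 h2 h3 => (h η h1 h2 h3).1

/-- Exchanging the coordinates turns the second partial derivative into the first, so the reflection
argument is needed for one direction only. -/
theorem HasWeakGradient.snd {φ : L2Quadrant} {g : L2Quadrant × L2Quadrant}
    (h : HasWeakGradient φ g) :
    WeakDerivQuadrant (fun p => φ p.swap) (fun p => g.2 p.swap) := by
  intro η h1 h2 h3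
  have hs : tsupport (fun p : ℝ × ℝ => η p.swap) ⊆ quadrant := by
    have : tsupport (fun p : ℝ × ℝ => η p.swap) = Prod.swap ⁻¹' tsupport η :=
      tsupport_comp_eq_preimage η (Homeomorph.prodComm ℝ ℝ)
    rw [this]
    intro p hp
    exact ⟨(h3 hp).2, (h3 hp).1⟩
  have key := (h _ (contDiff_swap h1) (hasCompactSupport_swap h2) hs).2
  simp only [fderiv_comp_swap h1] at key
  rw [setIntegral_quadrant_swap, setIntegral_quadrant_swap (fun p => (η p : ℂ) * g.2 p.swap)]
  simpa using key

/-- The first component of the gradient, extended to the plane. -/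
def planeGrad₁ (g : L2Quadrant × L2Quadrant) : ℝ × ℝ → ℂ := reflectOdd g.1

/-- The second component of the gradient, extended to the plane. -/
def planeGrad₂ (g : L2Quadrant × L2Quadrant) (z : ℝ × ℝ) : ℂ :=
  reflectOdd (fun p => g.2 p.swap) z.swap

theorem stronglyMeasurable_planeGrad₁ (g : L2Quadrant × L2Quadrant) :
    StronglyMeasurable (planeGrad₁ g) := stronglyMeasurable_reflectOdd (Lp.stronglyMeasurable _)

theorem stronglyMeasurable_planeGrad₂ (g : L2Quadrant × L2Quadrant) :
    StronglyMeasurable (planeGrad₂ g) :=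
  stronglyMeasurable_swap (stronglyMeasurable_reflectOdd
    (stronglyMeasurable_swap (Lp.stronglyMeasurable g.2)))

theorem memLp_planeGrad₁ (g : L2Quadrant × L2Quadrant) : MemLp (planeGrad₁ g) 2 volume :=
  memLp_reflectOdd (Lp.stronglyMeasurable _) (memLp_coe _)

theorem memLp_planeGrad₂ (g : L2Quadrant × L2Quadrant) : MemLp (planeGrad₂ g) 2 volume :=
  (memLp_reflectOdd (stronglyMeasurable_swap (Lp.stronglyMeasurable g.2))
    (memLp_swap (memLp_coe g.2))).comp_measurePreserving Measure.measurePreserving_swap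

theorem memLp_reflect_coe (φ : L2Quadrant) : MemLp (reflect φ) 2 volume :=
  memLp_reflect (Lp.stronglyMeasurable _) (memLp_coe _)

theorem norm_planeGrad₁_ae (g : L2Quadrant × L2Quadrant) :
    ∀ᵐ z, ‖planeGrad₁ g z‖ = ‖reflect g.1 z‖ := norm_reflectOdd_ae

theorem norm_planeGrad₂_ae (g : L2Quadrant × L2Quadrant) :
    ∀ᵐ z, ‖planeGrad₂ g z‖ = ‖reflect g.2 z‖ := by
  filter_upwards [ae_snd_ne_zero] with z hz
  rcases lt_or_gt_of_ne hz with h | h <;> simp [planeGrad₂, reflectOdd, reflect, h]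

theorem HasWeakGradient.plane {φ : L2Quadrant} {g : L2Quadrant × L2Quadrant}
    (h : HasWeakGradient φ g) :
    WeakGradientPlane (reflect φ) (planeGrad₁ g) (planeGrad₂ g) := by
  intro η hη hηc
  refine ⟨h.fst.reflect (Lp.stronglyMeasurable _) (Lp.stronglyMeasurable _) (memLp_coe _)
    (memLp_coe _) hη hηc, ?_⟩
  have key := h.snd.reflect (stronglyMeasurable_swap (Lp.stronglyMeasurable φ))
    (stronglyMeasurable_swap (Lp.stronglyMeasurable g.2)) (memLp_swap (memLp_coe φ))
    (memLp_swap (memLp_coe g.2)) (contDiff_swap hη) (hasCompactSupport_swap hηc)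
  simp only [fderiv_comp_swap hη] at key
  have s1 := integral_prod_swap (μ := (volume : Measure ℝ)) (ν := (volume : Measure ℝ))
    (fun p => (fderiv ℝ η p (0, 1) : ℂ) * ElectronPairs.reflect φ p)
  have s2 := integral_prod_swap (μ := (volume : Measure ℝ)) (ν := (volume : Measure ℝ))
    (fun p => (η p : ℂ) * planeGrad₂ g p)
  exact s1.symm.trans (key.trans (congrArg Neg.neg s2))

theorem ae_reflect {P : ℝ × ℝ → Prop} (h : ∀ᵐ z ∂(volume.restrict quadrant), P z) :
    ∀ᵐ z : ℝ × ℝ, P (|z.1|, |z.2|) := by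
  rw [ae_restrict_iff' measurableSet_quadrant] at h
  have h1 := measurePreserving_neg_fst.quasiMeasurePreserving.ae h
  have h2 := measurePreserving_neg_snd.quasiMeasurePreserving.ae h
  have h3 := (measurePreserving_neg_fst.comp
    measurePreserving_neg_snd).quasiMeasurePreserving.ae h
  filter_upwards [h, h1, h2, h3, ae_fst_ne_zero, ae_snd_ne_zero] with z h h1 h2 h3 n1 n2
  rcases lt_or_gt_of_ne n1 with a1 | a1 <;> rcases lt_or_gt_of_ne n2 with a2 | a2
  · rw [abs_of_neg a1, abs_of_neg a2]
    exact h3 ⟨neg_pos.2 a1, neg_pos.2 a2⟩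
  · rw [abs_of_neg a1, abs_of_pos a2]
    exact h1 ⟨neg_pos.2 a1, a2⟩
  · rw [abs_of_pos a1, abs_of_neg a2]
    exact h2 ⟨a1, neg_pos.2 a2⟩
  · rw [abs_of_pos a1, abs_of_pos a2]
    exact h ⟨a1, a2⟩

theorem isClosed_pairDomain (d L : ℝ) : IsClosed (pairDomain d L) := by
  unfold pairDomain
  simp only [Set.ofPred_and]
  refine (isClosed_le continuous_const continuous_fst).inter
    ((isClosed_le continuous_fst continuous_const).inter
    ((isClosed_le continuous_const continuous_snd).inter
    ((isClosed_le continuous_snd continuous_const).inter (isClosed_le ?_ continuous_const))))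
  fun_prop

/-- A weak derivative vanishes where the function does. -/
theorem WeakDerivQuadrant.eq_zero_off {φ g : ℝ × ℝ → ℂ} (h : WeakDerivQuadrant φ g)
    (hg : MemLp g 2 (volume.restrict quadrant)) {D : Set (ℝ × ℝ)} (hD : IsClosed D)
    (hφ : ∀ᵐ p ∂(volume.restrict quadrant), p ∉ D → φ p = 0) :
    ∀ᵐ p ∂(volume.restrict quadrant), p ∉ D → g p = 0 := by
  have hU : IsOpen (quadrant ∩ Dᶜ) := isOpen_quadrant.inter hD.isOpen_compl
  have hloc : LocallyIntegrableOn g (quadrant ∩ Dᶜ) (volume.restrict quadrant) :=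
    (hg.locallyIntegrable (by norm_num)).locallyIntegrableOn _
  have key := hU.ae_eq_zero_of_integral_contDiff_smul_eq_zero hloc ?_
  · filter_upwards [key, ae_restrict_mem measurableSet_quadrant] with p hp hpq hpD
    exact hp ⟨hpq, hpD⟩
  · intro η h1 h2 h3
    have h4 := h η h1 h2 (h3.trans Set.inter_subset_left)
    have h5 : ∫ p in quadrant, (fderiv ℝ η p (1, 0) : ℂ) * φ p = 0 := by
      refine integral_eq_zero_of_ae ?_
      filter_upwards [hφ] with p hp
      by_cases hpD : p ∈ D
      · have : fderiv ℝ η p = 0 := image_eq_zero_of_notMem_tsupport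
          (fun hm => (h3 (tsupport_fderiv_subset ℝ hm)).2 hpD)
        simp [this]
      · simp [hp hpD]
    rw [h5] at h4
    simp only [Complex.real_smul]
    exact neg_eq_zero.1 h4.symm

section FormDomain

variable {d L : ℝ} {φ : L2Quadrant} {g : L2Quadrant × L2Quadrant}

/-- A weak gradient vanishes almost everywhere on an open set where the function does, and
reflection carries this to the plane. The Dirichlet condition enters the arm estimate in this form,
without traces. -/
theorem MemFormDomain.plane_eq_zero (h : MemFormDomain d L φ g) :
    ∀ᵐ z : ℝ × ℝ, (|z.1|, |z.2|) ∉ pairDomain d L →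
      reflect φ z = 0 ∧ planeGrad₁ g z = 0 ∧ planeGrad₂ g z = 0 := by
  have h1 := h.eq_zero_off
  have h2 := h.hasWeakGradient.fst.eq_zero_off (memLp_coe g.1) (isClosed_pairDomain d L) h1
  have hsymm : ∀ p : ℝ × ℝ, p.swap ∈ pairDomain d L ↔ p ∈ pairDomain d L := by
    intro p
    simp only [pairDomain, Set.mem_ofPred_eq, Prod.fst_swap, Prod.snd_swap, abs_sub_comm p.2]
    tauto
  have h3 : ∀ᵐ p ∂(volume.restrict quadrant), p ∉ pairDomain d L → g.2 p = 0 := by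
    have e1 : ∀ᵐ p ∂(volume.restrict quadrant), p ∉ pairDomain d L → φ p.swap = 0 := by
      filter_upwards [measurePreserving_swap_quadrant.quasiMeasurePreserving.ae h1] with p hp hpD
      exact hp (by rwa [hsymm])
    have e2 := h.hasWeakGradient.snd.eq_zero_off (memLp_swap (memLp_coe g.2))
      (isClosed_pairDomain d L) e1
    filter_upwards [measurePreserving_swap_quadrant.quasiMeasurePreserving.ae e2] with p hp hpD
    simpa using hp (by rwa [hsymm])
  filter_upwards [ae_reflect h1, ae_reflect h2, ae_reflect h3] with z e1 e2 e3 hz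
  refine ⟨e1 hz, ?_, ?_⟩
  · simp only [planeGrad₁, reflectOdd, e2 hz, mul_zero]
  · simp only [planeGrad₂, reflectOdd, Prod.fst_swap, Prod.snd_swap, Prod.swap_prod_mk, e3 hz,
      mul_zero]

theorem MemFormDomain.plane_antisymm (h : MemFormDomain d L φ g) :
    ∀ᵐ z : ℝ × ℝ, reflect φ z.swap = -reflect φ z := by
  filter_upwards [ae_reflect h.antisymm] with z hz
  exact hz

end FormDomain

/-! ## The spectral gap above one linear functional -/

theorem setIntegral_eq_zero_of_odd {X : Type*} [MeasurableSpace X] {μ : Measure X} {σ : X → X}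
    (hσ : MeasurePreserving σ μ μ) (hinv : Function.Involutive σ) {R : Set X}
    (hR : σ ⁻¹' R = R) {K : X → ℂ} (hK : ∀ᵐ x ∂μ, K (σ x) = -K x) : ∫ x in R, K x ∂μ = 0 := by
  have hemb : MeasurableEmbedding σ :=
    (MeasurableEquiv.ofInvolutive σ hinv hσ.measurable).measurableEmbedding
  have h := hσ.setIntegral_preimage_emb hemb K R
  rw [hR, integral_congr_ae (ae_restrict_of_ae hK), integral_neg] at h
  linear_combination (-1 / 2 : ℂ) * h

theorem setIntegral_norm_sq_reflect {f : ℝ × ℝ → ℂ} (hfm : StronglyMeasurable f)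
    (hf : MemLp f 2 (volume.restrict quadrant))
    {B : Set (ℝ × ℝ)} (hB : MeasurableSet B) (hB1 : ∀ z, (-z.1, z.2) ∈ B ↔ z ∈ B)
    (hB2 : ∀ z, (z.1, -z.2) ∈ B ↔ z ∈ B) :
    ∫ z in B, ‖reflect f z‖ ^ 2 = 4 * ∫ z in B ∩ quadrant, ‖f z‖ ^ 2 := by
  have hm := memLp_reflect hfm hf
  rw [setIntegral_fold_quadrant hB hB1 hB2
    (((memLp_two_iff_integrable_sq_norm hm.1).1 hm).integrableOn), ← integral_const_mul]
  refine setIntegral_congr_fun (hB.inter measurableSet_quadrant) fun z hz => ?_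
  have h1 : reflect f z = f z := reflect_of_mem hz.2
  simp only [reflect_neg_fst, reflect_neg_snd]
  have h2 : reflect f (-z.1, -z.2) = f z := by
    rw [reflect_neg_fst (z.1, -z.2), reflect_neg_snd, h1]
  rw [h2, h1]
  ring

section Gap

variable {d L : ℝ} {φ : L2Quadrant} {g : L2Quadrant × L2Quadrant}

/-- The function in the coordinates `(x - y, x + y)`. -/
def diagFun (φ : L2Quadrant) (z : ℝ × ℝ) : ℂ := reflect φ (diagCoord.symm z)

/-- The derivative along `x - y`. -/
def diagGrad₁ (g : L2Quadrant × L2Quadrant) (z : ℝ × ℝ) : ℂ :=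
  ((1 / 2 : ℝ) : ℂ) * planeGrad₁ g (diagCoord.symm z) +
    ((-1 / 2 : ℝ) : ℂ) * planeGrad₂ g (diagCoord.symm z)

/-- The derivative along `x + y`. -/
def diagGrad₂ (g : L2Quadrant × L2Quadrant) (z : ℝ × ℝ) : ℂ :=
  ((1 / 2 : ℝ) : ℂ) * planeGrad₁ g (diagCoord.symm z) +
    ((1 / 2 : ℝ) : ℂ) * planeGrad₂ g (diagCoord.symm z)

theorem stronglyMeasurable_comp_symm (T : (ℝ × ℝ) ≃L[ℝ] (ℝ × ℝ)) {f : ℝ × ℝ → ℂ}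
    (hf : StronglyMeasurable f) : StronglyMeasurable fun z => f (T.symm z) :=
  hf.comp_measurable T.symm.continuous.measurable

theorem stronglyMeasurable_reflect_coe (φ : L2Quadrant) : StronglyMeasurable (reflect φ) :=
  stronglyMeasurable_reflect (Lp.stronglyMeasurable _)

theorem stronglyMeasurable_diagFun (φ : L2Quadrant) : StronglyMeasurable (diagFun φ) :=
  stronglyMeasurable_comp_symm _ (stronglyMeasurable_reflect_coe _)

theorem stronglyMeasurable_diagGrad₁ (g : L2Quadrant × L2Quadrant) :
    StronglyMeasurable (diagGrad₁ g) :=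
  ((stronglyMeasurable_comp_symm _ (stronglyMeasurable_planeGrad₁ g)).const_mul _).add
    ((stronglyMeasurable_comp_symm _ (stronglyMeasurable_planeGrad₂ g)).const_mul _)

theorem stronglyMeasurable_diagGrad₂ (g : L2Quadrant × L2Quadrant) :
    StronglyMeasurable (diagGrad₂ g) :=
  ((stronglyMeasurable_comp_symm _ (stronglyMeasurable_planeGrad₁ g)).const_mul _).add
    ((stronglyMeasurable_comp_symm _ (stronglyMeasurable_planeGrad₂ g)).const_mul _)

theorem memLp_diagFun (φ : L2Quadrant) : MemLp (diagFun φ) 2 volume :=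
  memLp_comp_symm _ (stronglyMeasurable_reflect_coe _) (memLp_reflect_coe φ)

theorem memLp_diagGrad₁ (g : L2Quadrant × L2Quadrant) : MemLp (diagGrad₁ g) 2 volume :=
  ((memLp_comp_symm _ (stronglyMeasurable_planeGrad₁ g) (memLp_planeGrad₁ g)).const_mul _).add
    ((memLp_comp_symm _ (stronglyMeasurable_planeGrad₂ g) (memLp_planeGrad₂ g)).const_mul _)

theorem memLp_diagGrad₂ (g : L2Quadrant × L2Quadrant) : MemLp (diagGrad₂ g) 2 volume :=
  ((memLp_comp_symm _ (stronglyMeasurable_planeGrad₁ g) (memLp_planeGrad₁ g)).const_mul _).add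
    ((memLp_comp_symm _ (stronglyMeasurable_planeGrad₂ g) (memLp_planeGrad₂ g)).const_mul _)

theorem HasWeakGradient.diag₁ (h : HasWeakGradient φ g) (I J : Set ℝ) :
    ProdWeakDeriv I J (diagFun φ) (diagGrad₁ g) :=
  h.plane.prodWeakDeriv diagCoord (memLp_reflect_coe φ) (memLp_planeGrad₁ g) (memLp_planeGrad₂ g)
    (by rw [diagCoord_symm_apply]; norm_num) I J

theorem HasWeakGradient.diag₂ (h : HasWeakGradient φ g) (I J : Set ℝ) :
    ProdWeakDeriv I J (fun z => diagFun φ z.swap) (fun z => diagGrad₂ g z.swap) :=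
  h.plane.prodWeakDeriv_swap diagCoord (memLp_reflect_coe φ) (memLp_planeGrad₁ g)
    (memLp_planeGrad₂ g) (by rw [diagCoord_symm_apply]; norm_num) I J

/-- Changing the sign of `x - y` at fixed `x + y` is the exchange of the particles. -/
theorem MemFormDomain.diagFun_neg_fst (h : MemFormDomain d L φ g) :
    ∀ᵐ z : ℝ × ℝ, diagFun φ (-z.1, z.2) = -diagFun φ z := by
  filter_upwards [ae_comp_symm diagCoord h.plane_antisymm] with z hz
  unfold diagFun
  rw [← hz]
  congr 1
  simp only [diagCoord_symm_apply, Prod.swap_prod_mk, Prod.mk.injEq]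
  constructor <;> ring

/-- Changing the sign of `x + y` is the map `(x, y) ↦ (-y, -x)`, the exchange combined with both
reflections, under which the extension is even. -/
theorem MemFormDomain.diagFun_neg_snd (h : MemFormDomain d L φ g) :
    ∀ᵐ z : ℝ × ℝ, diagFun φ (z.1, -z.2) = -diagFun φ z := by
  filter_upwards [ae_comp_symm diagCoord h.plane_antisymm] with z hz
  unfold diagFun
  rw [← hz]
  simp only [diagCoord_symm_apply, Prod.swap_prod_mk, reflect]
  rw [← abs_neg ((z.1 + -z.2) / 2), ← abs_neg ((-z.2 - z.1) / 2)]
  congr 4 <;> ring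

theorem integrable_norm_sq_of_memLp {f : ℝ × ℝ → ℂ} {μ : Measure (ℝ × ℝ)} (hf : MemLp f 2 μ) :
    Integrable (fun z => ‖f z‖ ^ 2) μ := (memLp_two_iff_integrable_sq_norm hf.1).1 hf

theorem setIntegral_norm_sq_diagFun (φ : L2Quadrant) {A : Set (ℝ × ℝ)} (hA : MeasurableSet A) :
    ∫ z in A, ‖diagFun φ z‖ ^ 2 = 2 * ∫ z in diagCoord ⁻¹' A, ‖reflect φ z‖ ^ 2 := by
  have h := setIntegral_comp_symm diagCoord hA fun z => ‖reflect φ z‖ ^ 2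
  rw [diagCoord_det, abs_two, smul_eq_mul] at h
  exact h

/-- By the parallelogram identity the new derivatives carry half of `|∇φ| ^ 2`, and the Jacobian 2
compensates. For the function itself the Jacobian remains, which is where the factor 2 in the
threshold `2 (π / d) ^ 2` comes from. -/
theorem setIntegral_norm_sq_diagGrad (g : L2Quadrant × L2Quadrant) {A : Set (ℝ × ℝ)}
    (hA : MeasurableSet A) :
    (∫ z in A, ‖diagGrad₁ g z‖ ^ 2) + ∫ z in A, ‖diagGrad₂ g z‖ ^ 2 =
      (∫ z in diagCoord ⁻¹' A, ‖reflect g.1 z‖ ^ 2) +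
        ∫ z in diagCoord ⁻¹' A, ‖reflect g.2 z‖ ^ 2 := by
  have h := setIntegral_comp_symm diagCoord hA
    fun z => (‖planeGrad₁ g z‖ ^ 2 + ‖planeGrad₂ g z‖ ^ 2) / 2
  rw [diagCoord_det, abs_two, smul_eq_mul, integral_div _ (fun p => ‖planeGrad₁ g p‖ ^ 2 + _),
    mul_div_cancel₀ _ two_ne_zero] at h
  have i1 := (integrable_norm_sq_of_memLp (memLp_planeGrad₁ g)).integrableOn (s := diagCoord ⁻¹' A)
  have i2 := (integrable_norm_sq_of_memLp (memLp_planeGrad₂ g)).integrableOn (s := diagCoord ⁻¹' A)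
  rw [integral_add i1 i2] at h
  have j1 : ∫ z in diagCoord ⁻¹' A, ‖planeGrad₁ g z‖ ^ 2 =
      ∫ z in diagCoord ⁻¹' A, ‖reflect g.1 z‖ ^ 2 :=
    integral_congr_ae (ae_restrict_of_ae ((norm_planeGrad₁_ae g).mono fun z hz => by simp only [hz]))
  have j2 : ∫ z in diagCoord ⁻¹' A, ‖planeGrad₂ g z‖ ^ 2 =
      ∫ z in diagCoord ⁻¹' A, ‖reflect g.2 z‖ ^ 2 :=
    integral_congr_ae (ae_restrict_of_ae ((norm_planeGrad₂_ae g).mono fun z hz => by simp only [hz]))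
  rw [← j1, ← j2, ← h, ← integral_add
    (integrable_norm_sq_of_memLp (memLp_diagGrad₁ g)).integrableOn
    (integrable_norm_sq_of_memLp (memLp_diagGrad₂ g)).integrableOn]
  refine integral_congr_ae (ae_of_all _ fun z => ?_)
  have key : ∀ a b : ℂ, ‖((1 / 2 : ℝ) : ℂ) * a + ((-1 / 2 : ℝ) : ℂ) * b‖ ^ 2 +
      ‖((1 / 2 : ℝ) : ℂ) * a + ((1 / 2 : ℝ) : ℂ) * b‖ ^ 2 = (‖a‖ ^ 2 + ‖b‖ ^ 2) / 2 := by
    intro a b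
    simp only [← Complex.normSq_eq_norm_sq, Complex.normSq_apply, Complex.add_re, Complex.add_im,
      Complex.re_ofReal_mul, Complex.im_ofReal_mul]
    ring
  exact key _ _

/-- The square `|x - y|, |x + y| < d` in the coordinates `(x - y, x + y)`. -/
def diagSquare (d : ℝ) : Set (ℝ × ℝ) := Set.Ioo (-d) (-d + 2 * d) ×ˢ Set.Ioo (-d) (-d + 2 * d)

theorem measurableSet_diagSquare (d : ℝ) : MeasurableSet (diagSquare d) :=
  measurableSet_Ioo.prod measurableSet_Ioo

theorem neg_fst_mem_diagSquare (z : ℝ × ℝ) : (-z.1, z.2) ∈ diagSquare d ↔ z ∈ diagSquare d := by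
  simp only [diagSquare, Set.mem_prod, Set.mem_Ioo]
  constructor <;> rintro ⟨⟨h1, h2⟩, h3, h4⟩ <;> refine ⟨⟨?_, ?_⟩, ?_, ?_⟩ <;> linarith

theorem neg_snd_mem_diagSquare (z : ℝ × ℝ) : (z.1, -z.2) ∈ diagSquare d ↔ z ∈ diagSquare d := by
  simp only [diagSquare, Set.mem_prod, Set.mem_Ioo]
  constructor <;> rintro ⟨⟨h1, h2⟩, h3, h4⟩ <;> refine ⟨⟨?_, ?_⟩, ?_, ?_⟩ <;> linarith

/-- The diamond `|x - y|, |x + y| < d`. -/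
def diamond (d : ℝ) : Set (ℝ × ℝ) := diagCoord ⁻¹' diagSquare d

theorem measurableSet_diamond (d : ℝ) : MeasurableSet (diamond d) :=
  diagCoord.continuous.measurable (measurableSet_diagSquare d)

theorem neg_fst_mem_diamond (z : ℝ × ℝ) : (-z.1, z.2) ∈ diamond d ↔ z ∈ diamond d := by
  simp only [diamond, diagSquare, Set.mem_preimage, diagCoord_apply, Set.mem_prod, Set.mem_Ioo]
  constructor <;> rintro ⟨⟨h1, h2⟩, h3, h4⟩ <;> refine ⟨⟨?_, ?_⟩, ?_, ?_⟩ <;> linarith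

theorem neg_snd_mem_diamond (z : ℝ × ℝ) : (z.1, -z.2) ∈ diamond d ↔ z ∈ diamond d := by
  simp only [diamond, diagSquare, Set.mem_preimage, diagCoord_apply, Set.mem_prod, Set.mem_Ioo]
  constructor <;> rintro ⟨⟨h1, h2⟩, h3, h4⟩ <;> refine ⟨⟨?_, ?_⟩, ?_, ?_⟩ <;> linarith

/-- The product of cosines `cos (π n (a + d) / 2d) cos (π l (b + d) / 2d)`. -/
def cosProd (d : ℝ) (n l : ℤ) (z : ℝ × ℝ) : ℂ :=
  (Real.cos (Real.pi * n * (z.1 - -d) / (2 * d)) : ℂ) *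
    (Real.cos (Real.pi * l * (z.2 - -d) / (2 * d)) : ℂ)

theorem cosProd_neg_left (n l : ℤ) (z : ℝ × ℝ) : cosProd d (-n) l z = cosProd d n l z := by
  unfold cosProd
  have : Real.pi * ((-n : ℤ) : ℝ) * (z.1 - -d) / (2 * d) =
    -(Real.pi * (n : ℝ) * (z.1 - -d) / (2 * d)) := by push_cast; ring
  rw [this, Real.cos_neg]

theorem cosProd_neg_right (n l : ℤ) (z : ℝ × ℝ) : cosProd d n (-l) z = cosProd d n l z := by
  unfold cosProd
  have : Real.pi * ((-l : ℤ) : ℝ) * (z.2 - -d) / (2 * d) =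
    -(Real.pi * (l : ℝ) * (z.2 - -d) / (2 * d)) := by push_cast; ring
  rw [this, Real.cos_neg]

theorem MemFormDomain.integral_cosProd_zero_left (h : MemFormDomain d L φ g) (l : ℤ) :
    ∫ z in diagSquare d, cosProd d 0 l z * diagFun φ z = 0 := by
  refine setIntegral_eq_zero_of_odd measurePreserving_neg_fst (fun z => by simp)
    (Set.ext neg_fst_mem_diagSquare) ?_
  filter_upwards [h.diagFun_neg_fst] with z hz
  rw [hz]
  simp [cosProd]

theorem MemFormDomain.integral_cosProd_zero_right (h : MemFormDomain d L φ g) (n : ℤ) :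
    ∫ z in diagSquare d, cosProd d n 0 z * diagFun φ z = 0 := by
  refine setIntegral_eq_zero_of_odd measurePreserving_neg_snd (fun z => by simp)
    (Set.ext neg_snd_mem_diagSquare) ?_
  filter_upwards [h.diagFun_neg_snd] with z hz
  rw [hz]
  simp [cosProd]

/-- Neumann inequality on the square of side `2 d` with the modes of index at most one in absolute
value. Modes with a zero index vanish by oddness, and the four modes `(± 1, ± 1)` coincide, so one
functional remains. The next modes have frequency `2 π / (2 d) = π / d`, exactly the threshold of
the arm. -/
theorem MemFormDomain.corner (hd : 0 < d) (h : MemFormDomain d L φ g) :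
    2 * ∫ z in diamond d ∩ quadrant, ‖φ z‖ ^ 2 ≤
      (d / Real.pi) ^ 2 * ((∫ z in diamond d ∩ quadrant, ‖g.1 z‖ ^ 2) +
        ∫ z in diamond d ∩ quadrant, ‖g.2 z‖ ^ 2) +
      1 / (4 * d ^ 2) * ‖∫ z in diagSquare d, cosProd d 1 1 z * diagFun φ z‖ ^ 2 := by
  have key := rectangle_poincare (a := -d) (b := -d) (h := 2 * d) (h' := 2 * d) (by linarith)
    (by linarith) (stronglyMeasurable_diagFun φ) (stronglyMeasurable_diagGrad₁ g)
    (stronglyMeasurable_diagGrad₂ g) ((memLp_diagFun φ).restrict _) ((memLp_diagGrad₁ g).restrict _)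
    ((memLp_diagGrad₂ g).restrict _) (h.hasWeakGradient.diag₁ _ _) (h.hasWeakGradient.diag₂ _ _)
    (m := 2) (M := 2) two_pos two_pos
  have hI : Finset.Ioo (-((2 : ℕ) : ℤ)) ((2 : ℕ) : ℤ) = {-1, 0, 1} := by decide
  change ∫ z in diagSquare d, ‖diagFun φ z‖ ^ 2 ≤ _ * (∫ z in diagSquare d, ‖diagGrad₁ g z‖ ^ 2) +
    _ * (∫ z in diagSquare d, ‖diagGrad₂ g z‖ ^ 2) + 1 / (2 * d) * (1 / (2 * d) *
      ∑ n ∈ Finset.Ioo (-((2 : ℕ) : ℤ)) ((2 : ℕ) : ℤ),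
      ∑ l ∈ Finset.Ioo (-((2 : ℕ) : ℤ)) ((2 : ℕ) : ℤ),
        ‖∫ z in diagSquare d, cosProd d n l z * diagFun φ z‖ ^ 2) at key
  rw [hI] at key
  have hsum : ∀ f : ℤ → ℝ, ∑ n ∈ ({-1, 0, 1} : Finset ℤ), f n = f (-1) + f 0 + f 1 := by
    intro f
    rw [Finset.sum_insert (by decide), Finset.sum_insert (by decide), Finset.sum_singleton]
    ring
  simp only [hsum, cosProd_neg_left, cosProd_neg_right, h.integral_cosProd_zero_left,
    h.integral_cosProd_zero_right, norm_zero] at key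
  rw [add_assoc _ ((2 * d / (Real.pi * (2 : ℕ))) ^ 2 * _), ← add_assoc ((2 * d / _) ^ 2 * _),
    ← mul_add, setIntegral_norm_sq_diagGrad g (measurableSet_diagSquare d),
    setIntegral_norm_sq_diagFun φ (measurableSet_diagSquare d)] at key
  change 2 * (∫ z in diamond d, _) ≤ _ * ((∫ z in diamond d, _) + ∫ z in diamond d, _) + _ at key
  rw [setIntegral_norm_sq_reflect (Lp.stronglyMeasurable _) (memLp_coe φ) (measurableSet_diamond d)
      neg_fst_mem_diamond neg_snd_mem_diamond,
    setIntegral_norm_sq_reflect (Lp.stronglyMeasurable _) (memLp_coe g.1) (measurableSet_diamond d)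
      neg_fst_mem_diamond neg_snd_mem_diamond,
    setIntegral_norm_sq_reflect (Lp.stronglyMeasurable _) (memLp_coe g.2) (measurableSet_diamond d)
      neg_fst_mem_diamond neg_snd_mem_diamond] at key
  have e1 : 2 * d / (Real.pi * (2 : ℕ)) = d / Real.pi := by
    have := Real.pi_pos
    push_cast
    field_simp
  rw [e1] at key
  have e2 : ∀ X : ℝ, 1 / (2 * d) * (1 / (2 * d) * (X ^ 2 + 0 ^ 2 + X ^ 2 + (0 ^ 2 + 0 ^ 2 + 0 ^ 2) +
      (X ^ 2 + 0 ^ 2 + X ^ 2))) = 4 * (1 / (4 * d ^ 2) * X ^ 2) := by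
    intro X
    field_simp
    ring
  rw [e2] at key
  linarith

/-- The arm `|x - y| < d < x + y < M`. -/
def arm (d M : ℝ) : Set (ℝ × ℝ) := diagCoord ⁻¹' (Set.Ioo (-d) d ×ˢ Set.Ioo d M)

theorem measurableSet_arm (d M : ℝ) : MeasurableSet (arm d M) :=
  diagCoord.continuous.measurable (measurableSet_Ioo.prod measurableSet_Ioo)

theorem arm_subset_quadrant (d M : ℝ) : arm d M ⊆ quadrant := by
  rintro z ⟨⟨h1, h2⟩, h3, h4⟩
  simp only [diagCoord_apply] at h1 h2 h3 h4
  exact ⟨show 0 < z.1 by linarith, show 0 < z.2 by linarith⟩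

theorem setIntegral_norm_sq_reflect_arm (f : L2Quadrant) (d M : ℝ) :
    ∫ z in arm d M, ‖reflect f z‖ ^ 2 = ∫ z in arm d M, ‖f z‖ ^ 2 :=
  setIntegral_congr_fun (measurableSet_arm d M) fun z hz => by
    simp only [reflect_of_mem (φ := f) (arm_subset_quadrant d M hz)]

theorem notMem_pairDomain_of_diag {z : ℝ × ℝ} (h1 : d < |z.1|) (h2 : d < z.2) :
    (|(diagCoord.symm z).1|, |(diagCoord.symm z).2|) ∉ pairDomain d L := by
  rintro ⟨-, -, -, -, h⟩
  simp only [diagCoord_symm_apply] at h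
  rw [abs_le] at h
  obtain ⟨ha, hb⟩ := h
  cases abs_cases z.1 <;> cases abs_cases ((z.1 + z.2) / 2) <;> cases abs_cases ((z.2 - z.1) / 2) <;>
    linarith

/-- On a line `x + y = const` the function is odd in `x - y` and vanishes beyond `|x - y| = d`, so
its lowest admissible frequency is `π / d`. The derivative along `x + y` is dropped. -/
theorem MemFormDomain.arm (hd : 0 < d) (h : MemFormDomain d L φ g) (M : ℝ) :
    2 * ∫ z in arm d M, ‖φ z‖ ^ 2 ≤
      (d / Real.pi) ^ 2 * ((∫ z in arm d M, ‖g.1 z‖ ^ 2) + ∫ z in arm d M, ‖g.2 z‖ ^ 2) := by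
  have hR : MeasurableSet (Set.Ioo (-d) d ×ˢ Set.Ioo d M) := measurableSet_Ioo.prod measurableSet_Ioo
  have h0 := ae_comp_symm diagCoord h.plane_eq_zero
  have key := dirichlet_slices (b := d) (e := M) hd (stronglyMeasurable_diagFun φ)
    (stronglyMeasurable_diagGrad₁ g) (memLp_diagFun φ) (memLp_diagGrad₁ g)
    (h.hasWeakGradient.diag₁ _ _)
    (h0.mono fun z hz h1 h2 => (hz (notMem_pairDomain_of_diag h2 h1.1)).1)
    (h0.mono fun z hz h1 h2 => by
      obtain ⟨-, e1, e2⟩ := hz (notMem_pairDomain_of_diag h2 h1.1)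
      simp only [diagGrad₁, e1, e2, mul_zero, add_zero]) h.diagFun_neg_fst
  have hnn : 0 ≤ ∫ z in Set.Ioo (-d) d ×ˢ Set.Ioo d M, ‖diagGrad₂ g z‖ ^ 2 :=
    integral_nonneg fun z => by positivity
  have hs := setIntegral_norm_sq_diagGrad g hR
  rw [setIntegral_norm_sq_diagFun φ hR] at key
  change _ = (∫ z in ElectronPairs.arm d M, _) + ∫ z in ElectronPairs.arm d M, _ at hs
  change 2 * (∫ z in ElectronPairs.arm d M, _) ≤ _ at key
  rw [setIntegral_norm_sq_reflect_arm, setIntegral_norm_sq_reflect_arm] at hs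
  rw [setIntegral_norm_sq_reflect_arm] at key
  rw [← hs]
  refine key.trans (mul_le_mul_of_nonneg_left (by linarith) (by positivity))

/-! ### Assembling the corner and the arm -/

theorem ae_fst_ne (c : ℝ) : ∀ᵐ z : ℝ × ℝ, z.1 ≠ c :=
  Measure.quasiMeasurePreserving_fst.ae (p := fun x : ℝ => x ≠ c)
    (by simp [ae_iff, measure_singleton])

theorem ae_snd_ne (c : ℝ) : ∀ᵐ z : ℝ × ℝ, z.2 ≠ c :=
  Measure.quasiMeasurePreserving_snd.ae (p := fun x : ℝ => x ≠ c)
    (by simp [ae_iff, measure_singleton])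

/-- Up to null sets the domain lies in the corner `x + y < d` and the arm `d < x + y < M`, because
`x + y ≤ 2 L < M` on it. -/
theorem MemFormDomain.norm_sq_eq (h : MemFormDomain d L φ g) {M : ℝ} (hM : 2 * L < M) :
    ‖φ‖ ^ 2 = (∫ z in diamond d ∩ quadrant, ‖φ z‖ ^ 2) +
      ∫ z in ElectronPairs.arm d M, ‖φ z‖ ^ 2 := by
  have hm1 := (measurableSet_diamond d).inter measurableSet_quadrant
  have hsub : (diamond d ∩ quadrant) ∪ ElectronPairs.arm d M ⊆ quadrant :=
    Set.union_subset Set.inter_subset_right (arm_subset_quadrant d M)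
  have hdisj : Disjoint (diamond d ∩ quadrant) (ElectronPairs.arm d M) := by
    rw [Set.disjoint_left]
    rintro z ⟨⟨-, -, h1⟩, -⟩ ⟨-, h2, -⟩
    linarith
  have hi := integrable_norm_sq φ
  rw [norm_sq_eq_integral, ← setIntegral_union hdisj (measurableSet_arm d M)
    (hi.mono_set (Set.subset_union_left.trans hsub)) (hi.mono_set (Set.subset_union_right.trans hsub))]
  refine setIntegral_eq_of_subset_of_ae_sdiff_eq_zero measurableSet_quadrant.nullMeasurableSet hsub ?_
  have h0 := h.eq_zero_off
  rw [ae_restrict_iff' measurableSet_quadrant] at h0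
  filter_upwards [h0, ae_comp_symm diagCoord.symm (ae_fst_ne d),
    ae_comp_symm diagCoord.symm (ae_fst_ne (-d)), ae_comp_symm diagCoord.symm (ae_snd_ne d)]
    with z hz n1 n2 n3 hzm
  obtain ⟨hzq, hzn⟩ := hzm
  simp only [ContinuousLinearEquiv.symm_symm, diagCoord_apply] at n1 n2 n3
  by_cases hp : z ∈ pairDomain d L
  · exfalso
    obtain ⟨p1, p2, p3, p4, p5⟩ := hp
    obtain ⟨p5, p6⟩ := abs_le.1 p5
    have hq : 0 < z.1 ∧ 0 < z.2 := hzq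
    have q1 := lt_of_le_of_ne p5 (Ne.symm n2)
    have q2 := lt_of_le_of_ne p6 n1
    apply hzn
    rcases lt_or_gt_of_ne n3 with h3 | h3
    · refine Or.inl ⟨⟨⟨?_, ?_⟩, ?_, ?_⟩, hzq⟩ <;> simp only [diagCoord_apply] <;> linarith
    · refine Or.inr ⟨⟨?_, ?_⟩, ?_, ?_⟩ <;> simp only [diagCoord_apply] <;> linarith
  · rw [hz hzq hp]
    simp

theorem setIntegral_add_le_norm_sq (f : L2Quadrant) (d M : ℝ) :
    (∫ z in diamond d ∩ quadrant, ‖f z‖ ^ 2) + ∫ z in ElectronPairs.arm d M, ‖f z‖ ^ 2 ≤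
      ‖f‖ ^ 2 := by
  have hsub : (diamond d ∩ quadrant) ∪ ElectronPairs.arm d M ⊆ quadrant :=
    Set.union_subset Set.inter_subset_right (arm_subset_quadrant d M)
  have hdisj : Disjoint (diamond d ∩ quadrant) (ElectronPairs.arm d M) := by
    rw [Set.disjoint_left]
    rintro z ⟨⟨-, -, h1⟩, -⟩ ⟨-, h2, -⟩
    linarith
  have hi := integrable_norm_sq f
  rw [norm_sq_eq_integral, ← setIntegral_union hdisj (measurableSet_arm d M)
    (hi.mono_set (Set.subset_union_left.trans hsub)) (hi.mono_set (Set.subset_union_right.trans hsub))]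
  exact setIntegral_mono_set hi (ae_of_all _ fun z => by positivity) hsub.eventuallyLE

/-- The Riesz representative is the conjugate kernel truncated to `A`, which is square integrable
because `A` has finite measure. -/
theorem exists_functional_of_bounded {K : ℝ × ℝ → ℂ} (hK : Measurable K) {A : Set (ℝ × ℝ)}
    (hA : MeasurableSet A) (hAf : volume A ≠ ⊤) (hAQ : A ⊆ quadrant) {C : ℝ} (hC : ∀ z, ‖K z‖ ≤ C) :
    ∃ ℓ : L2Quadrant →L[ℂ] ℂ, ∀ φ, ℓ φ = ∫ z in A, K z * φ z := by
  let k : ℝ × ℝ → ℂ := A.indicator fun z => (starRingEnd ℂ) (K z)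
  have hk : MemLp k 2 (volume.restrict quadrant) := by
    refine MemLp.restrict _ ?_
    rw [memLp_indicator_iff_restrict hA]
    have : IsFiniteMeasure (volume.restrict A) := ⟨by
      rw [Measure.restrict_apply_univ]
      exact hAf.lt_top⟩
    refine MemLp.of_bound ?_ C (ae_of_all _ fun z => ?_)
    · exact (Complex.continuous_conj.measurable.comp hK).aestronglyMeasurable
    · rw [RCLike.norm_conj]
      exact hC z
  refine ⟨innerSL ℂ (hk.toLp k), fun φ => ?_⟩
  rw [innerSL_apply_apply, L2.inner_def]
  have h1 : ∫ z in quadrant, inner ℂ (hk.toLp k z) (φ z) =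
      ∫ z in quadrant, A.indicator (fun z => K z * φ z) z := by
    refine integral_congr_ae ?_
    filter_upwards [hk.coeFn_toLp] with z hz
    rw [hz]
    by_cases hzA : z ∈ A
    · simp [k, hzA, mul_comm]
    · simp [k, hzA]
  rw [h1, setIntegral_indicator hA, Set.inter_eq_right.2 hAQ]

theorem volume_diamond_ne_top (d : ℝ) : volume (diamond d) ≠ ⊤ := by
  have hb : Bornology.IsBounded (diamond d) := by
    refine (Metric.isBounded_Icc (-|d|, -|d|) ((|d|, |d|) : ℝ × ℝ)).subset ?_
    rintro z ⟨⟨h1, h2⟩, h3, h4⟩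
    simp only [diagCoord_apply] at h1 h2 h3 h4
    have := le_abs_self d
    exact ⟨⟨by simp only; linarith, by simp only; linarith⟩, by simp only; linarith, by simp only; linarith⟩
  exact hb.measure_lt_top.ne

theorem norm_cosProd_le (n l : ℤ) (z : ℝ × ℝ) : ‖cosProd d n l z‖ ≤ 1 := by
  unfold cosProd
  rw [norm_mul, Complex.norm_real, Complex.norm_real]
  exact mul_le_one₀ (Real.abs_cos_le_one _) (norm_nonneg _) (Real.abs_cos_le_one _)

theorem continuous_cosProd (n l : ℤ) : Continuous (cosProd d n l) := by
  unfold cosProd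
  refine (Complex.continuous_ofReal.comp ?_).mul (Complex.continuous_ofReal.comp ?_) <;> fun_prop

/-- Changing coordinates gives the factor 2, and folding onto the quadrant sums the four reflections
of the cosine kernel. What remains is integration against a bounded kernel on a bounded set. -/
theorem exists_functional_corner (d : ℝ) : ∃ ℓ : L2Quadrant →L[ℂ] ℂ, ∀ φ : L2Quadrant,
    ∫ z in diagSquare d, cosProd d 1 1 z * diagFun φ z = ℓ φ := by
  let c : ℝ × ℝ → ℂ := fun z => cosProd d 1 1 (diagCoord z)
  have hc : Continuous c := (continuous_cosProd 1 1).comp diagCoord.continuous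
  have hc1 : ∀ z, ‖c z‖ ≤ 1 := fun z => norm_cosProd_le _ _ _
  obtain ⟨ℓ, hℓ⟩ := exists_functional_of_bounded
    (K := fun z => c z + c (-z.1, z.2) + (c (z.1, -z.2) + c (-z.1, -z.2)))
    (by
      refine Continuous.measurable ?_
      fun_prop)
    ((measurableSet_diamond d).inter measurableSet_quadrant)
    (measure_ne_top_of_subset Set.inter_subset_left (volume_diamond_ne_top d))
    Set.inter_subset_right (C := 4) (fun z => by
      have h1 := norm_add_le (c z + c (-z.1, z.2)) (c (z.1, -z.2) + c (-z.1, -z.2))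
      have h2 := norm_add_le (c z) (c (-z.1, z.2))
      have h3 := norm_add_le (c (z.1, -z.2)) (c (-z.1, -z.2))
      linarith [hc1 z, hc1 (-z.1, z.2), hc1 (z.1, -z.2), hc1 (-z.1, -z.2)])
  refine ⟨(2 : ℂ) • ℓ, fun φ => ?_⟩
  have h := setIntegral_comp_symm diagCoord (measurableSet_diagSquare d)
    fun z => c z * reflect φ z
  rw [diagCoord_det, abs_two] at h
  have h1 : ∀ z, c (diagCoord.symm z) = cosProd d 1 1 z := fun z => by simp [c]
  simp_rw [h1] at h
  change ∫ z in diagSquare d, cosProd d 1 1 z * reflect φ (diagCoord.symm z) = _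
  rw [h, smul_apply, hℓ, smul_eq_mul, Complex.real_smul]
  congr 1
  change ∫ z in diamond d, c z * reflect φ z = _
  have hint : IntegrableOn (fun z => c z * reflect φ z) (diamond d) :=
    Integrable.bdd_mul (c := 1)
      (integrableOn_of_memLp_two (memLp_reflect_coe φ) (volume_diamond_ne_top d))
      hc.aestronglyMeasurable (ae_of_all _ hc1)
  rw [setIntegral_fold_quadrant (measurableSet_diamond d) neg_fst_mem_diamond neg_snd_mem_diamond
    hint]
  refine setIntegral_congr_fun ((measurableSet_diamond d).inter measurableSet_quadrant)
    fun z hz => ?_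
  have e1 : reflect φ z = φ z := reflect_of_mem hz.2
  have e2 : reflect φ (-z.1, -z.2) = φ z := by
    rw [reflect_neg_fst (z.1, -z.2), reflect_neg_snd, e1]
  simp only [reflect_neg_fst, reflect_neg_snd, e1, e2]
  ring

/-- Orthogonally to one function, supported in the corner and independent of `L`, the quadratic form
is bounded below by the bottom `2 (π / d) ^ 2` of the spectrum of the infinite strip. -/
theorem exists_functional_gap (hd : 0 < d) : ∃ (ℓ : L2Quadrant →L[ℂ] ℂ) (C : ℝ),
    ∀ (L : ℝ) (φ : L2Quadrant) (g : L2Quadrant × L2Quadrant), MemFormDomain d L φ g →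
      2 * (Real.pi / d) ^ 2 * ‖φ‖ ^ 2 ≤ ‖g.1‖ ^ 2 + ‖g.2‖ ^ 2 + C * ‖ℓ φ‖ ^ 2 := by
  obtain ⟨ℓ, hℓ⟩ := exists_functional_corner d
  refine ⟨ℓ, (Real.pi / d) ^ 2 * (1 / (4 * d ^ 2)), fun L φ g h => ?_⟩
  have hM : 2 * L < 2 * L + 1 := by linarith
  have h1 := h.corner hd
  have h2 := h.arm hd (2 * L + 1)
  rw [hℓ] at h1
  have g1 := setIntegral_add_le_norm_sq g.1 d (2 * L + 1)
  have g2 := setIntegral_add_le_norm_sq g.2 d (2 * L + 1)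
  rw [h.norm_sq_eq hM]
  have hpi := Real.pi_pos
  have hcancel : (Real.pi / d) ^ 2 * (d / Real.pi) ^ 2 = 1 := by
    field_simp
  have key : (Real.pi / d) ^ 2 * (2 * ((∫ z in diamond d ∩ quadrant, ‖φ z‖ ^ 2) +
      ∫ z in ElectronPairs.arm d (2 * L + 1), ‖φ z‖ ^ 2)) ≤ (Real.pi / d) ^ 2 *
      ((d / Real.pi) ^ 2 * (‖g.1‖ ^ 2 + ‖g.2‖ ^ 2) + 1 / (4 * d ^ 2) * ‖ℓ φ‖ ^ 2) := by
    refine mul_le_mul_of_nonneg_left ?_ (by positivity)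
    have := mul_le_mul_of_nonneg_left (add_le_add g1 g2) (by positivity : 0 ≤ (d / Real.pi) ^ 2)
    linarith
  rw [mul_add ((Real.pi / d) ^ 2) ((d / Real.pi) ^ 2 * _), ← mul_assoc _ ((d / Real.pi) ^ 2),
    hcancel, one_mul] at key
  linarith

end Gap

/-! ## Lower bounds off finitely many functionals -/

section Counting

variable {d L : ℝ} {φ : L2Quadrant} {g : L2Quadrant × L2Quadrant}

/-- The part of the strip below the diagonal, up to height `H`. -/
def lowerStrip (d H : ℝ) : Set (ℝ × ℝ) :=
  shearCoord ⁻¹' (Set.Ioo 0 (0 + d) ×ˢ Set.Ioo 0 (0 + H))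

theorem measurableSet_lowerStrip (d H : ℝ) : MeasurableSet (lowerStrip d H) :=
  shearCoord.continuous.measurable (measurableSet_Ioo.prod measurableSet_Ioo)

theorem lowerStrip_subset_quadrant (d H : ℝ) : lowerStrip d H ⊆ quadrant := by
  rintro z ⟨⟨h1, h2⟩, h3, h4⟩
  simp only [shearCoord_apply] at h1 h2 h3 h4
  exact ⟨show 0 < z.1 by linarith, h3⟩

theorem volume_lowerStrip_ne_top (d H : ℝ) : volume (lowerStrip d H) ≠ ⊤ := by
  have hb : Bornology.IsBounded (lowerStrip d H) := by
    refine (Metric.isBounded_Icc (0, 0) ((|d| + |H|, |H|) : ℝ × ℝ)).subset ?_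
    rintro z ⟨⟨h1, h2⟩, h3, h4⟩
    simp only [shearCoord_apply] at h1 h2 h3 h4
    have := le_abs_self d
    have := le_abs_self H
    exact ⟨⟨by simp only; linarith, by simp only; linarith⟩, by simp only; linarith,
      by simp only; linarith⟩
  exact hb.measure_lt_top.ne

/-- An exchange-symmetric integrand contributes equally on both sides of the diagonal, which is a
null set. -/
theorem setIntegral_quadrant_eq_lowerStrip {K : ℝ × ℝ → ℝ} {H : ℝ}
    (hK : IntegrableOn K quadrant) (hs : ∀ᵐ z ∂(volume.restrict quadrant), K z.swap = K z)
    (h0 : ∀ᵐ z : ℝ × ℝ, z ∈ quadrant → z.2 < z.1 → z ∉ lowerStrip d H → K z = 0) :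
    ∫ z in quadrant, K z = 2 * ∫ z in lowerStrip d H, K z := by
  have hA : MeasurableSet {z : ℝ × ℝ | z.2 < z.1} := measurableSet_lt measurable_snd measurable_fst
  have hQA := measurableSet_quadrant.inter hA
  have hsub : lowerStrip d H ⊆ quadrant ∩ {z : ℝ × ℝ | z.2 < z.1} := by
    intro z hz
    refine ⟨lowerStrip_subset_quadrant d H hz, ?_⟩
    have := hz.1.1
    simp only [shearCoord_apply] at this
    exact sub_pos.1 this
  have hdiag : ∀ᵐ z : ℝ × ℝ, z.1 - z.2 ≠ 0 :=
    ae_comp_symm shearCoord.symm (ae_fst_ne 0)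
  have hswap : MeasurePreserving Prod.swap (volume : Measure (ℝ × ℝ)) volume :=
    Measure.measurePreserving_swap
  rw [setIntegral_fold hswap Prod.swap_swap hA measurableSet_quadrant (Set.ext fun z => and_comm)
    (Set.disjoint_left.2 fun z h1 h2 => lt_asymm (show z.2 < z.1 from h1) h2)
    (hdiag.mono fun z hz => (lt_or_gt_of_ne (sub_ne_zero.1 hz)).symm) hK]
  have h1 : ∫ z in quadrant ∩ {z : ℝ × ℝ | z.2 < z.1}, (K z + K z.swap) =
      ∫ z in quadrant ∩ {z : ℝ × ℝ | z.2 < z.1}, 2 * K z := by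
    refine integral_congr_ae ?_
    filter_upwards [ae_restrict_of_ae_restrict_of_subset Set.inter_subset_left hs] with z hz
    rw [hz]
    ring
  rw [h1, integral_const_mul]
  congr 1
  refine setIntegral_eq_of_subset_of_ae_sdiff_eq_zero hQA.nullMeasurableSet hsub ?_
  filter_upwards [h0] with z hz hzm
  exact hz hzm.1.1 hzm.1.2 hzm.2

theorem MemFormDomain.norm_sq_eq_lowerStrip (h : MemFormDomain d L φ g) {H : ℝ} (hH : L ≤ H) :
    ‖φ‖ ^ 2 = 2 * ∫ z in lowerStrip d H, ‖φ z‖ ^ 2 := by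
  have h0 := h.eq_zero_off
  rw [ae_restrict_iff' measurableSet_quadrant] at h0
  rw [norm_sq_eq_integral, setIntegral_quadrant_eq_lowerStrip (integrable_norm_sq φ)
    (h.antisymm.mono fun z hz => by simp only [hz, norm_neg])]
  filter_upwards [h0, ae_comp_symm shearCoord.symm (ae_fst_ne d), ae_snd_ne H]
    with z hz n1 n2 hzq hzA hzn
  simp only [ContinuousLinearEquiv.symm_symm, shearCoord_apply] at n1
  by_cases hp : z ∈ pairDomain d L
  · exfalso
    obtain ⟨p1, p2, p3, p4, p5⟩ := hp
    obtain ⟨p5, p6⟩ := abs_le.1 p5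
    have q2 := lt_of_le_of_ne p6 n1
    have q3 := lt_of_le_of_ne (p4.trans hH) n2
    have hq : 0 < z.2 := hzq.2
    refine hzn ⟨⟨?_, ?_⟩, ?_, ?_⟩ <;> simp only [shearCoord_apply] <;> linarith
  · rw [hz hzq hp]
    simp

theorem setIntegral_shear_norm_sq_le {G : ℝ × ℝ → ℂ} {f : L2Quadrant}
    (hG : ∀ᵐ z, ‖G z‖ = ‖reflect f z‖) (d H : ℝ) :
    ∫ z in Set.Ioo 0 (0 + d) ×ˢ Set.Ioo 0 (0 + H), ‖G (shearCoord.symm z)‖ ^ 2 ≤ ‖f‖ ^ 2 := by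
  have h := setIntegral_comp_symm shearCoord (A := Set.Ioo 0 (0 + d) ×ˢ Set.Ioo 0 (0 + H))
    (measurableSet_Ioo.prod measurableSet_Ioo) fun z => ‖G z‖ ^ 2
  rw [shearCoord_det, abs_one, one_smul] at h
  rw [h, norm_sq_eq_integral]
  change ∫ z in lowerStrip d H, _ ≤ _
  calc ∫ z in lowerStrip d H, ‖G z‖ ^ 2 = ∫ z in lowerStrip d H, ‖f z‖ ^ 2 := by
        refine integral_congr_ae ?_
        filter_upwards [ae_restrict_of_ae hG, ae_restrict_mem (measurableSet_lowerStrip d H)]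
          with z hz hm
        rw [hz, reflect_of_mem (lowerStrip_subset_quadrant d H hm)]
    _ ≤ _ := setIntegral_mono_set (integrable_norm_sq f) (ae_of_all _ fun z => by positivity)
        (lowerStrip_subset_quadrant d H).eventuallyLE

/-- The product of cosines `cos (π n p / d) cos (π l y / H)` in the coordinates `(x - y, y)`. -/
def cosShear (d H : ℝ) (n l : ℤ) (z : ℝ × ℝ) : ℂ :=
  (Real.cos (Real.pi * n * (z.1 - z.2 - 0) / d) : ℂ) *
    (Real.cos (Real.pi * l * (z.2 - 0) / H) : ℂ)

theorem exists_functional_cosShear (d H : ℝ) (n l : ℤ) : ∃ ℓ : L2Quadrant →L[ℂ] ℂ,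
    ∀ φ : L2Quadrant, ℓ φ = ∫ z in lowerStrip d H, cosShear d H n l z * φ z := by
  refine exists_functional_of_bounded (C := 1) ?_ (measurableSet_lowerStrip d H)
    (volume_lowerStrip_ne_top d H) (lowerStrip_subset_quadrant d H) fun z => ?_
  · refine Continuous.measurable ?_
    unfold cosShear
    refine (Complex.continuous_ofReal.comp ?_).mul (Complex.continuous_ofReal.comp ?_) <;> fun_prop
  · unfold cosShear
    rw [norm_mul, Complex.norm_real, Complex.norm_real]
    exact mul_le_one₀ (Real.abs_cos_le_one _) (norm_nonneg _) (Real.abs_cos_le_one _)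

/-- Rectangle inequality in the coordinates `(x - y, y)`. Their partial derivatives are `∂x` and `∂x
+ ∂y`, the latter with square at most `2 |∇φ| ^ 2`. Taking `m n` modes along the length `n` makes
the error `1 / (π m)` independent of `n`. The constant `2 d ^ 2 + 4` is twice `d ^ 2 + 2`, since the
half strip carries half of `‖φ‖ ^ 2`. -/
theorem MemFormDomain.le_of_integral_cosShear_eq_zero (hd : 0 < d) (h : MemFormDomain d L φ g)
    {m n : ℕ} (hm : 0 < m) (hn : 0 < n) (hL : L ≤ n)
    (hφ : ∀ j ∈ Finset.Ioo (-m : ℤ) m, ∀ l ∈ Finset.Ioo (-(m * n : ℕ) : ℤ) (m * n : ℕ),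
      ∫ z in lowerStrip d n, cosShear d n j l z * φ z = 0) :
    Real.pi ^ 2 / (2 * d ^ 2 + 4) * m ^ 2 * ‖φ‖ ^ 2 ≤ ‖g.1‖ ^ 2 + ‖g.2‖ ^ 2 := by
  have hn' : (0 : ℝ) < n := by exact_mod_cast hn
  have hm' : (0 : ℝ) < m := by exact_mod_cast hm
  have hΦ := memLp_reflect_coe φ
  have s1 := stronglyMeasurable_comp_symm shearCoord (stronglyMeasurable_planeGrad₁ g)
  have s2 := stronglyMeasurable_comp_symm shearCoord (stronglyMeasurable_planeGrad₂ g)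
  have m1 := memLp_comp_symm shearCoord (stronglyMeasurable_planeGrad₁ g) (memLp_planeGrad₁ g)
  have m2 := memLp_comp_symm shearCoord (stronglyMeasurable_planeGrad₂ g) (memLp_planeGrad₂ g)
  have hA := h.hasWeakGradient.plane.prodWeakDeriv shearCoord hΦ (memLp_planeGrad₁ g)
    (memLp_planeGrad₂ g) (c₁ := 1) (c₂ := 0) (by rw [shearCoord_symm_apply]; norm_num)
    (Set.Ioo 0 (0 + d)) (Set.Ioo 0 (0 + n))
  have hB := h.hasWeakGradient.plane.prodWeakDeriv_swap shearCoord hΦ (memLp_planeGrad₁ g)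
    (memLp_planeGrad₂ g) (c₁ := 1) (c₂ := 1) (by rw [shearCoord_symm_apply]; norm_num)
    (Set.Ioo 0 (0 + n)) (Set.Ioo 0 (0 + d))
  simp only [Complex.ofReal_one, Complex.ofReal_zero, one_mul, zero_mul, add_zero] at hA hB
  have key := rectangle_poincare (F := fun z => reflect φ (shearCoord.symm z))
    (Ga := fun z => planeGrad₁ g (shearCoord.symm z))
    (Gb := fun z => planeGrad₁ g (shearCoord.symm z) + planeGrad₂ g (shearCoord.symm z))
    hd hn' (stronglyMeasurable_comp_symm _ (stronglyMeasurable_reflect_coe φ)) s1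
    (s1.add s2) ((memLp_comp_symm _ (stronglyMeasurable_reflect_coe φ) hΦ).restrict _)
    (m1.restrict _) ((m1.add m2).restrict _) hA hB hm (M := m * n) (by positivity)
  have hR : MeasurableSet (Set.Ioo 0 (0 + d) ×ˢ Set.Ioo 0 (0 + (n : ℝ))) :=
    measurableSet_Ioo.prod measurableSet_Ioo
  have hsum : ∀ j ∈ Finset.Ioo (-m : ℤ) m, ∀ l ∈ Finset.Ioo (-(m * n : ℕ) : ℤ) (m * n : ℕ),
      ∫ z in Set.Ioo 0 (0 + d) ×ˢ Set.Ioo 0 (0 + (n : ℝ)),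
        (Real.cos (Real.pi * j * (z.1 - 0) / d) : ℂ) *
          (Real.cos (Real.pi * l * (z.2 - 0) / n) : ℂ) * reflect φ (shearCoord.symm z) = 0 := by
    intro j hj l hl
    have e := setIntegral_comp_symm shearCoord hR fun z => cosShear d n j l z * reflect φ z
    rw [shearCoord_det, abs_one, one_smul] at e
    simp only [cosShear, shearCoord_symm_apply, add_sub_cancel_right] at e
    simp only [shearCoord_symm_apply]
    rw [e, ← hφ j hj l hl]
    refine setIntegral_congr_fun (measurableSet_lowerStrip d n) fun z hz => ?_
    simp only [cosShear, reflect_of_mem (φ := φ) (lowerStrip_subset_quadrant d n hz)]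
  rw [Finset.sum_eq_zero fun j hj => Finset.sum_eq_zero fun l hl => by
    rw [hsum j hj l hl, norm_zero, sq, zero_mul], mul_zero, mul_zero, add_zero] at key
  have e1 := setIntegral_comp_symm shearCoord hR fun z => ‖reflect φ z‖ ^ 2
  rw [shearCoord_det, abs_one, one_smul] at e1
  have e2 : ∫ z in shearCoord ⁻¹' (Set.Ioo 0 (0 + d) ×ˢ Set.Ioo 0 (0 + (n : ℝ))),
      ‖reflect φ z‖ ^ 2 = ∫ z in lowerStrip d n, ‖φ z‖ ^ 2 :=
    setIntegral_congr_fun (measurableSet_lowerStrip d n) fun z hz => by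
      simp only [reflect_of_mem (φ := φ) (lowerStrip_subset_quadrant d n hz)]
  have h1 := setIntegral_shear_norm_sq_le (norm_planeGrad₁_ae g) d n
  have h2 := setIntegral_shear_norm_sq_le (norm_planeGrad₂_ae g) d n
  have h3 : ∫ z in Set.Ioo 0 (0 + d) ×ˢ Set.Ioo 0 (0 + (n : ℝ)),
      ‖planeGrad₁ g (shearCoord.symm z) + planeGrad₂ g (shearCoord.symm z)‖ ^ 2 ≤
      2 * (‖g.1‖ ^ 2 + ‖g.2‖ ^ 2) := by
    refine le_trans ?_ (mul_le_mul_of_nonneg_left (add_le_add h1 h2) two_pos.le)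
    have i1 := (integrable_norm_sq_of_memLp m1).integrableOn
      (s := Set.Ioo 0 (0 + d) ×ˢ Set.Ioo 0 (0 + (n : ℝ)))
    have i2 := (integrable_norm_sq_of_memLp m2).integrableOn
      (s := Set.Ioo 0 (0 + d) ×ˢ Set.Ioo 0 (0 + (n : ℝ)))
    rw [← integral_add i1 i2, ← integral_const_mul]
    refine integral_mono (integrable_norm_sq_of_memLp (m1.add m2)).integrableOn
      ((i1.add i2).const_mul 2) fun z => ?_
    have := norm_add_le (planeGrad₁ g (shearCoord.symm z)) (planeGrad₂ g (shearCoord.symm z))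
    calc _ ≤ (‖planeGrad₁ g (shearCoord.symm z)‖ + ‖planeGrad₂ g (shearCoord.symm z)‖) ^ 2 := by
          gcongr
      _ ≤ _ := by
          nlinarith [sq_nonneg (‖planeGrad₁ g (shearCoord.symm z)‖ -
            ‖planeGrad₂ g (shearCoord.symm z)‖)]
  rw [e1, e2] at key
  rw [h.norm_sq_eq_lowerStrip hL]
  have hpi := Real.pi_pos
  have c2 : (n : ℝ) / (Real.pi * (m * n : ℕ)) = 1 / (Real.pi * m) := by
    push_cast
    field_simp
  rw [c2] at key
  have key2 := key.trans (add_le_add (mul_le_mul_of_nonneg_left h1 (by positivity))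
    (mul_le_mul_of_nonneg_left h3 (by positivity)))
  have hle : (d / (Real.pi * m)) ^ 2 * ‖g.1‖ ^ 2 +
      (1 / (Real.pi * m)) ^ 2 * (2 * (‖g.1‖ ^ 2 + ‖g.2‖ ^ 2)) ≤
      (d ^ 2 + 2) / (Real.pi ^ 2 * m ^ 2) * (‖g.1‖ ^ 2 + ‖g.2‖ ^ 2) := by
    have : (d / (Real.pi * m)) ^ 2 * ‖g.1‖ ^ 2 ≤
        (d / (Real.pi * m)) ^ 2 * (‖g.1‖ ^ 2 + ‖g.2‖ ^ 2) :=
      mul_le_mul_of_nonneg_left (le_add_of_nonneg_right (by positivity)) (by positivity)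
    refine (add_le_add_left this _).trans (le_of_eq ?_)
    field_simp
  have key3 := key2.trans hle
  calc Real.pi ^ 2 / (2 * d ^ 2 + 4) * m ^ 2 * (2 * ∫ z in lowerStrip d n, ‖φ z‖ ^ 2)
      = Real.pi ^ 2 * m ^ 2 / (d ^ 2 + 2) * ∫ z in lowerStrip d n, ‖φ z‖ ^ 2 := by
        field_simp
        ring
    _ ≤ Real.pi ^ 2 * m ^ 2 / (d ^ 2 + 2) *
        ((d ^ 2 + 2) / (Real.pi ^ 2 * m ^ 2) * (‖g.1‖ ^ 2 + ‖g.2‖ ^ 2)) :=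
        mul_le_mul_of_nonneg_left key3 (by positivity)
    _ = _ := by field_simp

/-- On a wire of length `n`, the quadratic form is at least `c m ^ 2` off `4 m ^ 2 n` functionals. -/
theorem exists_functionals_counting (hd : 0 < d) (m : ℕ) {n : ℕ} (hn : 0 < n) :
    ∃ (κ : Finset (ℤ × ℤ)) (ℓ : κ → L2Quadrant →L[ℂ] ℂ), Fintype.card κ ≤ 4 * m ^ 2 * n ∧
      ∀ (L : ℝ) (φ : L2Quadrant) (g : L2Quadrant × L2Quadrant), L ≤ n → MemFormDomain d L φ g →
        (∀ k, ℓ k φ = 0) →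
        Real.pi ^ 2 / (2 * d ^ 2 + 4) * m ^ 2 * ‖φ‖ ^ 2 ≤ ‖g.1‖ ^ 2 + ‖g.2‖ ^ 2 := by
  choose ℓ hℓ using exists_functional_cosShear d n
  refine ⟨Finset.Ioo (-m : ℤ) m ×ˢ Finset.Ioo (-(m * n : ℕ) : ℤ) (m * n : ℕ),
    fun k => ℓ k.1.1 k.1.2, ?_, fun L φ g hL h hk => ?_⟩
  · rw [Fintype.card_coe, Finset.card_product, Int.card_Ioo, Int.card_Ioo]
    calc _ ≤ (2 * m) * (2 * (m * n)) := Nat.mul_le_mul (by omega) (by omega)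
      _ = _ := by ring
  · rcases Nat.eq_zero_or_pos m with rfl | hm
    · simp only [Nat.cast_zero, ne_eq, OfNat.ofNat_ne_zero, not_false_eq_true, zero_pow, mul_zero,
        zero_mul]
      positivity
    · refine h.le_of_integral_cosShear_eq_zero hd hm hn hL fun j hj l hl => ?_
      rw [← hℓ]
      exact hk ⟨(j, l), Finset.mem_product.2 ⟨hj, hl⟩⟩

end Counting

/-! ## A bound state: a trial function below the bottom of the spectrum of the strip -/

/-- The density `|∇ψ|² - 2 k² |ψ|²` of `ψ(x, y) = f(x - y, y)`, `f = a sin (k p) + b sin (2 k p)`, where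
`a`, `b` depend on `y` with derivatives `a'`, `b'`. -/
def trialDensity (k a b a' b' p : ℝ) : ℝ :=
  2 * (k * (a * Real.cos (k * p) + 2 * b * Real.cos (2 * (k * p)))) ^ 2 -
    2 * (k * (a * Real.cos (k * p) + 2 * b * Real.cos (2 * (k * p)))) *
      (a' * Real.sin (k * p) + b' * Real.sin (2 * (k * p))) +
    (a' * Real.sin (k * p) + b' * Real.sin (2 * (k * p))) ^ 2 -
    2 * k ^ 2 * (a * Real.sin (k * p) + b * Real.sin (2 * (k * p))) ^ 2

/-- Product-to-sum formulas turn the density into a trigonometric polynomial in `k p`, which is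
integrated term by term. -/
theorem hasDerivAt_trialPrimitive (k a b a' b' p : ℝ) (hk : k ≠ 0) :
    HasDerivAt (fun p => (k * a ^ 2 - a' ^ 2 / (4 * k)) * Real.sin (2 * (k * p)) +
      2 * k * a * b * (Real.sin (3 * (k * p)) + Real.sin (k * p)) +
      (3 * k ^ 2 * b ^ 2 + a' ^ 2 / 2 + b' ^ 2 / 2) * p +
      (5 / 4 * k * b ^ 2 - b' ^ 2 / (8 * k)) * Real.sin (4 * (k * p)) +
      a' * b' / k * (Real.sin (k * p) - Real.sin (3 * (k * p)) / 3) +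
      (a * a' / 2 * Real.cos (2 * (k * p)) +
        a * b' * (Real.cos (3 * (k * p)) / 3 + Real.cos (k * p)) +
        2 * (a' * b) * (Real.cos (3 * (k * p)) / 3 - Real.cos (k * p)) +
        b * b' / 2 * Real.cos (4 * (k * p))))
      (trialDensity k a b a' b' p) p := by
  have hS : ∀ j : ℝ, HasDerivAt (fun p => Real.sin (j * (k * p)))
      (Real.cos (j * (k * p)) * (j * k)) p := by
    intro j
    have : HasDerivAt (fun p => j * (k * p)) (j * k) p := by
      simpa using ((hasDerivAt_id p).const_mul k).const_mul j
    exact this.sin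
  have hC : ∀ j : ℝ, HasDerivAt (fun p => Real.cos (j * (k * p)))
      (-Real.sin (j * (k * p)) * (j * k)) p := by
    intro j
    have : HasDerivAt (fun p => j * (k * p)) (j * k) p := by
      simpa using ((hasDerivAt_id p).const_mul k).const_mul j
    exact this.cos
  have hS1 := hS 1
  have hC1 := hC 1
  simp only [one_mul] at hS1 hC1
  have h := ((((((hS 2).const_mul (k * a ^ 2 - a' ^ 2 / (4 * k))).add
    (((hS 3).add hS1).const_mul (2 * k * a * b))).add
    ((hasDerivAt_id p).const_mul (3 * k ^ 2 * b ^ 2 + a' ^ 2 / 2 + b' ^ 2 / 2))).add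
    ((hS 4).const_mul (5 / 4 * k * b ^ 2 - b' ^ 2 / (8 * k)))).add
    ((hS1.sub ((hS 3).div_const 3)).const_mul (a' * b' / k))).add
    (((((hC 2).const_mul (a * a' / 2)).add
    ((((hC 3).div_const 3).add hC1).const_mul (a * b'))).add
    ((((hC 3).div_const 3).sub hC1).const_mul (2 * (a' * b)))).add
    ((hC 4).const_mul (b * b' / 2)))
  refine h.congr_deriv ?_
  -- After expanding the multiple angles, a polynomial identity modulo `sin ^ 2 + cos ^ 2 = 1`
  -- remains.
  unfold trialDensity
  have e4 : 4 * (k * p) = 2 * (2 * (k * p)) := by ring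
  rw [e4, Real.sin_two_mul (2 * (k * p)), Real.cos_two_mul (2 * (k * p)), Real.sin_two_mul,
    Real.cos_two_mul, Real.sin_three_mul, Real.cos_three_mul]
  have hsc := Real.sin_sq_add_cos_sq (k * p)
  generalize Real.sin (k * p) = s at *
  generalize Real.cos (k * p) = c at *
  clear h hS hC hS1 hC1 e4
  field_simp
  grind

theorem continuous_trialDensity (k a b a' b' : ℝ) : Continuous (trialDensity k a b a' b') := by
  unfold trialDensity
  fun_prop

/-- The first mode sits exactly at the threshold, so `a` itself costs nothing and only `a'` does.
The second mode costs a term quadratic in `b`, while its interference with the first is linear in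
`b` and its derivative. A small `b` of the right sign therefore lowers the energy. -/
theorem integral_trialDensity {d : ℝ} (hd : 0 < d) (a b a' b' : ℝ) :
    ∫ p in (0 : ℝ)..d, trialDensity (Real.pi / d) a b a' b' p =
      d / 2 * (6 * (Real.pi / d) ^ 2 * b ^ 2 + a' ^ 2 + b' ^ 2) - 8 / 3 * (a * b' - a' * b) := by
  have hpi := Real.pi_pos
  have hk : Real.pi / d ≠ 0 := by positivity
  rw [intervalIntegral.integral_eq_sub_of_hasDerivAt
    (fun p _ => hasDerivAt_trialPrimitive (Real.pi / d) a b a' b' p hk)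
    ((continuous_trialDensity _ _ _ _ _).intervalIntegrable _ _)]
  have e : Real.pi / d * d = Real.pi := by field_simp
  have s3 : Real.sin (3 * Real.pi) = 0 := by exact_mod_cast Real.sin_nat_mul_pi 3
  have s4 : Real.sin (4 * Real.pi) = 0 := by exact_mod_cast Real.sin_nat_mul_pi 4
  have c3 : Real.cos (3 * Real.pi) = -1 := by
    rw [show 3 * Real.pi = Real.pi + 2 * Real.pi by ring, Real.cos_add_two_pi, Real.cos_pi]
  have c4 : Real.cos (4 * Real.pi) = 1 := by
    rw [show 4 * Real.pi = 2 * Real.pi + 2 * Real.pi by ring, Real.cos_add_two_pi, Real.cos_two_pi]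
  simp only [e, mul_zero, Real.sin_zero, Real.cos_zero, Real.sin_pi, Real.cos_pi, Real.sin_two_pi,
    Real.cos_two_pi, s3, s4, c3, c4]
  ring

/-- Truncation to the interval `[0, c]`. -/
def clamp (c p : ℝ) : ℝ := max 0 (min p c)

theorem lipschitzWith_clamp (c : ℝ) : LipschitzWith 1 (clamp c) :=
  (LipschitzWith.id.min_const c).const_max 0

theorem clamp_mem {c : ℝ} (hc : 0 ≤ c) (p : ℝ) : clamp c p ∈ Set.Icc 0 c :=
  ⟨le_max_left _ _, max_le hc (min_le_right _ _)⟩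

theorem clamp_of_mem {c p : ℝ} (h0 : 0 ≤ p) (hc : p ≤ c) : clamp c p = p := by
  rw [clamp, min_eq_left hc, max_eq_right h0]

theorem clamp_of_le_zero {c p : ℝ} (hp : p ≤ 0) : clamp c p = 0 := by
  rw [clamp, max_eq_left ((min_le_left _ _).trans hp)]

theorem clamp_of_ge {c p : ℝ} (hc : 0 ≤ c) (hp : c ≤ p) : clamp c p = c := by
  rw [clamp, min_eq_right hp, max_eq_right hc]

/-- The trial function in terms of the truncated coordinates. -/
def trialAux (d : ℝ) (q : ℝ × ℝ × ℝ) : ℝ :=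
  (1 - q.2.1 / (10 * d)) * Real.sin (Real.pi / d * q.1) +
    (-(1 / 10) * (1 - q.2.2 / d)) * Real.sin (2 * (Real.pi / d * q.1))

theorem contDiff_trialAux (d : ℝ) : ContDiff ℝ ∞ (trialAux d) := by
  unfold trialAux
  fun_prop

/-- The part of the trial function below the diagonal. -/
def trialHalf (d : ℝ) (z : ℝ × ℝ) : ℝ :=
  trialAux d (clamp d (z.1 - z.2), clamp (10 * d) z.2, clamp d z.2)

/-- The trial function. -/
def trial (d : ℝ) (z : ℝ × ℝ) : ℝ := trialHalf d z - trialHalf d z.swap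

theorem trial_swap (d : ℝ) (z : ℝ × ℝ) : trial d z.swap = -trial d z := by
  simp [trial]

/-- Clamping keeps the arguments in a compact box, on which the smooth profile is Lipschitz.
Lipschitz continuity suffices for integration by parts against test functions, so the kinks of the
clamps do no harm. -/
theorem exists_lipschitzWith_trial {d : ℝ} (hd : 0 < d) : ∃ C, LipschitzWith C (trial d) := by
  have hK : IsCompact (Set.Icc 0 d ×ˢ (Set.Icc 0 (10 * d) ×ˢ Set.Icc 0 d) : Set (ℝ × ℝ × ℝ)) :=
    isCompact_Icc.prod (isCompact_Icc.prod isCompact_Icc)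
  obtain ⟨C, hC⟩ := (((contDiff_trialAux d).of_le (by exact_mod_cast le_top)
    : ContDiff ℝ 1 (trialAux d)).locallyLipschitz.locallyLipschitzOn).exists_lipschitzOnWith_of_compact hK
  have h1 : LipschitzWith (1 + 1) fun z : ℝ × ℝ => z.1 - z.2 :=
    LipschitzWith.prod_fst.sub LipschitzWith.prod_snd
  have h2 := ((lipschitzWith_clamp d).comp h1).prodMk
    (((lipschitzWith_clamp (10 * d)).comp LipschitzWith.prod_snd).prodMk
      ((lipschitzWith_clamp d).comp LipschitzWith.prod_snd))
  have h3 : LipschitzWith _ (trialHalf d) := lipschitzOnWith_univ.1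
    (hC.comp (lipschitzOnWith_univ.2 h2) fun z _ => ⟨clamp_mem hd.le _,
      clamp_mem (by positivity) _, clamp_mem hd.le _⟩)
  have h4 : LipschitzWith 1 (Prod.swap : ℝ × ℝ → ℝ × ℝ) :=
    LipschitzWith.prod_snd.prodMk LipschitzWith.prod_fst |>.weaken (by simp)
  exact ⟨_, h3.sub (h3.comp h4)⟩

theorem trialHalf_eq_zero {d : ℝ} (hd : 0 < d) {z : ℝ × ℝ}
    (h : z.1 - z.2 ≤ 0 ∨ d ≤ z.1 - z.2 ∨ 10 * d ≤ z.2) : trialHalf d z = 0 := by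
  have e : Real.pi / d * d = Real.pi := by field_simp
  rcases h with h | h | h
  · simp [trialHalf, trialAux, clamp_of_le_zero h]
  · simp [trialHalf, trialAux, clamp_of_ge hd.le h, e]
  · have h1 : clamp (10 * d) z.2 = 10 * d := clamp_of_ge (by positivity) h
    have h2 : clamp d z.2 = d := clamp_of_ge hd.le (by linarith)
    simp [trialHalf, trialAux, h1, h2, hd.ne']

/-- Below the diagonal the support has `y ≤ 10 d` and `x - y ≤ d`, so both coordinates are at most
`11 d`; this is the minimal wire length in the spectral bounds. -/
theorem trial_eq_zero {d : ℝ} (hd : 0 < d) {z : ℝ × ℝ} (hz : z ∈ quadrant)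
    (h : z ∉ pairDomain d (11 * d)) : trial d z = 0 := by
  have hq : 0 < z.1 ∧ 0 < z.2 := hz
  have h1 : z.1 - z.2 ≤ 0 ∨ d ≤ z.1 - z.2 ∨ 10 * d ≤ z.2 := by
    by_contra! hc
    exact h ⟨hq.1.le, by linarith, hq.2.le, by linarith, abs_le.2 ⟨by linarith, by linarith⟩⟩
  have h2 : z.2 - z.1 ≤ 0 ∨ d ≤ z.2 - z.1 ∨ 10 * d ≤ z.1 := by
    by_contra! hc
    exact h ⟨hq.1.le, by linarith, hq.2.le, by linarith, abs_le.2 ⟨by linarith, by linarith⟩⟩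
  rw [trial, trialHalf_eq_zero hd h1, trialHalf_eq_zero (z := z.swap) hd h2, sub_zero]

theorem eventually_notMem_pairDomain {d L : ℝ} {z : ℝ × ℝ} (hz : z ∈ quadrant)
    (h : z ∉ pairDomain d L) : ∀ᶠ w in 𝓝 z, w ∈ quadrant ∧ w ∉ pairDomain d L :=
  (isOpen_quadrant.eventually_mem hz).and ((isClosed_pairDomain d L).isOpen_compl.eventually_mem h)

theorem lineDeriv_trial_eq_zero {d : ℝ} (hd : 0 < d) {z : ℝ × ℝ} (hz : z ∈ quadrant)
    (h : z ∉ pairDomain d (11 * d)) (v : ℝ × ℝ) : lineDeriv ℝ (trial d) z v = 0 := by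
  have : trial d =ᶠ[𝓝 z] fun _ => 0 :=
    (eventually_notMem_pairDomain hz h).mono fun w hw => trial_eq_zero hd hw.1 hw.2
  rw [this.lineDeriv_eq]
  simp [lineDeriv]

theorem lineDeriv_trial_swap (d : ℝ) (z v : ℝ × ℝ) :
    lineDeriv ℝ (trial d) z.swap v.swap = -lineDeriv ℝ (trial d) z v := by
  unfold lineDeriv
  have : (fun t : ℝ => trial d (z.swap + t • v.swap)) = fun t => -trial d (z + t • v) := by
    funext t
    rw [← trial_swap]
    rfl
  rw [this, deriv.fun_neg]

theorem isCompact_pairDomain (d L : ℝ) : IsCompact (pairDomain d L) := by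
  refine Metric.isCompact_of_isClosed_isBounded (isClosed_pairDomain d L)
    ((Metric.isBounded_Icc (0, 0) ((L, L) : ℝ × ℝ)).subset ?_)
  rintro z ⟨h1, h2, h3, h4, -⟩
  exact ⟨⟨h1, h3⟩, h2, h4⟩

theorem memLp_of_bounded_of_eq_zero {d L C : ℝ} {f : ℝ × ℝ → ℝ} (hf : Measurable f)
    (hC : ∀ z ∈ pairDomain d L, ‖f z‖ ≤ C) (h0 : ∀ z ∈ quadrant, z ∉ pairDomain d L → f z = 0) :
    MemLp (fun z => (f z : ℂ)) 2 (volume.restrict quadrant) := by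
  have hD := (isClosed_pairDomain d L).measurableSet
  have h1 : MemLp ((pairDomain d L).indicator fun z => (f z : ℂ)) 2
      (volume.restrict quadrant) := by
    refine MemLp.restrict _ ?_
    rw [memLp_indicator_iff_restrict hD]
    have : IsFiniteMeasure (volume.restrict (pairDomain d L)) := ⟨by
      rw [Measure.restrict_apply_univ]
      exact (isCompact_pairDomain d L).measure_lt_top⟩
    refine MemLp.of_bound (Complex.measurable_ofReal.comp hf).aestronglyMeasurable C ?_
    filter_upwards [ae_restrict_mem hD] with z hz
    rw [Complex.norm_real]
    exact hC z hz
  refine h1.ae_eq ?_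
  filter_upwards [ae_restrict_mem measurableSet_quadrant] with z hz
  by_cases hzD : z ∈ pairDomain d L
  · rw [Set.indicator_of_mem hzD]
  · rw [Set.indicator_of_notMem hzD, h0 z hz hzD, Complex.ofReal_zero]

theorem memLp_trial {d : ℝ} (hd : 0 < d) :
    MemLp (fun z => (trial d z : ℂ)) 2 (volume.restrict quadrant) := by
  obtain ⟨C, hC⟩ := exists_lipschitzWith_trial hd
  obtain ⟨B, hB⟩ := (isCompact_pairDomain d (11 * d)).exists_bound_of_continuousOn
    hC.continuous.continuousOn
  exact memLp_of_bounded_of_eq_zero hC.continuous.measurable hB fun z hz h => trial_eq_zero hd hz h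

theorem memLp_lineDeriv_trial {d : ℝ} (hd : 0 < d) (v : ℝ × ℝ) :
    MemLp (fun z => ((lineDeriv ℝ (trial d) z v : ℝ) : ℂ)) 2 (volume.restrict quadrant) := by
  obtain ⟨C, hC⟩ := exists_lipschitzWith_trial hd
  exact memLp_of_bounded_of_eq_zero (measurable_lineDeriv hC.continuous)
    (fun z _ => norm_lineDeriv_le_of_lipschitz ℝ hC) fun z hz h => lineDeriv_trial_eq_zero hd hz h v

theorem integral_fderiv_mul_trial {d : ℝ} (hd : 0 < d) {η : ℝ × ℝ → ℝ} (hη : ContDiff ℝ ∞ η)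
    (hηc : HasCompactSupport η) (hηq : tsupport η ⊆ quadrant) (v : ℝ × ℝ) :
    ∫ p in quadrant, (fderiv ℝ η p v : ℂ) * (trial d p : ℂ) =
      -∫ p in quadrant, (η p : ℂ) * ((lineDeriv ℝ (trial d) p v : ℝ) : ℂ) := by
  obtain ⟨C, hC⟩ := exists_lipschitzWith_trial hd
  obtain ⟨D, hD⟩ := ContDiff.lipschitzWith_of_hasCompactSupport hηc hη (by simp)
  have h := hC.integral_lineDeriv_mul_eq (μ := volume) hD hηc v
  simp_rw [(hη.differentiable (by simp)).differentiableAt.lineDeriv_eq_fderiv, map_neg, neg_mul]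
    at h
  rw [integral_neg] at h
  have h1 : ∫ p in quadrant, fderiv ℝ η p v * trial d p = ∫ p, fderiv ℝ η p v * trial d p := by
    refine setIntegral_eq_integral_of_forall_compl_eq_zero fun p hp => ?_
    have : fderiv ℝ η p = 0 :=
      image_eq_zero_of_notMem_tsupport fun hp' => hp (hηq (tsupport_fderiv_subset ℝ hp'))
    rw [this, zero_apply, zero_mul]
  have h2 : ∫ p in quadrant, η p * lineDeriv ℝ (trial d) p v =
      ∫ p, lineDeriv ℝ (trial d) p v * η p := by
    rw [setIntegral_eq_integral_of_forall_compl_eq_zero fun p hp => by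
      rw [image_eq_zero_of_notMem_tsupport fun hp' => hp (hηq hp'), zero_mul]]
    simp_rw [mul_comm]
  simp_rw [← Complex.ofReal_mul]
  rw [integral_complex_ofReal, integral_complex_ofReal, h1, h2, h, ← Complex.ofReal_neg, neg_neg]

/-! ### Energy of the trial function -/

section Trial

variable {d : ℝ}

/-- The coefficient of the second mode in the trial function. -/
def trialCoeff (d y : ℝ) : ℝ := if y < d then -(1 / 10) * (1 - y / d) else 0

/-- The derivative of the coefficient of the second mode. -/
def trialCoeffDeriv (d y : ℝ) : ℝ := if y < d then 1 / (10 * d) else 0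

theorem hasLineDerivAt_sine_modes (k α β γ δ : ℝ) (z v : ℝ × ℝ) :
    HasLineDerivAt ℝ (fun w : ℝ × ℝ => (α + β * w.2) * Real.sin (k * (w.1 - w.2)) +
        (γ + δ * w.2) * Real.sin (2 * (k * (w.1 - w.2))))
      (k * ((α + β * z.2) * Real.cos (k * (z.1 - z.2)) +
          2 * (γ + δ * z.2) * Real.cos (2 * (k * (z.1 - z.2)))) * (v.1 - v.2) +
        (β * Real.sin (k * (z.1 - z.2)) + δ * Real.sin (2 * (k * (z.1 - z.2)))) * v.2) z v := by
  unfold HasLineDerivAt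
  have hy : HasDerivAt (fun t : ℝ => (z + t • v).2) v.2 0 := by
    simpa using ((hasDerivAt_id (0 : ℝ)).mul_const v.2).const_add z.2
  have hx : HasDerivAt (fun t : ℝ => (z + t • v).1) v.1 0 := by
    simpa using ((hasDerivAt_id (0 : ℝ)).mul_const v.1).const_add z.1
  have hp := (hx.sub hy).const_mul k
  have h := (((hy.const_mul β).const_add α).mul hp.sin).add
    (((hy.const_mul δ).const_add γ).mul (hp.const_mul 2).sin)
  refine h.congr_deriv ?_
  simp only [zero_smul, add_zero, Pi.sub_apply]
  ring

/-- The trial function near a generic point of the lower strip. -/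
theorem trial_eventuallyEq (hd : 0 < d) {z : ℝ × ℝ} (hz : z ∈ lowerStrip d (10 * d))
    (hzd : z.2 ≠ d) : trial d =ᶠ[𝓝 z] fun w : ℝ × ℝ =>
      (1 + (-(1 / (10 * d))) * w.2) * Real.sin (Real.pi / d * (w.1 - w.2)) +
        (trialCoeff d z.2 - trialCoeffDeriv d z.2 * z.2 + trialCoeffDeriv d z.2 * w.2) *
          Real.sin (2 * (Real.pi / d * (w.1 - w.2))) := by
  have hopen : IsOpen (lowerStrip d (10 * d)) :=
    (isOpen_Ioo.prod isOpen_Ioo).preimage shearCoord.continuous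
  have hside : ∀ᶠ w : ℝ × ℝ in 𝓝 z, (w.2 < d ↔ z.2 < d) ∧ w.2 ≠ d := by
    rcases lt_or_gt_of_ne hzd with h | h
    · filter_upwards [(continuous_snd.tendsto z).eventually (gt_mem_nhds h)] with w hw
      exact ⟨iff_of_true hw h, hw.ne⟩
    · filter_upwards [(continuous_snd.tendsto z).eventually (lt_mem_nhds h)] with w hw
      exact ⟨iff_of_false (not_lt.2 hw.le) (not_lt.2 h.le), hw.ne'⟩
  filter_upwards [hopen.eventually_mem hz, hside] with w hw hs
  obtain ⟨⟨h1, h2⟩, h3, h4⟩ := hw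
  simp only [shearCoord_apply, zero_add] at h1 h2 h3 h4
  have hsw : trialHalf d w.swap = 0 :=
    trialHalf_eq_zero hd (Or.inl (by simp only [Prod.fst_swap, Prod.snd_swap]; linarith))
  rw [trial, hsw, sub_zero, trialHalf, trialAux, clamp_of_mem h1.le h2.le, clamp_of_mem h3.le h4.le]
  unfold trialCoeff trialCoeffDeriv
  by_cases hzl : z.2 < d
  · rw [clamp_of_mem h3.le (hs.1.2 hzl).le, if_pos hzl, if_pos hzl]
    field_simp
    ring
  · have : d ≤ w.2 := not_lt.1 fun hh => hzl (hs.1.1 hh)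
    rw [clamp_of_ge hd.le this, if_neg hzl, if_neg hzl]
    field_simp
    ring

/-- The density `|∇ψ|² - 2 (π / d)² |ψ|²` of the trial function `ψ`. -/
def trialEnergy (d : ℝ) (z : ℝ × ℝ) : ℝ :=
  (lineDeriv ℝ (trial d) z (1, 0)) ^ 2 + (lineDeriv ℝ (trial d) z (0, 1)) ^ 2 -
    2 * (Real.pi / d) ^ 2 * (trial d z) ^ 2

theorem trialEnergy_eq (hd : 0 < d) {z : ℝ × ℝ} (hz : z ∈ lowerStrip d (10 * d)) (hzd : z.2 ≠ d) :
    trialEnergy d z = trialDensity (Real.pi / d) (1 - z.2 / (10 * d)) (trialCoeff d z.2)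
      (-(1 / (10 * d))) (trialCoeffDeriv d z.2) (z.1 - z.2) := by
  have h := trial_eventuallyEq hd hz hzd
  have h1 := fun v => ((hasLineDerivAt_sine_modes (Real.pi / d) _ _ _ _ z
    v).congr_of_eventuallyEq h).lineDeriv
  rw [trialEnergy, h1, h1, h.eq_of_nhds, trialDensity]
  have e : 1 - z.2 / (10 * d) = 1 + -(1 / (10 * d)) * z.2 := by ring
  rw [e]
  ring

theorem integrableOn_trialEnergy (hd : 0 < d) : IntegrableOn (trialEnergy d) quadrant := by
  have h1 := integrable_norm_sq_of_memLp (memLp_lineDeriv_trial hd (1, 0))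
  have h2 := integrable_norm_sq_of_memLp (memLp_lineDeriv_trial hd (0, 1))
  have h3 := integrable_norm_sq_of_memLp (memLp_trial hd)
  simp only [Complex.norm_real, Real.norm_eq_abs, sq_abs] at h1 h2 h3
  exact (h1.add h2).sub (h3.const_mul _)

theorem trialEnergy_swap (z : ℝ × ℝ) : trialEnergy d z.swap = trialEnergy d z := by
  have h1 := lineDeriv_trial_swap d z (1, 0)
  have h2 := lineDeriv_trial_swap d z (0, 1)
  simp only [Prod.swap_prod_mk] at h1 h2
  rw [trialEnergy, h1, h2, trial_swap, trialEnergy]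
  ring

theorem trialEnergy_eq_zero (hd : 0 < d) {z : ℝ × ℝ} (hz : z.2 < z.1)
    (h : d < z.1 - z.2 ∨ 10 * d < z.2) : trialEnergy d z = 0 := by
  have hev : trial d =ᶠ[𝓝 z] fun _ => 0 := by
    have e1 : ∀ᶠ w : ℝ × ℝ in 𝓝 z, w.2 < w.1 :=
      (isOpen_lt continuous_snd continuous_fst).eventually_mem hz
    have e2 : ∀ᶠ w : ℝ × ℝ in 𝓝 z, d < w.1 - w.2 ∨ 10 * d < w.2 :=
      ((isOpen_lt continuous_const (continuous_fst.sub continuous_snd)).union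
        (isOpen_lt continuous_const continuous_snd)).eventually_mem h
    filter_upwards [e1, e2] with w h1 h2
    have hsw : trialHalf d w.swap = 0 :=
      trialHalf_eq_zero hd (Or.inl (by simp only [Prod.fst_swap, Prod.snd_swap]; linarith))
    rw [trial, hsw, sub_zero]
    exact trialHalf_eq_zero hd (Or.inr (h2.imp le_of_lt le_of_lt))
  rw [trialEnergy, hev.lineDeriv_eq, hev.lineDeriv_eq, hev.eq_of_nhds]
  simp [lineDeriv]

theorem setIntegral_trialEnergy (hd : 0 < d) :
    ∫ z in quadrant, trialEnergy d z = 2 * ∫ z in lowerStrip d (10 * d), trialEnergy d z := by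
  refine setIntegral_quadrant_eq_lowerStrip (integrableOn_trialEnergy hd)
    (ae_of_all _ fun z => trialEnergy_swap z) ?_
  filter_upwards [ae_comp_symm shearCoord.symm (ae_fst_ne d), ae_snd_ne (10 * d)]
    with z n1 n2 hzq hzA hzn
  simp only [ContinuousLinearEquiv.symm_symm, shearCoord_apply] at n1
  refine trialEnergy_eq_zero hd hzA ?_
  by_contra! hc
  have hq : 0 < z.2 := hzq.2
  have q1 := lt_of_le_of_ne hc.1 n1
  have q2 := lt_of_le_of_ne hc.2 n2
  refine hzn ⟨⟨?_, ?_⟩, ?_, ?_⟩ <;> simp only [shearCoord_apply] <;> linarith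

/-- The energy density of the trial function, integrated over `x - y`. -/
theorem integral_trialDensity_trialCoeff (hd : 0 < d) (y : ℝ) :
    ∫ p in Set.Ioo 0 d, trialDensity (Real.pi / d) (1 - y / (10 * d)) (trialCoeff d y)
      (-(1 / (10 * d))) (trialCoeffDeriv d y) p =
    1 / (200 * d) + (Set.Iio d).indicator
      (fun y => 3 * Real.pi ^ 2 / (100 * d) * (1 - y / d) ^ 2 - 47 / (200 * d)) y := by
  rw [integral_Ioo_eq_interval hd.le, integral_trialDensity hd]
  by_cases h : y < d
  · rw [Set.indicator_of_mem (Set.mem_Iio.2 h), trialCoeff, trialCoeffDeriv, if_pos h, if_pos h]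
    field_simp
    ring
  · rw [Set.indicator_of_notMem (s := Set.Iio d) h, trialCoeff, trialCoeffDeriv, if_neg h, if_neg h]
    field_simp
    ring

/-- The slow decay of the first mode over the height `10 d` costs `1 / 20`. On `y < d` the second
mode costs `π ^ 2 / 100 + 1 / 200`, and the interference gains `24 / 100`. The total is negative
because `π ^ 2 < 37 / 2`. -/
theorem setIntegral_lowerStrip_trialEnergy (hd : 0 < d) :
    ∫ z in lowerStrip d (10 * d), trialEnergy d z = Real.pi ^ 2 / 100 - 37 / 200 := by
  have hR : MeasurableSet (Set.Ioo 0 (0 + d) ×ˢ Set.Ioo 0 (0 + 10 * d)) :=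
    measurableSet_Ioo.prod measurableSet_Ioo
  have hS := measurableSet_lowerStrip d (10 * d)
  have hint : IntegrableOn (fun z => trialEnergy d (shearCoord.symm z))
      (Set.Ioo 0 (0 + d) ×ˢ Set.Ioo 0 (0 + 10 * d)) := by
    have h1 : Integrable ((lowerStrip d (10 * d)).indicator (trialEnergy d)) :=
      ((integrableOn_trialEnergy hd).mono_set (lowerStrip_subset_quadrant _ _)).integrable_indicator hS
    refine ((integrable_comp_symm shearCoord h1).integrableOn).congr_fun (fun z hz => ?_) hR
    refine Set.indicator_of_mem ?_ _
    rw [lowerStrip, Set.mem_preimage, shearCoord.apply_symm_apply]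
    exact hz
  have e := setIntegral_comp_symm shearCoord hR (trialEnergy d)
  rw [shearCoord_det, abs_one, one_smul] at e
  change _ = ∫ z in lowerStrip d (10 * d), trialEnergy d z at e
  let W : ℝ × ℝ → ℝ := fun z => trialDensity (Real.pi / d) (1 - z.2 / (10 * d)) (trialCoeff d z.2)
      (-(1 / (10 * d))) (trialCoeffDeriv d z.2) z.1
  have hW : (fun z => trialEnergy d (shearCoord.symm z)) =ᵐ[volume.restrict
      (Set.Ioo 0 (0 + d) ×ˢ Set.Ioo 0 (0 + 10 * d))] W := by
    filter_upwards [ae_restrict_mem hR, ae_restrict_of_ae (ae_snd_ne d)] with z hz hzd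
    have hm : shearCoord.symm z ∈ lowerStrip d (10 * d) := by
      rw [lowerStrip, Set.mem_preimage, shearCoord.apply_symm_apply]
      exact hz
    rw [trialEnergy_eq hd hm hzd]
    simp only [W, shearCoord_symm_apply, add_sub_cancel_right]
  rw [← e, integral_congr_ae hW]
  have hWi : IntegrableOn W (Set.Ioo 0 (0 + d) ×ˢ Set.Ioo 0 (0 + 10 * d)) := hint.congr hW
  rw [setIntegral_swap (Set.Ioo 0 (0 + 10 * d)) (Set.Ioo 0 (0 + d)) W, Measure.volume_eq_prod,
    setIntegral_prod (fun z : ℝ × ℝ => W z.swap) hWi.swap]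
  simp only [Prod.swap_prod_mk, W, zero_add]
  simp_rw [integral_trialDensity_trialCoeff hd]
  have hc : Continuous fun y : ℝ =>
      3 * Real.pi ^ 2 / (100 * d) * (1 - y / d) ^ 2 - 47 / (200 * d) := by fun_prop
  rw [integral_add (integrable_const _) ((hc.integrableOn_Icc.mono_set Set.Ioo_subset_Icc_self).indicator
    measurableSet_Iio), setIntegral_indicator measurableSet_Iio]
  have hI : Set.Ioo 0 (10 * d) ∩ Set.Iio d = Set.Ioo 0 d := by
    ext y
    simp only [Set.mem_inter_iff, Set.mem_Ioo, Set.mem_Iio]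
    constructor
    · rintro ⟨⟨h1, -⟩, h2⟩
      exact ⟨h1, h2⟩
    · rintro ⟨h1, h2⟩
      exact ⟨⟨h1, by linarith⟩, h2⟩
  rw [hI, integral_Ioo_eq_interval hd.le]
  have hP : ∀ y ∈ Set.uIcc 0 d, HasDerivAt (fun y => -(Real.pi ^ 2 / 100) * (1 - y / d) ^ 3 -
      47 / (200 * d) * y) (3 * Real.pi ^ 2 / (100 * d) * (1 - y / d) ^ 2 - 47 / (200 * d)) y := by
    intro y _
    have h := ((((hasDerivAt_id y).div_const d).const_sub 1).pow 3).const_mul (-(Real.pi ^ 2 / 100))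
    refine (h.sub ((hasDerivAt_id y).const_mul (47 / (200 * d)))).congr_deriv ?_
    simp only [id_eq, Nat.add_one_sub_one]
    push_cast
    ring
  rw [intervalIntegral.integral_eq_sub_of_hasDerivAt hP (hc.intervalIntegrable _ _)]
  simp only [integral_const, measureReal_restrict_apply_univ, Real.volume_real_Ioo, smul_eq_mul]
  rw [max_eq_left (by linarith)]
  field_simp
  ring

/-- There is a function, independent of `L`, on which the quadratic form is strictly below the bottom
`2 (π / d) ^ 2` of the spectrum of the infinite strip. -/
theorem exists_trial (hd : 0 < d) : ∃ (ψ : L2Quadrant) (g : L2Quadrant × L2Quadrant),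
    (∀ L, 11 * d ≤ L → MemFormDomain d L ψ g) ∧
      ‖g.1‖ ^ 2 + ‖g.2‖ ^ 2 < 2 * (Real.pi / d) ^ 2 * ‖ψ‖ ^ 2 := by
  have hψ := memLp_trial hd
  have hg := memLp_lineDeriv_trial hd
  have aψ := hψ.coeFn_toLp
  refine ⟨hψ.toLp _, ((hg (1, 0)).toLp _, (hg (0, 1)).toLp _), fun L hL => ⟨?_, ?_, ?_⟩, ?_⟩
  · intro η h1 h2 h3
    have key : ∀ v : ℝ × ℝ, ∫ p in quadrant, (fderiv ℝ η p v : ℂ) * hψ.toLp _ p =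
        -∫ p in quadrant, (η p : ℂ) * (hg v).toLp _ p := by
      intro v
      have e1 := integral_fderiv_mul_trial hd h1 h2 h3 v
      have e2 : ∫ p in quadrant, (fderiv ℝ η p v : ℂ) * hψ.toLp _ p =
          ∫ p in quadrant, (fderiv ℝ η p v : ℂ) * (trial d p : ℂ) :=
        integral_congr_ae (aψ.mono fun z hz => by simp only [hz])
      have e3 : ∫ p in quadrant, (η p : ℂ) * (hg v).toLp _ p =
          ∫ p in quadrant, (η p : ℂ) * ((lineDeriv ℝ (trial d) p v : ℝ) : ℂ) :=
        integral_congr_ae ((hg v).coeFn_toLp.mono fun z hz => by simp only [hz])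
      rw [e2, e3, e1]
    exact ⟨key (1, 0), key (0, 1)⟩
  · filter_upwards [aψ, ae_restrict_mem measurableSet_quadrant] with z hz hzq hzp
    rw [hz, trial_eq_zero hd hzq, Complex.ofReal_zero]
    rintro ⟨h1, h2, h3, h4, h5⟩
    exact hzp ⟨h1, h2.trans hL, h3, h4.trans hL, h5⟩
  · filter_upwards [aψ, measurePreserving_swap_quadrant.quasiMeasurePreserving.ae aψ] with z hz hz'
    rw [hz, hz', trial_swap, Complex.ofReal_neg]
  · have e := setIntegral_trialEnergy hd
    rw [setIntegral_lowerStrip_trialEnergy hd] at e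
    have h1 := integrable_norm_sq_of_memLp (hg (1, 0))
    have h2 := integrable_norm_sq_of_memLp (hg (0, 1))
    have h3 := integrable_norm_sq_of_memLp hψ
    have n : ∀ {f : ℝ × ℝ → ℝ} (hf : MemLp (fun z => (f z : ℂ)) 2 (volume.restrict quadrant)),
        ‖hf.toLp _‖ ^ 2 = ∫ z in quadrant, f z ^ 2 := by
      intro f hf
      rw [norm_sq_eq_integral]
      refine integral_congr_ae (hf.coeFn_toLp.mono fun z hz => ?_)
      simp only [hz, Complex.norm_real, Real.norm_eq_abs, sq_abs]
    simp only [Complex.norm_real, Real.norm_eq_abs, sq_abs] at h1 h2 h3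
    unfold trialEnergy at e
    have h12 : Integrable (fun z => lineDeriv ℝ (trial d) z (1, 0) ^ 2 +
      lineDeriv ℝ (trial d) z (0, 1) ^ 2) (volume.restrict quadrant) := h1.add h2
    rw [integral_sub h12 (h3.const_mul _), integral_add h1 h2, integral_const_mul] at e
    simp only [n]
    have := Real.pi_lt_d2
    have := Real.pi_pos
    nlinarith

end Trial

/-! ## The form domain is a closed subspace -/

section FormSubmodule

variable {d L : ℝ}

/-- A function together with its gradient. -/
abbrev PairSpace : Type := L2Quadrant × WithLp 2 (L2Quadrant × L2Quadrant)

/-- The function component. -/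
def PairSpace.fn : PairSpace →L[ℂ] L2Quadrant := ContinuousLinearMap.fst ℂ _ _

/-- The first component of the gradient. -/
def PairSpace.grad₁ : PairSpace →L[ℂ] L2Quadrant :=
  (WithLp.fstL 2 ℂ L2Quadrant L2Quadrant).comp (ContinuousLinearMap.snd ℂ _ _)

/-- The second component of the gradient. -/
def PairSpace.grad₂ : PairSpace →L[ℂ] L2Quadrant :=
  (WithLp.sndL 2 ℂ L2Quadrant L2Quadrant).comp (ContinuousLinearMap.snd ℂ _ _)

open Classical in
/-- The pairing with a real test function, as a continuous functional. -/
def testPairing (η : ℝ × ℝ → ℝ) : L2Quadrant →L[ℂ] ℂ :=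
  if h : MemLp (fun z => (η z : ℂ)) 2 (volume.restrict quadrant) then innerSL ℂ (h.toLp _) else 0

theorem testPairing_apply {η : ℝ × ℝ → ℝ} (hη : Continuous η) (hc : HasCompactSupport η)
    (φ : L2Quadrant) : testPairing η φ = ∫ z in quadrant, (η z : ℂ) * φ z := by
  have h : MemLp (fun z => (η z : ℂ)) 2 (volume.restrict quadrant) :=
    ((Complex.continuous_ofReal.comp hη).memLp_of_hasCompactSupport
      (hc.comp_left Complex.ofReal_zero)).restrict _
  rw [testPairing, dif_pos h, innerSL_apply_apply, L2.inner_def]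
  refine integral_congr_ae (h.coeFn_toLp.mono fun z hz => ?_)
  simp only [hz, RCLike.inner_apply, Complex.conj_ofReal, mul_comm]

/-- Each test function imposes continuous linear conditions. Together with `ae_eq_zero_off_iff` and
`antisymm_iff` this presents the form domain as an intersection of closed kernels, so the form is
closed. -/
theorem hasWeakGradient_iff {φ : L2Quadrant} {g : L2Quadrant × L2Quadrant} :
    HasWeakGradient φ g ↔ ∀ η : ℝ × ℝ → ℝ, ContDiff ℝ ∞ η → HasCompactSupport η →
      tsupport η ⊆ quadrant →
      testPairing (fun p => fderiv ℝ η p (1, 0)) φ + testPairing η g.1 = 0 ∧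
      testPairing (fun p => fderiv ℝ η p (0, 1)) φ + testPairing η g.2 = 0 := by
  refine forall_congr' fun η => forall_congr' fun h1 => forall_congr' fun h2 =>
    forall_congr' fun h3 => ?_
  have hd : ∀ v, Continuous fun p => fderiv ℝ η p v := fun v =>
    (h1.continuous_fderiv (by simp)).clm_apply continuous_const
  have hs : ∀ v, HasCompactSupport fun p => fderiv ℝ η p v := fun v =>
    h2.fderiv_apply (𝕜 := ℝ) v
  rw [testPairing_apply (hd _) (hs _), testPairing_apply (hd _) (hs _),
    testPairing_apply h1.continuous h2, testPairing_apply h1.continuous h2,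
    add_eq_zero_iff_eq_neg, add_eq_zero_iff_eq_neg]

theorem ae_eq_zero_off_iff (φ : L2Quadrant) {D : Set (ℝ × ℝ)} (hD : MeasurableSet D) :
    (∀ᵐ p ∂(volume.restrict quadrant), p ∉ D → φ p = 0) ↔
      LpToLpRestrictCLM (ℝ × ℝ) ℂ ℂ (volume.restrict quadrant) 2 Dᶜ φ = 0 := by
  change (∀ᵐ p ∂(volume.restrict quadrant), p ∈ Dᶜ → φ p = 0) ↔ _
  rw [Lp.eq_zero_iff_ae_eq_zero, ← ae_restrict_iff' hD.compl]
  have h := LpToLpRestrictCLM_coeFn ℂ Dᶜ φ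
  constructor
  · intro h1
    filter_upwards [h, h1] with z hz hz1
    rw [hz, hz1]
    rfl
  · intro h1
    filter_upwards [h, h1] with z hz hz1
    rw [← hz, hz1]
    rfl

/-- The exchange of the two particles. -/
def exchange : L2Quadrant →L[ℂ] L2Quadrant :=
  (Lp.compMeasurePreservingₗᵢ ℂ Prod.swap measurePreserving_swap_quadrant).toContinuousLinearMap

theorem antisymm_iff (φ : L2Quadrant) :
    (∀ᵐ p ∂(volume.restrict quadrant), φ p.swap = -φ p) ↔
      exchange φ + φ = 0 := by
  have h : exchange φ =ᵐ[volume.restrict quadrant] φ ∘ Prod.swap :=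
    Lp.coeFn_compMeasurePreserving φ measurePreserving_swap_quadrant
  rw [Lp.eq_zero_iff_ae_eq_zero]
  have h2 := Lp.coeFn_add (exchange φ) φ
  constructor
  · intro h1
    filter_upwards [h, h1, h2] with z hz hz1 hz2
    rw [hz2, Pi.add_apply, hz, Function.comp_apply, hz1, neg_add_cancel]
    rfl
  · intro h1
    filter_upwards [h, h1, h2] with z hz hz1 hz2
    rw [hz2, Pi.add_apply, hz, Function.comp_apply] at hz1
    exact eq_neg_of_add_eq_zero_left hz1

/-- The form domain as a subspace. -/
def formSubmodule (d L : ℝ) : Submodule ℂ PairSpace :=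
  (⨅ η : {η : ℝ × ℝ → ℝ // ContDiff ℝ ∞ η ∧ HasCompactSupport η ∧ tsupport η ⊆ quadrant},
    LinearMap.ker ((testPairing fun p => fderiv ℝ η.1 p (1, 0)).comp PairSpace.fn +
      (testPairing η.1).comp PairSpace.grad₁).toLinearMap ⊓
    LinearMap.ker ((testPairing fun p => fderiv ℝ η.1 p (0, 1)).comp PairSpace.fn +
      (testPairing η.1).comp PairSpace.grad₂).toLinearMap) ⊓
  (LinearMap.ker ((LpToLpRestrictCLM (ℝ × ℝ) ℂ ℂ (volume.restrict quadrant) 2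
      (pairDomain d L)ᶜ).comp PairSpace.fn).toLinearMap ⊓
    LinearMap.ker ((exchange + ContinuousLinearMap.id ℂ L2Quadrant).comp
      PairSpace.fn).toLinearMap)

theorem isClosed_formSubmodule (d L : ℝ) : IsClosed (formSubmodule d L : Set PairSpace) := by
  unfold formSubmodule
  simp only [Submodule.coe_inf, Submodule.coe_iInf]
  refine (isClosed_iInter fun η => ?_).inter ?_
  · exact (ContinuousLinearMap.isClosed_ker _).inter (ContinuousLinearMap.isClosed_ker _)
  · exact (ContinuousLinearMap.isClosed_ker _).inter (ContinuousLinearMap.isClosed_ker _)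

theorem mem_formSubmodule_iff {w : PairSpace} :
    w ∈ formSubmodule d L ↔ MemFormDomain d L w.1 (w.2.fst, w.2.snd) := by
  have h0 : MemFormDomain d L w.1 (w.2.fst, w.2.snd) ↔ HasWeakGradient w.1 (w.2.fst, w.2.snd) ∧
      (∀ᵐ p ∂(volume.restrict quadrant), p ∉ pairDomain d L → w.1 p = 0) ∧
      ∀ᵐ p ∂(volume.restrict quadrant), w.1 p.swap = -w.1 p :=
    ⟨fun h => ⟨h.1, h.2, h.3⟩, fun h => ⟨h.1, h.2.1, h.2.2⟩⟩
  rw [h0, hasWeakGradient_iff, ae_eq_zero_off_iff _ (isClosed_pairDomain d L).measurableSet,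
    antisymm_iff, formSubmodule, Submodule.mem_inf, Submodule.mem_inf, Submodule.mem_iInf]
  refine and_congr ⟨fun h η h1 h2 h3 => ?_, fun h η => ?_⟩ Iff.rfl
  · exact h ⟨η, h1, h2, h3⟩
  · exact h η.1 η.2.1 η.2.2.1 η.2.2.2

/-! ## Eigenvalue bounds -/

/-- An instance of `le_of_eigenvectors`; the two gradient components are joined with the `L²`
product norm, so that their inner products add. -/
theorem le_of_isBulkEigenvector {κ : Type*} [Fintype κ] (ℓ : κ → L2Quadrant →L[ℂ] ℂ) {Λ E : ℝ}
    {n : ℕ} (hcard : Fintype.card κ < n + 1)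
    (hΛ : ∀ (φ : L2Quadrant) (g : L2Quadrant × L2Quadrant), MemFormDomain d L φ g →
      (∀ k, ℓ k φ = 0) → Λ * ‖φ‖ ^ 2 ≤ ‖g.1‖ ^ 2 + ‖g.2‖ ^ 2)
    {φ : Fin (n + 1) → L2Quadrant} {ε : Fin (n + 1) → ℝ} (hφ : LinearIndependent ℂ φ)
    (h : ∀ i, IsBulkEigenvector d L (ε i) (φ i) ∧ ε i ≤ E) : Λ ≤ E := by
  choose g hg using fun i => (h i).1
  refine le_of_eigenvectors (formSubmodule d L) (fun k => (ℓ k : L2Quadrant →ₗ[ℂ] ℂ))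
    (by simpa using hcard) (fun w hw hk => ?_) φ (fun i => WithLp.toLp 2 (g i)) ε
    (fun i => (h i).2) hφ (fun i => mem_formSubmodule_iff.2 (hg i).1) fun i j => ?_
  · rw [WithLp.prod_norm_sq_eq_of_L2]
    exact hΛ _ _ (mem_formSubmodule_iff.1 hw) hk
  · rw [WithLp.prod_inner_apply]
    exact (hg j).2 (φ i) (g i) (hg i).1

/-- The values allowed in the definition of the `n`-th eigenvalue. -/
def eigenvalueBounds (d L : ℝ) (n : ℕ) : Set ℝ :=
  {E : ℝ | ∃ (φ : Fin (n + 1) → L2Quadrant) (ε : Fin (n + 1) → ℝ),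
    LinearIndependent ℂ φ ∧ ∀ i, IsBulkEigenvector d L (ε i) (φ i) ∧ ε i ≤ E}

theorem bulkEigenvalue_eq_sInf (d L : ℝ) (n : ℕ) :
    bulkEigenvalue d L n = sInf (eigenvalueBounds d L n) := rfl

theorem eigenvalueBounds_anti {n m : ℕ} (h : n ≤ m) :
    eigenvalueBounds d L m ⊆ eigenvalueBounds d L n := by
  rintro E ⟨φ, ε, hφ, hE⟩
  have hle : n + 1 ≤ m + 1 := by omega
  exact ⟨fun i => φ (Fin.castLE hle i), fun i => ε (Fin.castLE hle i),
    hφ.comp _ (Fin.castLE_injective hle), fun i => hE _⟩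

/-- Nonemptiness matters because `sInf ∅ = 0` in `ℝ`, and existence of the higher eigenvalues is not
established. -/
theorem le_bulkEigenvalue {κ : Type*} [Fintype κ] (ℓ : κ → L2Quadrant →L[ℂ] ℂ) {Λ : ℝ}
    {n : ℕ} (hcard : Fintype.card κ < n + 1)
    (hΛ : ∀ (φ : L2Quadrant) (g : L2Quadrant × L2Quadrant), MemFormDomain d L φ g →
      (∀ k, ℓ k φ = 0) → Λ * ‖φ‖ ^ 2 ≤ ‖g.1‖ ^ 2 + ‖g.2‖ ^ 2)
    (hne : (eigenvalueBounds d L n).Nonempty) : Λ ≤ bulkEigenvalue d L n :=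
  le_csInf hne fun _ ⟨_, _, hφ, h⟩ => le_of_isBulkEigenvector ℓ hcard hΛ hφ h

/-- All eigenvalues but the lowest lie above the bottom of the spectrum of the infinite strip. -/
theorem two_mul_sq_le_bulkEigenvalue (hd : 0 < d) {n : ℕ} (hn : 1 ≤ n)
    (hne : (eigenvalueBounds d L n).Nonempty) : 2 * (Real.pi / d) ^ 2 ≤ bulkEigenvalue d L n := by
  obtain ⟨ℓ, C, h⟩ := exists_functional_gap hd
  refine le_bulkEigenvalue (fun _ : Unit => ℓ) (by simpa using Nat.pos_of_ne_zero (by omega)) (fun φ g hφ hk => ?_) hne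
  have := h L φ g hφ
  rwa [hk (), norm_zero, sq (0 : ℝ), mul_zero, mul_zero, add_zero] at this

/-- The lowest eigenvalue stays strictly below the bottom of the spectrum of the infinite strip. -/
theorem exists_bulkEigenvalue_zero_le (hd : 0 < d) : ∃ γ : ℝ, 0 < γ ∧ ∀ L, 11 * d ≤ L →
    bulkEigenvalue d L 0 ≤ 2 * (Real.pi / d) ^ 2 - γ := by
  obtain ⟨ℓ, C, hgap⟩ := exists_functional_gap hd
  obtain ⟨ψ, g, hψ, hlt⟩ := exists_trial hd
  have hψ0 : ψ ≠ 0 := by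
    rintro rfl
    rw [norm_zero, sq (0 : ℝ), mul_zero, mul_zero] at hlt
    exact absurd hlt (not_lt.2 (by positivity))
  have hpos : 0 < ‖ψ‖ ^ 2 := by positivity
  refine ⟨2 * (Real.pi / d) ^ 2 - (‖g.1‖ ^ 2 + ‖g.2‖ ^ 2) / ‖ψ‖ ^ 2, ?_, fun L hL => ?_⟩
  · rw [sub_pos, div_lt_iff₀ hpos]
    exact hlt
  · obtain ⟨E, hE, w, hw, hw0, h⟩ := exists_ground_state (formSubmodule d L)
      (isClosed_formSubmodule d L) ℓ (C := C) (Λ := 2 * (Real.pi / d) ^ 2)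
      (Λ' := (‖g.1‖ ^ 2 + ‖g.2‖ ^ 2) / ‖ψ‖ ^ 2) (by rwa [div_lt_iff₀ hpos])
      (fun w hw => by
        rw [WithLp.prod_norm_sq_eq_of_L2]
        exact hgap L _ _ (mem_formSubmodule_iff.1 hw))
      (ψ := (ψ, WithLp.toLp 2 g)) (mem_formSubmodule_iff.2 (hψ L hL)) hψ0
      (by
        rw [WithLp.prod_norm_sq_eq_of_L2, div_mul_cancel₀ _ hpos.ne']
        rfl)
    have hmem : E ∈ eigenvalueBounds d L 0 := by
      refine ⟨fun _ => w.1, fun _ => E, linearIndependent_unique_iff (ι := Fin 1) |>.2 hw0, fun _ => ⟨⟨_,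
        mem_formSubmodule_iff.1 hw, fun φ f hf => ?_⟩, le_rfl⟩⟩
      have := h (φ, WithLp.toLp 2 f) (mem_formSubmodule_iff.2 hf)
      rwa [WithLp.prod_inner_apply] at this
    have hbdd : BddBelow (eigenvalueBounds d L 0) := by
      refine ⟨0, ?_⟩
      rintro E' ⟨φ, ε, hφ, h'⟩
      -- With no functionals at all, nonnegativity of the form bounds every eigenvalue below by
      -- zero.
      refine le_of_isBulkEigenvector (fun e : Empty => e.elim) (by simp) (fun φ f _ _ => ?_) hφ h'
      rw [zero_mul]
      positivity
    rw [bulkEigenvalue_eq_sInf, sub_sub_cancel]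
    exact (csInf_le hbdd hmem).trans hE

/-- The eigenvalues grow at least linearly in `n / L`. -/
theorem exists_le_bulkEigenvalue (hd : 0 < d) : ∃ a : ℝ, 0 < a ∧ ∀ (L : ℝ) (M n : ℕ), 0 < M →
    L ≤ M → (eigenvalueBounds d L n).Nonempty →
      a * (n / M) - 8 * a ≤ bulkEigenvalue d L n := by
  have hpi := Real.pi_pos
  refine ⟨Real.pi ^ 2 / (2 * d ^ 2 + 4) / 8, by positivity, fun L M n hM hL hne => ?_⟩
  set c := Real.pi ^ 2 / (2 * d ^ 2 + 4) with hc
  have hc0 : 0 < c := by positivity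
  -- The largest `m` with `4 m ^ 2 M ≤ n`, so that there are fewer functionals than the `n + 1`
  -- eigenvectors.
  set m := Nat.sqrt (n / (4 * M)) with hm
  obtain ⟨κ, ℓ, hcard, h⟩ := exists_functionals_counting hd m hM
  have h1 : 4 * m ^ 2 * M ≤ n := by
    have e1 : m ^ 2 ≤ n / (4 * M) := Nat.sqrt_le' _
    have e2 := (Nat.le_div_iff_mul_le (by omega)).1 e1
    calc 4 * m ^ 2 * M = m ^ 2 * (4 * M) := by ring
      _ ≤ n := e2
  have h2 := le_bulkEigenvalue ℓ (Nat.lt_succ_of_le (hcard.trans h1))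
    (fun φ g hφ hk => h L φ g hL hφ hk) hne
  refine le_trans ?_ h2
  have h3 : n < (m + 1) ^ 2 * (4 * M) :=
    (Nat.div_lt_iff_lt_mul (by omega)).1 (Nat.lt_succ_sqrt' (n / (4 * M)))
  have h3' : (n : ℝ) < (m + 1) ^ 2 * (4 * M) := by exact_mod_cast h3
  have hM' : (0 : ℝ) < M := by exact_mod_cast hM
  have h4 : (n : ℝ) / M < 4 * (m + 1) ^ 2 := by
    rw [div_lt_iff₀ hM']
    linarith
  -- This is `(m + 1) ^ 2 / 2 ≤ m ^ 2 + 1`; it accounts for the constants `/ 8` and `8 * a`.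
  have h5 : (n : ℝ) / M / 8 - 1 ≤ m ^ 2 := by nlinarith [sq_nonneg ((m : ℝ) - 1)]
  calc c / 8 * (n / M) - 8 * (c / 8) = c * (n / M / 8 - 1) := by ring
    _ ≤ c * m ^ 2 := mul_le_mul_of_nonneg_left h5 hc0.le

end FormSubmodule

open scoped ComplexOrder

/-! ## Occupation numbers -/

theorem posSemidef_pathLaplacian {e : ℕ → ℝ} (he : ∀ i, 0 ≤ e i) (N : ℕ) :
    (pathLaplacian e N).PosSemidef := by
  refine Matrix.PosSemidef.of_dotProduct_mulVec_nonneg (pathLaplacian_isHermitian e N) fun f => ?_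
  have hw : ∀ i j : Fin N, 0 ≤ edgeWeight e i j := by
    intro i j
    unfold edgeWeight
    split_ifs <;> first | exact he _ | exact le_rfl
  set S : ℂ := star f ⬝ᵥ (pathLaplacian e N).mulVec f with hS
  have h1 : S = ∑ i, ∑ j, (edgeWeight e i j : ℂ) * (star (f i) * (f i - f j)) := by
    rw [hS, dotProduct]
    refine Finset.sum_congr rfl fun i _ => ?_
    rw [pathLaplacian_mulVec, Pi.star_apply, Finset.mul_sum]
    exact Finset.sum_congr rfl fun j _ => by ring
  have h2 : S = ∑ i, ∑ j, (edgeWeight e i j : ℂ) * (star (f j) * (f j - f i)) := by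
    rw [h1, Finset.sum_comm]
    exact Finset.sum_congr rfl fun i _ => Finset.sum_congr rfl fun j _ => by
      rw [edgeWeight_comm]
  -- Averaging the double sum with its transpose, the weights being symmetric, leaves weighted
  -- squared differences.
  have h3 : S = ((1 / 2 * ∑ i, ∑ j, edgeWeight e i j * ‖f i - f j‖ ^ 2 : ℝ) : ℂ) := by
    have h4 : S + S = ∑ i, ∑ j, (edgeWeight e i j : ℂ) * ((‖f i - f j‖ ^ 2 : ℝ) : ℂ) := by
      nth_rw 1 [h1]
      rw [h2, ← Finset.sum_add_distrib]
      refine Finset.sum_congr rfl fun i _ => ?_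
      rw [← Finset.sum_add_distrib]
      refine Finset.sum_congr rfl fun j _ => ?_
      rw [← Complex.normSq_eq_norm_sq, ← Complex.mul_conj, map_sub]
      simp only [RCLike.star_def]
      ring
    push_cast at h4 ⊢
    rw [← h4]
    ring
  rw [h3]
  refine Complex.zero_le_real.2 (mul_nonneg (by norm_num) (Finset.sum_nonneg fun i _ =>
    Finset.sum_nonneg fun j _ => mul_nonneg (hw i j) (by positivity)))

theorem surfaceEigenvalue_nonneg {e : ℕ → ℝ} (he : ∀ i, 0 ≤ e i) (N : ℕ) (j : Fin N) :
    0 ≤ surfaceEigenvalue e N j :=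
  (posSemidef_pathLaplacian he N).eigenvalues_nonneg j

theorem occupation_pos {β μ E : ℝ} (hβ : 0 < β) (h : μ < E) : 0 < occupation β μ E := by
  have : 1 < Real.exp (β * (E - μ)) := Real.one_lt_exp_iff.2 (mul_pos hβ (sub_pos.2 h))
  exact one_div_pos.2 (sub_pos.2 this)

theorem occupation_anti {β μ E E' : ℝ} (hβ : 0 < β) (h : μ < E) (hE : E ≤ E') :
    occupation β μ E' ≤ occupation β μ E := by
  have h1 : 1 < Real.exp (β * (E - μ)) := Real.one_lt_exp_iff.2 (mul_pos hβ (sub_pos.2 h))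
  have h2 : Real.exp (β * (E - μ)) ≤ Real.exp (β * (E' - μ)) := Real.exp_le_exp.2 (by gcongr)
  exact one_div_le_one_div_of_le (sub_pos.2 h1) (by linarith)

/-- Write the occupation number as `x / (1 - x)` with `x = e ^ (-β (E - μ))`. The numerator is
bounded using `μ ≤ t`, and the denominator using the gap `E - μ ≥ γ`. -/
theorem occupation_le_exp {β μ E γ t : ℝ} (hβ : 0 < β) (hγ : 0 < γ) (hμ : μ ≤ t - γ)
    (hE : t ≤ E) : occupation β μ E ≤ Real.exp (-(β * (E - t))) / (1 - Real.exp (-(β * γ))) := by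
  have h0 : Real.exp (-(β * γ)) < 1 := Real.exp_lt_one_iff.2 (by nlinarith)
  have h1 : Real.exp (-(β * (E - μ))) ≤ Real.exp (-(β * γ)) :=
    Real.exp_le_exp.2 (neg_le_neg (mul_le_mul_of_nonneg_left (by linarith) hβ.le))
  have h2 : Real.exp (-(β * (E - μ))) ≤ Real.exp (-(β * (E - t))) :=
    Real.exp_le_exp.2 (neg_le_neg (mul_le_mul_of_nonneg_left (by linarith) hβ.le))
  have h3 : occupation β μ E = Real.exp (-(β * (E - μ))) / (1 - Real.exp (-(β * (E - μ)))) := by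
    have hp := Real.exp_pos (β * (E - μ))
    rw [occupation, Real.exp_neg]
    have hne : Real.exp (β * (E - μ)) - 1 ≠ 0 := by
      have : 1 < Real.exp (β * (E - μ)) := Real.one_lt_exp_iff.2 (mul_pos hβ (by linarith))
      linarith
    have hne' : 1 - (Real.exp (β * (E - μ)))⁻¹ ≠ 0 := by
      intro h
      apply hne
      field_simp at h
      rwa [mul_zero] at h
    field_simp
  rw [h3]
  exact div_le_div₀ (Real.exp_pos _).le h2 (by linarith) (by linarith)

/-- From `e ^ u ≥ 1 + u`. For `u` of order `1 / L` it bounds the sum of the geometric series with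
ratio `e ^ (-u)` linearly in `L`. -/
theorem one_div_one_sub_exp_neg_le {u : ℝ} (hu : 0 < u) : 1 / (1 - Real.exp (-u)) ≤ 1 + 1 / u := by
  have h1 : 1 + u ≤ Real.exp u := by linarith [Real.add_one_le_exp u]
  have h2 : Real.exp (-u) ≤ 1 / (1 + u) := by
    rw [Real.exp_neg, ← one_div]
    exact one_div_le_one_div_of_le (by linarith) h1
  have h3 : u / (1 + u) ≤ 1 - Real.exp (-u) := by
    have : u / (1 + u) = 1 - 1 / (1 + u) := by field_simp; ring
    linarith
  calc 1 / (1 - Real.exp (-u)) ≤ 1 / (u / (1 + u)) :=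
        one_div_le_one_div_of_le (by positivity) h3
    _ = 1 + 1 / u := by field_simp; ring

/-! ## Bulk -/

/-- When the occupation numbers are summable, empty index sets in the definition of the eigenvalues do
not contribute. -/
theorem occupation_eq_zero_of_empty {β d L μ : ℝ}
    (hs : Summable fun n => occupation β μ (bulkEigenvalue d L n)) {n : ℕ}
    (hn : ¬ (eigenvalueBounds d L n).Nonempty) : occupation β μ (bulkEigenvalue d L n) = 0 := by
  have hm : ∀ m, n ≤ m → bulkEigenvalue d L m = 0 := by
    intro m hm
    have : eigenvalueBounds d L m = ∅ := by
      by_contra hne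
      exact hn ((Set.nonempty_iff_ne_empty.2 hne).mono (eigenvalueBounds_anti hm))
    rw [bulkEigenvalue_eq_sInf, this, Real.sInf_empty]
  rw [hm n le_rfl]
  -- All later indices carry the same default energy zero, so the terms are eventually constant;
  -- summability forces the constant to vanish.
  refine tendsto_nhds_unique (tendsto_const_nhds.congr' ?_) hs.tendsto_atTop_zero
  filter_upwards [eventually_ge_atTop n] with m h
  rw [hm m h]

/-- The bulk density outside the ground state is bounded uniformly in `L` and `μ`. -/
theorem exists_bulkNumber_le {d β : ℝ} (hd : 0 < d) (hβ : 0 < β) : ∃ C : ℝ, 0 ≤ C ∧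
    ∀ L μ : ℝ, 11 * d ≤ L → 1 ≤ L → μ < bulkEigenvalue d L 0 →
      bulkNumber β d L μ ≤ occupation β μ (bulkEigenvalue d L 0) + L * C := by
  obtain ⟨γ, hγ, hE0⟩ := exists_bulkEigenvalue_zero_le hd
  obtain ⟨a, ha, hE⟩ := exists_le_bulkEigenvalue hd
  set t := 2 * (Real.pi / d) ^ 2 with ht
  have hγ1 : 0 < 1 - Real.exp (-(β * γ)) := sub_pos.2 (Real.exp_lt_one_iff.2 (by nlinarith))
  -- The exponential absorbs the offset `8 a` of the linear lower bound and the reference energy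
  -- `t`; the denominator comes from the gap.
  set K := Real.exp (β * (8 * a + t)) / (1 - Real.exp (-(β * γ))) with hK
  have hK0 : 0 < K := by positivity
  refine ⟨K * (1 + 2 / (β * a)), by positivity, fun L μ hL hL1 hμ => ?_⟩
  have hμt : μ ≤ t - γ := hμ.le.trans (hE0 L hL)
  -- The counting bound needs an integer length; as `L ≥ 1`, rounding up at most doubles it, whence
  -- the 2 in `C`.
  set M := ⌈L⌉₊ with hM
  have hLM : L ≤ M := Nat.le_ceil L
  have hM0 : 0 < M := Nat.ceil_pos.2 (by linarith)
  have hM0' : (0 : ℝ) < M := by exact_mod_cast hM0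
  have hM2 : (M : ℝ) ≤ 2 * L := by linarith [Nat.ceil_lt_add_one (show 0 ≤ L by linarith)]
  by_cases hs : Summable fun n => occupation β μ (bulkEigenvalue d L n)
  · set q := Real.exp (-(β * a / M)) with hq
    have hu : 0 < β * a / M := by positivity
    have hq1 : q < 1 := Real.exp_lt_one_iff.2 (by linarith)
    have hq0 : 0 ≤ q := (Real.exp_pos _).le
    have hterm : ∀ n : ℕ, occupation β μ (bulkEigenvalue d L (n + 1)) ≤ K * q ^ n := by
      intro n
      by_cases hne : (eigenvalueBounds d L (n + 1)).Nonempty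
      · have h1 := two_mul_sq_le_bulkEigenvalue hd (Nat.le_add_left 1 n) hne
        have h2 := hE L M (n + 1) hM0 hLM hne
        refine (occupation_le_exp hβ hγ hμt h1).trans ?_
        rw [hK, div_mul_eq_mul_div]
        refine div_le_div_of_nonneg_right ?_ hγ1.le
        rw [hq, ← Real.exp_nat_mul, ← Real.exp_add, Real.exp_le_exp]
        have h3 : a * (n / M) ≤ a * (((n + 1 : ℕ) : ℝ) / M) := by
          push_cast
          gcongr
          linarith
        have h4 : β * (a * (n / M) - 8 * a) ≤ β * bulkEigenvalue d L (n + 1) :=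
          mul_le_mul_of_nonneg_left (by linarith) hβ.le
        have h5 : (n : ℝ) * -(β * a / M) = -(β * (a * (n / M))) := by ring
        rw [h5]
        linarith
      · rw [occupation_eq_zero_of_empty hs hne]
        positivity
    rw [bulkNumber, hs.tsum_eq_zero_add]
    refine add_le_add_right ?_ _
    have hg := summable_geometric_of_lt_one hq0 hq1
    calc ∑' n : ℕ, occupation β μ (bulkEigenvalue d L (n + 1)) ≤ ∑' n : ℕ, K * q ^ n :=
          ((summable_nat_add_iff 1).2 hs).tsum_le_tsum hterm (hg.mul_left K)
      _ = K * (1 / (1 - q)) := by rw [tsum_mul_left, tsum_geometric_of_lt_one hq0 hq1, one_div]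
      _ ≤ K * (1 + 1 / (β * a / M)) :=
          mul_le_mul_of_nonneg_left (one_div_one_sub_exp_neg_le hu) hK0.le
      _ ≤ K * (L * (1 + 2 / (β * a))) := by
          refine mul_le_mul_of_nonneg_left ?_ hK0.le
          have : 1 / (β * a / M) ≤ L * (2 / (β * a)) := by
            rw [one_div_div, mul_div_assoc']
            exact div_le_div_of_nonneg_right (by linarith) (by positivity)
          linarith
      _ = L * (K * (1 + 2 / (β * a))) := by ring
  -- A divergent series has the conventional sum zero, and the right-hand side is nonnegative.
  · rw [bulkNumber, tsum_eq_zero_of_not_summable hs]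
    exact add_nonneg (occupation_pos hβ hμ).le (by positivity)

/-- A nonzero sum rules out divergence. The remaining terms are nonnegative, since genuine higher
eigenvalues lie above the threshold, hence above `μ`, and empty index sets contribute zero. -/
theorem occupation_le_bulkNumber {d β : ℝ} (hd : 0 < d) (hβ : 0 < β) {L μ : ℝ} (hL : 11 * d ≤ L)
    (hμ : μ < bulkEigenvalue d L 0) (hs : bulkNumber β d L μ ≠ 0) :
    occupation β μ (bulkEigenvalue d L 0) ≤ bulkNumber β d L μ := by
  have hs : Summable fun n => occupation β μ (bulkEigenvalue d L n) := by
    by_contra h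
    exact hs (tsum_eq_zero_of_not_summable h)
  refine hs.le_tsum 0 fun n hn => ?_
  by_cases hne : (eigenvalueBounds d L n).Nonempty
  · obtain ⟨γ, hγ, hE0⟩ := exists_bulkEigenvalue_zero_le hd
    have h1 := two_mul_sq_le_bulkEigenvalue hd (Nat.one_le_iff_ne_zero.2 hn) hne
    exact (occupation_pos hβ (by linarith [hE0 L hL])).le
  · exact (occupation_eq_zero_of_empty hs hne).ge

/-! ## Surface -/

theorem surfaceNumber_nonneg {β α lam μ s : ℝ} {e : ℕ → ℝ} (hβ : 0 < β) (he : ∀ i, 0 ≤ e i) (N : ℕ)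
    (hμ : μ < lam * s - α) : 0 ≤ surfaceNumber β α lam e N μ s :=
  Finset.sum_nonneg fun j _ =>
    (occupation_pos hβ (by linarith [surfaceEigenvalue_nonneg he N j])).le

/-- The mean-field repulsion bounds the surface pair density. -/
theorem surfaceDensity_le {β α lam μ s t : ℝ} {e : ℕ → ℝ} (hβ : 0 < β) (hlam : 0 < lam)
    (he : ∀ i, 0 ≤ e i) (N : ℕ) (hμ : μ ≤ t)
    (hs : s = 1 / (N : ℝ) * surfaceNumber β α lam e N μ s) :
    s ≤ max ((t + α + 1) / lam) (1 / (Real.exp β - 1)) := by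
  -- If `s` exceeds the first bound, all levels lie at least 1 above `μ`, so the average occupation
  -- is at most `1 / (e ^ β - 1)`. By self-consistency this average is `s`, contradicting the second
  -- bound.
  by_contra! h
  obtain ⟨h1, h2⟩ := max_lt_iff.1 h
  rw [div_lt_iff₀ hlam] at h1
  have hb : 0 < 1 / (Real.exp β - 1) := one_div_pos.2 (sub_pos.2 (Real.one_lt_exp_iff.2 hβ))
  have h3 : surfaceNumber β α lam e N μ s ≤ N * (1 / (Real.exp β - 1)) := by
    have : ∀ j ∈ (Finset.univ : Finset (Fin N)),
        occupation β μ (surfaceEigenvalue e N j - α + lam * s) ≤ 1 / (Real.exp β - 1) := by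
      intro j _
      have h4 := occupation_anti (μ := μ) (E := μ + 1)
        (E' := surfaceEigenvalue e N j - α + lam * s) hβ (by linarith)
        (by linarith [surfaceEigenvalue_nonneg he N j])
      rwa [occupation, occupation, add_sub_cancel_left, mul_one, ← occupation] at h4
    simpa [surfaceNumber] using Finset.sum_le_card_nsmul _ _ _ this
  have h4 : 1 / (N : ℝ) * surfaceNumber β α lam e N μ s ≤ 1 / (Real.exp β - 1) := by
    rcases Nat.eq_zero_or_pos N with rfl | hN
    · simp only [Nat.cast_zero, div_zero, zero_mul]
      exact hb.le
    · have hN' : (0 : ℝ) < N := by exact_mod_cast hN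
      rw [one_div_mul_eq_div, div_le_iff₀ hN']
      linarith
  linarith

end ElectronPairs

end

/-! ### Conclusion: the ground state carries the excess density -/

theorem mainTheorem1 (d β δ α lam : ℝ) (hd : 0 < d) (hβ : 0 < β) (hδ : 0 < δ) (hα : 0 ≤ α)
    (hlam : 0 < lam) :
    ∃ ρcrit : ℝ, 0 < ρcrit ∧
      ∀ e : ℕ → ℝ, (∀ i, 0 ≤ e i) →
      ∀ N : ℝ → ℕ, Tendsto (fun L : ℝ => L / (N L : ℝ)) atTop (𝓝 δ) →
      ∀ ρ : ℝ, ρcrit < ρ →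
      -- a thermodynamic limit: lengths, chemical potentials and surface pair densities
      ∀ L μ s : ℕ → ℝ, (∀ k, 0 < L k) → Tendsto L atTop atTop →
        (∀ k, 0 ≤ s k) →
        (∀ k, μ k < min (lam * s k - α) (ElectronPairs.bulkEigenvalue d (L k) 0)) →
        (∀ k, s k = 1 / (N (L k) : ℝ) *
          ElectronPairs.surfaceNumber β α lam e (N (L k)) (μ k) (s k)) →
        Tendsto (fun k => 1 / L k *
          (ElectronPairs.surfaceNumber β α lam e (N (L k)) (μ k) (s k) +
            ElectronPairs.bulkNumber β d (L k) (μ k))) atTop (𝓝 ρ) →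
        -- the ground state density is bounded away from zero, ...
        (∃ c : ℝ, 0 < c ∧ ∀ᶠ k in atTop, c ≤ 1 / L k *
          ElectronPairs.occupation β (μ k) (ElectronPairs.bulkEigenvalue d (L k) 0)) ∧
        -- ... and it has, up to passing to a subsequence, a positive limit
        (∀ a : ℕ → ℕ, StrictMono a → ∃ b : ℕ → ℕ, StrictMono b ∧ ∃ r : ℝ, 0 < r ∧
          Tendsto (fun k => 1 / L (a (b k)) *
            ElectronPairs.occupation β (μ (a (b k)))
              (ElectronPairs.bulkEigenvalue d (L (a (b k))) 0)) atTop (𝓝 r)) := by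
  open ElectronPairs in
  obtain ⟨C, hC, hbulk⟩ := exists_bulkNumber_le hd hβ
  obtain ⟨γ, hγ, hE0⟩ := exists_bulkEigenvalue_zero_le hd
  set t := 2 * (Real.pi / d) ^ 2
  set S := max ((t + α + 1) / lam) (1 / (Real.exp β - 1)) with hS
  have hS0 : 0 ≤ S := le_max_of_le_right
    (one_div_pos.2 (sub_pos.2 (Real.one_lt_exp_iff.2 hβ))).le
  -- The first term bounds the surface density for long wires, the second the density of the excited
  -- bulk states. The extra 1 becomes the lower bound for the ground state density.
  refine ⟨2 / δ * S + C + 1, by positivity, ?_⟩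
  intro e he N hN ρ hρ L μ s hL0 hL hs0 hμ hs hlim
  have hμ1 : ∀ k, μ k < lam * s k - α := fun k => (hμ k).trans_le (min_le_left _ _)
  have hμ2 : ∀ k, μ k < bulkEigenvalue d (L k) 0 := fun k => (hμ k).trans_le (min_le_right _ _)
  set r : ℕ → ℝ := fun k => 1 / L k * occupation β (μ k) (bulkEigenvalue d (L k) 0) with hr
  -- The last condition gives `n(L) / L < 2 / δ`. It also excludes `n(L) = 0`, where the quotient is
  -- zero by convention.
  have hlarge : ∀ᶠ k in atTop, 11 * d ≤ L k ∧ 1 ≤ L k ∧ δ / 2 < L k / N (L k) :=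
    (hL.eventually_ge_atTop _).and ((hL.eventually_ge_atTop _).and
      ((hN.comp hL).eventually (lt_mem_nhds (by linarith))))
  have hsurf : ∀ᶠ k in atTop, 1 / L k * surfaceNumber β α lam e (N (L k)) (μ k) (s k) ≤
      2 / δ * S := by
    filter_upwards [hlarge] with k hk
    have hN0 : (0 : ℝ) < N (L k) := by
      rcases Nat.eq_zero_or_pos (N (L k)) with h | h
      · have := hk.2.2
        rw [h, Nat.cast_zero, div_zero] at this
        linarith
      · exact_mod_cast h
    have hsk := surfaceDensity_le (t := t) hβ hlam he (N (L k))
      ((hμ2 k).le.trans ((hE0 _ hk.1).trans (by linarith))) (hs k)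
    have h1 : surfaceNumber β α lam e (N (L k)) (μ k) (s k) = N (L k) * s k := by
      conv_rhs => rw [hs k]
      field_simp
    have h2 : (N (L k) : ℝ) / L k ≤ 2 / δ := by
      have := hk.2.2
      rw [lt_div_iff₀ hN0] at this
      rw [div_le_div_iff₀ (hL0 k) hδ]
      linarith
    calc 1 / L k * surfaceNumber β α lam e (N (L k)) (μ k) (s k) = N (L k) / L k * s k := by
          rw [h1]
          ring
      _ ≤ 2 / δ * S := mul_le_mul h2 hsk (hs0 k) (by positivity)
  have hlower : ∀ᶠ k in atTop, 1 ≤ r k := by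
    filter_upwards [hlarge, hsurf, hlim.eventually (lt_mem_nhds hρ)] with k hk h1 h2
    have h3 := mul_le_mul_of_nonneg_left (hbulk (L k) (μ k) hk.1 hk.2.1 (hμ2 k))
      (one_div_pos.2 (hL0 k)).le
    have h4 : 1 / L k * (L k * C) = C := by
      have := (hL0 k).ne'
      field_simp
    rw [mul_add, h4] at h3
    rw [mul_add] at h2
    simp only [hr]
    linarith
  have hupper : ∀ᶠ k in atTop, r k ≤ ρ + 1 := by
    filter_upwards [hlarge, hsurf, hlim.eventually (lt_mem_nhds hρ),
      hlim.eventually (gt_mem_nhds (lt_add_one ρ))] with k hk h1 h2 h3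
    rw [mul_add] at h2 h3
    -- If the bulk sum were zero, in particular if its series diverged, the surface alone would
    -- carry more than `2 / δ * S`.
    have hne : bulkNumber β d (L k) (μ k) ≠ 0 := by
      intro h0
      rw [h0, mul_zero, add_zero] at h2
      linarith
    have h4 := mul_le_mul_of_nonneg_left (occupation_le_bulkNumber hd hβ hk.1 (hμ2 k) hne)
      (one_div_pos.2 (hL0 k)).le
    have h5 := mul_nonneg (one_div_pos.2 (hL0 k)).le
      (surfaceNumber_nonneg (α := α) hβ he (N (L k)) (hμ1 k))
    simp only [hr]
    linarith
  refine ⟨⟨1, one_pos, hlower⟩, fun a ha => ?_⟩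
  -- The upper bound confines the ground state densities to a compact interval, and the lower bound
  -- makes every limit point positive.
  have hmem : ∀ᶠ k in atTop, r (a k) ∈ Set.Icc 1 (ρ + 1) :=
    ha.tendsto_atTop.eventually (hlower.and hupper)
  obtain ⟨x, hx, b, hb, hlimb⟩ := isCompact_Icc.tendsto_subseq' hmem.frequently
  exact ⟨b, hb, x, one_pos.trans_le hx.1, hlimb⟩
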